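/- Let $H_{\mathbb R}$ be a finite-dimensional real vector space (for instance $H_{\mathbb Z}\otimes\mathbb R$ for a lattice $H_{\mathbb Z}$), $H=H_{\mathbb R}\otimes\mathbb C$, $n\ge 0$ an integer, $Q$ a real bilinear form on $H_{\mathbb R}$ that is symmetric if $n$ is even and skew-symmetric if $n$ is odd, and $h^{p,q}$ ($p+q=n$) non-negative integers. Let $D$ be the classifying space of $Q$-polarized Hodge structures of weight $n$ with these Hodge numbers, that is, the set of decompositions $H=\bigoplus_{p+q=n}H^{p,q}$ with $\dim H^{p,q}=h^{p,q}$, $H^{p,q}=\overline{H^{q,p}}$, $Q(H^{p,q},H^{p',q'})=0$ unless $p'=n-p$, and $(\sqrt{-1})^{p-q}Q(\phi,\bar\phi)>0$ for $0\ne\phi\in H^{p,q}$. Put $F^p=\bigoplus_{p'\ge p}H^{p',n-p'}$. The holomorphic tangent space of $D$ at a point is contained in $\bigoplus_p\mathrm{Hom}(F^p,H/F^p)$, and a tangent vector $\xi$ is horizontal if $\xi(F^p)\subset F^{p-1}/F^p$ for $p=1,\dots,n$. A horizontal slice is a complex manifold $U$ with a holomorphic immersion $U\to D$ (for example a complex submanifold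 of $D$) all of whose tangent vectors are horizontal. Let $G=\mathrm{Aut}(H_{\mathbb R},Q)$, with Lie algebra $\mathfrak g$ and Killing form $B$. Let $p:D\to D_1$, $\{H^{p,q}\}\mapsto H^+=H^{n,0}\oplus H^{n-2,2}\oplus\cdots$, be the natural projection onto the symmetric space $D_1=G/K$, $K$ being the stabilizer of a point $H^+_0$. At a point $H^+$ of $D_1$, with $H^-=H^{n-1,1}\oplus H^{n-3,3}\oplus\cdots$, the tangent space of $D_1$ is identified with $\mathfrak p=\{X\in\mathfrak g: XH^+\subset H^-,\ XH^-\subset H^+\}$, and the invariant Riemannian metric of $D_1$ is there $cB|_{\mathfrak p}$, where $c>0$ is a fixed constant. Then there is a constant $\kappa>0$, depending only on $H_{\mathbb R}$, $Q$, $n$, the Hodge numbers and $c$, such that for every horizontal slice $U$ of $D$ the following holds. The pull-back to $U$ of the invariant Riemannian metric of $D_1$ under $U\to D\xrightarrow{p}D_1$ is a Kähler metric $g$ (the Hodge metric). Its holomorphic bisectional curvature is nonpositive, its holomorphic sectional curvature is at most $-\kappa$, and its Ricci curvature satisfies $\mathrm{Ric}(u,u)\le-\kappa\,g(u,u)$ for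 all tangent vectors $u$. -/

import Mathlib

open scoped ContDiff ComplexOrder Manifold Topology Matrix

noncomputable section

namespace HodgeSlice

attribute [local instance 100] LieRing.ofAssociativeRing

/-! ### Polarized Hodge structures and the classifying space

`H_ℝ = ℝ^ι` (for an integral structure, a basis of the lattice `H_ℤ` is chosen), `H = ℂ^ι`, complex
conjugation on `H` is `star`, and `Q` is the Gram matrix of the polarization form. -/

section Hodge

variable {ι : Type*} [Fintype ι] [DecidableEq ι]

/-- The complex bilinear extension of `Q` to `H = ℂ^ι`. -/
def complexForm (Q : Matrix ι ι ℝ) (x y : ι → ℂ) : ℂ :=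
  x ⬝ᵥ (Q.map Complex.ofReal *ᵥ y)

/-- The classifying space `D` of Hodge structures of weight `n` with Hodge numbers
`h^{p,n-p} = h p`, polarized by `Q`: decompositions `H = ⨁ H^{p,q}`, `p + q = n`, with
`H^{p,q} = conj H^{q,p}`, on which `Q` satisfies the two Hodge-Riemann relations.
`comp p` is `H^{p,n-p}`, and `p.rev` is `n - p`. -/
structure ClassifyingSpace (Q : Matrix ι ι ℝ) (n : ℕ) (h : Fin (n + 1) → ℕ) where
  comp : Fin (n + 1) → Submodule ℂ (ι → ℂ)
  isInternal : DirectSum.IsInternal comp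
  finrank_comp : ∀ p, Module.finrank ℂ (comp p) = h p
  conj_comp : ∀ p x, star x ∈ comp p.rev ↔ x ∈ comp p
  orthogonal : ∀ p p', p' ≠ p.rev → ∀ x ∈ comp p, ∀ y ∈ comp p', complexForm Q x y = 0
  positive : ∀ p, ∀ x ∈ comp p, x ≠ 0 →
    0 < Complex.I ^ (((p : ℕ) : ℤ) - ((n : ℤ) - ((p : ℕ) : ℤ))) * complexForm Q x (star x)

variable {Q : Matrix ι ι ℝ} {n : ℕ} {h : Fin (n + 1) → ℕ}

/-- The Hodge filtration `F^p = ⨁_{p' ≥ p} H^{p',n-p'}`. -/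
def ClassifyingSpace.fil (F : ClassifyingSpace Q n h) (p : ℕ) : Submodule ℂ (ι → ℂ) :=
  ⨆ (p' : Fin (n + 1)) (_ : p ≤ (p' : ℕ)), F.comp p'

/-- `H^+ = H^{n,0} + H^{n-2,2} + ⋯`. The assignment `F ↦ H^+` is the natural projection
`D = G/V → D₁ = G/K`, a point of `D₁` being the subspace `H^+`. -/
def ClassifyingSpace.plus (F : ClassifyingSpace Q n h) : Submodule ℂ (ι → ℂ) :=
  ⨆ (p : Fin (n + 1)) (_ : Even (n - (p : ℕ))), F.comp p

/-- `H^- = H^{n-1,1} + H^{n-3,3} + ⋯`. -/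
def ClassifyingSpace.minus (F : ClassifyingSpace Q n h) : Submodule ℂ (ι → ℂ) :=
  ⨆ (p : Fin (n + 1)) (_ : Odd (n - (p : ℕ))), F.comp p

variable (Q) in
/-- The Lie algebra `𝔤` of `G = Aut(H_ℝ, Q)`: real matrices `X` with `Xᵀ Q + Q X = 0`. -/
abbrev lieAlg : LieSubalgebra ℝ (Matrix ι ι ℝ) := skewAdjointMatricesLieSubalgebra Q

/-- The action of a real matrix on `H = ℂ^ι`. -/
def act (X : Matrix ι ι ℝ) (w : ι → ℂ) : ι → ℂ := X.map Complex.ofReal *ᵥ w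

/-- `X` lies in the noncompact part `𝔭` of the Cartan decomposition `𝔤 = 𝔣 ⊕ 𝔭` at the point `H^+`
of `D₁`, where `𝔣` is the stabilizer of `H^+` (equivalently, of `H^+` and `H^-`). -/
def ClassifyingSpace.IsNoncompact (F : ClassifyingSpace Q n h) (X : lieAlg Q) : Prop :=
  (∀ w ∈ F.plus, act X.1 w ∈ F.minus) ∧ (∀ w ∈ F.minus, act X.1 w ∈ F.plus)

end Hodge

/-! ### Horizontal slices -/

section Slice

variable {E : Type*} [NormedAddCommGroup E] [NormedSpace ℂ E]
variable {ι : Type*} [Fintype ι] [DecidableEq ι]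
variable {Q : Matrix ι ι ℝ} {n : ℕ} {h : Fin (n + 1) → ℕ}

/-- A family of subspaces of `ℂ^ι` is, near every point of `Ω`, spanned by a holomorphic frame. -/
def IsHolomorphicSubbundleOn (W : E → Submodule ℂ (ι → ℂ)) (Ω : Set E) : Prop :=
  ∀ z ∈ Ω, ∃ (k : ℕ) (s : Fin k → E → ι → ℂ), ∀ᶠ y in 𝓝 z,
    (∀ i, DifferentiableAt ℂ (s i) y) ∧ LinearIndependent ℂ (fun i => s i y) ∧
      Submodule.span ℂ (Set.range fun i => s i y) = W y

/-- `s` is a holomorphic section of the family `W` near `z`. -/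
def IsHolomorphicSectionAt (W : E → Submodule ℂ (ι → ℂ)) (z : E) (s : E → ι → ℂ) : Prop :=
  ∀ᶠ y in 𝓝 z, DifferentiableAt ℂ s y ∧ s y ∈ W y

/-- `ψ` is a holomorphic immersion of the open set `Ω` into `D` which is tangent to the horizontal
distribution. A map to `D` is holomorphic if it pulls back the Hodge bundles `F^p` to holomorphic
subbundles. The differential of `ψ` at `z` in the direction `v` is the element of
`⨁ Hom(F^p, H / F^p)` that sends `s(z)` to the class of `D_v s(z)`, for every holomorphic section
`s` of `F^p` near `z`; it is horizontal if it sends `F^p` to `F^{p-1} / F^p`. -/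
structure IsHorizontalImmersionOn (ψ : E → ClassifyingSpace Q n h) (Ω : Set E) : Prop where
  holomorphic : ∀ p : ℕ, IsHolomorphicSubbundleOn (fun y => (ψ y).fil p) Ω
  horizontal : ∀ z ∈ Ω, ∀ (p : ℕ) (s : E → ι → ℂ),
    IsHolomorphicSectionAt (fun y => (ψ y).fil (p + 1)) z s →
      ∀ v, fderiv ℂ s z v ∈ (ψ z).fil p
  immersion : ∀ z ∈ Ω, ∀ v : E,
    (∀ (p : ℕ) (s : E → ι → ℂ), IsHolomorphicSectionAt (fun y => (ψ y).fil p) z s →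
      fderiv ℂ s z v ∈ (ψ z).fil p) → v = 0

/-- A (possibly only immersed) horizontal slice of `D`: a complex manifold `M` with a holomorphic
immersion `φ` into `D` tangent to the horizontal distribution. -/
def IsHorizontalSlice {M : Type*} [TopologicalSpace M] [ChartedSpace E M]
    (φ : M → ClassifyingSpace Q n h) : Prop :=
  ∀ e ∈ atlas E M, IsHorizontalImmersionOn (φ ∘ e.symm) e.target

/-- `X ∈ 𝔭` is the velocity at `z`, in the direction `v`, of the map `y ↦ H^+(ψ y)` to `D₁`.
The tangent space of `D₁` at `H^+` is identified with `𝔭` (formed at `H^+`) by letting `X`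
correspond to the velocity of `t ↦ exp(tX) H^+` at `t = 0`; as an element of `Hom(H^+, H / H^+)`
this velocity is the restriction of `X`, while the velocity of `y ↦ H^+(ψ y)` sends `s(z)` to the
class of `D_v s(z)` for every section `s` of the family `H^+(ψ y)`. -/
def IsProjectedVelocity (ψ : E → ClassifyingSpace Q n h) (z v : E) (X : lieAlg Q) : Prop :=
  (ψ z).IsNoncompact X ∧
    ∀ s : E → ι → ℂ, DifferentiableAt ℝ s z → (∀ᶠ y in 𝓝 z, s y ∈ (ψ y).plus) →
      fderiv ℝ s z v - act X.1 (s z) ∈ (ψ z).plus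

/-- The element of `𝔭` that corresponds to the image of `v` in the tangent space of `D₁`. -/
def projectedVelocity (ψ : E → ClassifyingSpace Q n h) (z v : E) : lieAlg Q :=
  Classical.epsilon fun X => IsProjectedVelocity ψ z v X

/-- The pull-back by `y ↦ H^+(ψ y)` of the invariant Riemannian metric `c B` of `D₁ = G/K`, `B` the
Killing form of `𝔤`. Since `B` is invariant under `Ad(G)`, translating a tangent vector to a base
point and applying `B` on `𝔭` there is the same as applying `B` on `𝔭` at the given point. -/
def hodgeMetric (c : ℝ) (ψ : E → ClassifyingSpace Q n h) (z u v : E) : ℝ :=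
  c * killingForm ℝ (lieAlg Q) (projectedVelocity ψ z u) (projectedVelocity ψ z v)

end Slice

/-! ### Kähler metrics and curvature in a holomorphic chart

A metric is given in a chart by `g : E → E → E → ℝ`, `g z u v` being the product of `u` and `v` at
`z`; the complex structure `J` is multiplication by `i`. -/

section Curvature

variable {E : Type*} [NormedAddCommGroup E] [NormedSpace ℂ E]

/-- `g` is a smooth Riemannian metric on `Ω`, invariant under `J`, whose fundamental form
`ω(u, v) = g(Ju, v)` is closed. -/
structure IsKahlerOn (g : E → E → E → ℝ) (Ω : Set E) : Prop where
  add_left : ∀ z ∈ Ω, ∀ u u' v, g z (u + u') v = g z u v + g z u' v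
  smul_left : ∀ z ∈ Ω, ∀ (a : ℝ) (u v : E), g z (a • u) v = a * g z u v
  symm : ∀ z ∈ Ω, ∀ u v, g z u v = g z v u
  pos : ∀ z ∈ Ω, ∀ u, u ≠ 0 → 0 < g z u u
  smooth : ∀ u v, ContDiffOn ℝ ∞ (fun z => g z u v) Ω
  hermitian : ∀ z ∈ Ω, ∀ u v, g z (Complex.I • u) (Complex.I • v) = g z u v
  closed : ∀ z ∈ Ω, ∀ u v w,
    fderiv ℝ (fun y => g y (Complex.I • v) w) z u
      + fderiv ℝ (fun y => g y (Complex.I • w) u) z v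
      + fderiv ℝ (fun y => g y (Complex.I • u) v) z w = 0

/-- The Christoffel symbols of the Levi-Civita connection: `Γ(u, v) = ∇_u v` for constant vector
fields `u`, `v`, determined by the Koszul formula. -/
def christoffel (g : E → E → E → ℝ) (z u v : E) : E :=
  Classical.epsilon fun a => ∀ w, 2 * g z a w =
    fderiv ℝ (fun y => g y v w) z u + fderiv ℝ (fun y => g y u w) z v
      - fderiv ℝ (fun y => g y u v) z w

/-- The Riemann curvature `R(u, v) w = ∇_u ∇_v w - ∇_v ∇_u w` for constant vector fields. -/
def curvature (g : E → E → E → ℝ) (z u v w : E) : E :=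
  fderiv ℝ (fun y => christoffel g y v w) z u - fderiv ℝ (fun y => christoffel g y u w) z v
    + christoffel g z u (christoffel g z v w) - christoffel g z v (christoffel g z u w)

/-- The holomorphic bisectional curvature `⟨R(u, Ju) Jv, v⟩ / (|u|² |v|²)`. -/
def bisectionalCurvature (g : E → E → E → ℝ) (z u v : E) : ℝ :=
  g z (curvature g z u (Complex.I • u) (Complex.I • v)) v / (g z u u * g z v v)

/-- The holomorphic sectional curvature: the sectional curvature
`⟨R(u, Ju) Ju, u⟩ / |u|⁴` of the plane spanned by `u` and `Ju`. -/
def holomorphicSectionalCurvature (g : E → E → E → ℝ) (z u : E) : ℝ :=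
  g z (curvature g z u (Complex.I • u) (Complex.I • u)) u / (g z u u) ^ 2

/-- The Ricci curvature `Ric(u, v)`, the real trace of `w ↦ R(w, u) v`. -/
def ricciCurvature [FiniteDimensional ℂ E] (g : E → E → E → ℝ) (z u v : E) : ℝ :=
  ∑ i, (Module.finBasis ℝ E).coord i (curvature g z (Module.finBasis ℝ E i) u v)

end Curvature

end HodgeSlice

end

/-! A horizontal slice is encoded by its grading operators Λ(z), equal to p on H^{p,n-p}, inside the
fixed algebra End(H). Let * denote the adjoint for the flat, indefinite form Q(x, ȳ). Horizontality
gives dΛ = θ + θ*, where the Higgs field θ is complex linear and [Λ, θ] = -θ. The velocity in D₁ is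
the real operator θ - θ*. Since the Killing form is N - 2(-1)^n times the trace form, N = dim H
(`killingForm_lieAlg`), the Hodge metric is g(u, v) = ⟨θ_u, θ_v⟩ with ⟨a, b⟩ = -m Re tr(a b*)
(`hodgeMetric_eq`). This pairing does not depend on z. Different degrees are orthogonal, and by the
Hodge-Riemann relations it is positive on degree -1 and nonpositive on degree 0.

Differentiating the relations for θ and separating degrees (`structure_equations`) shows that the
θ_u commute and that ∇_uθ_v = ∂_uθ_v + T_uv, with T_uv = [θ_u*, θ_v], is symmetric of degree -1. As
T_uv has degree 0, ∂_uθ_v = ∇_uθ_v - T_uv is an orthogonal decomposition. Symmetry of ∇θ makes g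
Kähler and makes the Christoffel symbol Γ(u, v) the projection of ∇_uθ_v to the image of θ. The
ambient pairing being constant, the curvature is given by a Gauss equation
(`tracePairing_curvature`). Now ∇θ is complex linear in both arguments and T is conjugate linear in
the first, so the numerator of the bisectional curvature is 2⟨T_uv, T_uv⟩ - 2(|∇_uθ_v|² - |Γ(u,
v)|²), where both terms are nonpositive.

The strict bounds come from pairing T_uu with Λ: tr(T_uu Λ) = tr(θ_u θ_u*), so Cauchy-Schwarz in
degree 0 gives ⟨T_uu, T_uu⟩ ≤ -g(u, u)²/(mC) as soon as C > 0 and C ≥ tr Λ² = ∑ p² h^{p,n-p}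
(`sq_le_of_torsion`). For the Ricci curvature, averaging w ↦ R(w, u)u over w and Jw yields a
negative semidefinite operator, whose trace is at most its Rayleigh quotient at u
(`trace_mul_le_of_nonpos`). -/

noncomputable section

namespace HodgeSlice

/-! ### Smoothness of holomorphic maps of several variables -/

section Osgood

variable {E : Type*} [NormedAddCommGroup E] [NormedSpace ℂ E] [FiniteDimensional ℂ E]

open MeasureTheory Metric in
/-- The directional derivatives of a holomorphic function of several variables are holomorphic. -/
theorem differentiableAt_fderiv_apply {f : E → ℂ} {U : Set E} (hU : IsOpen U)
    (hf : DifferentiableOn ℂ f U) {x : E} (hx : x ∈ U) (v : E) :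
    DifferentiableAt ℂ (fun y => fderiv ℂ f y v) x := by
  have hproper : ProperSpace E := FiniteDimensional.proper ℂ E
  obtain ⟨ε, hε, hεU⟩ := Metric.isOpen_iff.1 hU x hx
  -- Three nested balls: y stays within ρ of x, the points y + ζ v within 2ρ, and the Cauchy
  -- estimates at those points use the values of f within 3ρ.
  set ρ := ε / 4 with hρ
  have hρ0 : 0 < ρ := by positivity
  have hball : closedBall x (3 * ρ) ⊆ U := fun y hy => hεU <| by
    rw [mem_closedBall] at hy; rw [mem_ball]; linarith
  obtain ⟨M, hM⟩ := (isCompact_closedBall x (3 * ρ)).exists_bound_of_continuousOn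
    (hf.continuousOn.mono hball)
  have hder : ∀ y ∈ closedBall x (2 * ρ), ‖fderiv ℂ f y‖ ≤ 2 * M / ρ := by
    intro y hy
    rw [mem_closedBall] at hy
    have hsub : ball y ρ ⊆ closedBall x (3 * ρ) := fun w hw => by
      rw [mem_ball] at hw; rw [mem_closedBall]
      linarith [dist_triangle w y x]
    refine Complex.norm_fderiv_le_div_of_mapsTo_ball (hf.mono (hsub.trans hball)) ?_ hρ0
    intro w hw
    rw [mem_closedBall, dist_eq_norm]
    have h1 := hM w (hsub hw)
    have h2 := hM y (by rw [mem_closedBall]; linarith)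
    linarith [norm_sub_le (f w) (f y)]
  -- Radius of the circle in the complex line through y in the direction v; the added 1 covers v =
  -- 0.
  set r := ρ / (‖v‖ + 1) with hr
  have hv1 : 0 < ‖v‖ + 1 := by positivity
  have hr0 : 0 < r := by positivity
  have hrv : r * ‖v‖ ≤ ρ := by
    rw [hr, div_mul_eq_mul_div, div_le_iff₀ hv1]
    nlinarith [norm_nonneg v]
  have hmem : ∀ y ∈ ball x ρ, ∀ ζ : ℂ, ‖ζ‖ ≤ r → y + ζ • v ∈ closedBall x (2 * ρ) := by
    intro y hy ζ hζ
    rw [mem_ball, dist_eq_norm] at hy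
    rw [mem_closedBall, dist_eq_norm]
    have h1 : ‖ζ • v‖ ≤ ρ := by
      rw [norm_smul]; exact (mul_le_mul_of_nonneg_right hζ (norm_nonneg v)).trans hrv
    calc ‖y + ζ • v - x‖ = ‖(y - x) + ζ • v‖ := by congr 1; abel
      _ ≤ ‖y - x‖ + ‖ζ • v‖ := norm_add_le _ _
      _ ≤ 2 * ρ := by linarith
  have h23 : closedBall x (2 * ρ) ⊆ U :=
    (closedBall_subset_closedBall (by linarith)).trans hball
  have hdiff : ∀ y ∈ closedBall x (2 * ρ), DifferentiableAt ℂ f y := fun y hy =>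
    hf.differentiableAt (hU.mem_nhds (h23 hy))
  have hcirc : ∀ t : ℝ, ‖circleMap 0 r t‖ ≤ r := fun t => by
    simp [abs_of_pos hr0]
  set a : ℝ → ℂ := fun t => deriv (circleMap 0 r) t * (1 / (circleMap 0 r t - 0) ^ 2) with ha
  have hac : Continuous a := by
    have h0 : ∀ t, (circleMap 0 r t - 0) ^ 2 ≠ 0 := fun t => by
      simpa using hr0.ne'
    simp only [ha, deriv_circleMap]
    have := continuous_circleMap 0 r
    fun_prop (disch := exact h0 _)
  -- Cauchy's formula for the derivative at 0 of ζ ↦ f (y + ζ v). On the right-hand side y enters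
  -- only through values of f, so it can be differentiated under the integral sign.
  have hformula : ∀ y ∈ ball x ρ, fderiv ℂ f y v =
      (2 * Real.pi * Complex.I : ℂ)⁻¹ * ∫ t in Set.Ioc 0 (2 * Real.pi),
        a t * f (y + circleMap 0 r t • v) := by
    intro y hy
    have hd : ∀ ζ : ℂ, ‖ζ‖ ≤ r → HasDerivAt (fun ζ : ℂ => f (y + ζ • v))
        (fderiv ℂ f (y + ζ • v) v) ζ := by
      intro ζ hζ
      have h1 : HasDerivAt (fun ζ : ℂ => y + ζ • v) v ζ := by
        simpa using ((hasDerivAt_id ζ).smul_const v).const_add y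
      exact (hdiff _ (hmem y hy ζ hζ)).hasFDerivAt.comp_hasDerivAt ζ h1
    have h2 : DiffContOnCl ℂ (fun ζ : ℂ => f (y + ζ • v)) (ball 0 r) := by
      refine DifferentiableOn.diffContOnCl fun ζ hζ => ?_
      rw [closure_ball _ hr0.ne', mem_closedBall_zero_iff] at hζ
      exact (hd ζ hζ).differentiableAt.differentiableWithinAt
    have h3 := h2.deriv_eq_smul_circleIntegral hr0
    rw [(hd 0 (by simpa using hr0.le)).deriv] at h3
    simp only [zero_smul, add_zero, smul_eq_mul] at h3
    have h4 : (2 * Real.pi * Complex.I : ℂ) ≠ 0 := by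
      simp [Real.pi_ne_zero, Complex.I_ne_zero]
    rw [eq_inv_mul_iff_mul_eq₀ h4, ← h3, circleIntegral,
      intervalIntegral.integral_of_le (by positivity)]
    simp only [ha, smul_eq_mul, mul_assoc]
  have hev : (fun y => fderiv ℂ f y v) =ᶠ[𝓝 x] fun y =>
      (2 * Real.pi * Complex.I : ℂ)⁻¹ * ∫ t in Set.Ioc 0 (2 * Real.pi),
        a t * f (y + circleMap 0 r t • v) := by
    filter_upwards [ball_mem_nhds x hρ0] with y hy using hformula y hy
  refine DifferentiableAt.congr_of_eventuallyEq ?_ hev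
  have hcont : ∀ y ∈ ball x ρ, Continuous fun t => a t * f (y + circleMap 0 r t • v) := by
    intro y hy
    refine hac.mul (continuous_iff_continuousAt.2 fun t => ?_)
    have h1 : Continuous fun t => y + circleMap 0 r t • v :=
      continuous_const.add ((continuous_circleMap 0 r).smul continuous_const)
    exact ContinuousAt.comp (f := fun t => y + circleMap 0 r t • v)
      (hdiff _ (hmem y hy _ (hcirc t))).continuousAt h1.continuousAt
  let : MeasurableSpace E := borel E
  have : BorelSpace E := ⟨rfl⟩
  have key := hasFDerivAt_integral_of_dominated_of_fderiv_le (𝕜 := ℂ)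
    (μ := volume.restrict (Set.Ioc (0 : ℝ) (2 * Real.pi)))
    (F := fun y t => a t * f (y + circleMap 0 r t • v))
    (F' := fun y t => a t • fderiv ℂ f (y + circleMap 0 r t • v)) (x₀ := x)
    (bound := fun t => ‖a t‖ * (2 * M / ρ)) (ball_mem_nhds x hρ0)
    (by filter_upwards [ball_mem_nhds x hρ0] with y hy
          using (hcont y hy).aestronglyMeasurable)
    ((hcont x (mem_ball_self hρ0)).integrableOn_Ioc)
    (by
      have h1 : Continuous fun t => x + circleMap 0 r t • v :=
        continuous_const.add ((continuous_circleMap 0 r).smul continuous_const)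
      exact hac.aestronglyMeasurable.smul
        (((measurable_fderiv ℂ f).comp h1.measurable).aestronglyMeasurable))
    (by
      refine Filter.Eventually.of_forall fun t y hy => ?_
      rw [norm_smul]
      exact mul_le_mul_of_nonneg_left (hder _ (hmem y hy _ (hcirc t))) (norm_nonneg _))
    ((hac.norm.mul continuous_const).integrableOn_Ioc)
    (by
      refine Filter.Eventually.of_forall fun t y hy => ?_
      have h1 : HasFDerivAt (fun y => y + circleMap 0 r t • v) (ContinuousLinearMap.id ℂ E) y :=
        (hasFDerivAt_id y).add_const _
      have h2 := (hdiff _ (hmem y hy _ (hcirc t))).hasFDerivAt.comp y h1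
      exact h2.const_mul (a t))
  exact key.differentiableAt.const_mul _

/-- A holomorphic function on an open subset of a finite-dimensional space is smooth. -/
theorem contDiffOn_of_differentiableOn {f : E → ℂ} {U : Set E} (hU : IsOpen U)
    (hf : DifferentiableOn ℂ f U) : ContDiffOn ℂ ∞ f U := by
  refine contDiffOn_infty.2 fun m => ?_
  induction m generalizing f with
  | zero => exact contDiffOn_zero.2 hf.continuousOn
  | succ m ih =>
    have := (contDiffOn_succ_iff_fderiv_of_isOpen (n := (m : WithTop ℕ∞)) (f := f) (𝕜 := ℂ) hU).2
    refine this ⟨hf, by simp, ?_⟩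
    refine contDiffOn_clm_apply.2 fun v => ih ?_
    exact fun x hx => (differentiableAt_fderiv_apply hU hf hx v).differentiableWithinAt

/-- A vector-valued map which is holomorphic near a point is real smooth there. -/
theorem contDiffAt_of_eventually_differentiableAt {ι : Type*} [Fintype ι] {f : E → ι → ℂ} {x : E}
    (hf : ∀ᶠ y in 𝓝 x, DifferentiableAt ℂ f y) : ContDiffAt ℝ ∞ f x := by
  obtain ⟨U, hU, hUo, hxU⟩ := eventually_nhds_iff.1 hf
  refine contDiffAt_pi.2 fun i => ?_
  have h1 : DifferentiableOn ℂ (fun y => f y i) U := fun y hy =>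
    (differentiableAt_pi.1 (hU y hy) i).differentiableWithinAt
  exact ((contDiffOn_of_differentiableOn hUo h1).contDiffAt (hUo.mem_nhds hxU)).restrict_scalars ℝ

end Osgood

/-! ### The Killing form of the Lie algebra of a bilinear form -/

section Killing

attribute [local instance 100] LieRing.ofAssociativeRing

variable {ι : Type*} [Fintype ι] [DecidableEq ι]

theorem trace_eq_sum_single (f : Matrix ι ι ℝ →ₗ[ℝ] Matrix ι ι ℝ) :
    LinearMap.trace ℝ _ f = ∑ i, ∑ j, f (Matrix.single i j 1) i j := by
  rw [LinearMap.trace_eq_matrix_trace ℝ (Matrix.stdBasis ℝ ι ι), Matrix.trace,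
    Fintype.sum_prod_type]
  refine Finset.sum_congr rfl fun i _ => Finset.sum_congr rfl fun j _ => ?_
  rw [Matrix.diag_apply, LinearMap.toMatrix_apply, Matrix.stdBasis_eq_single]
  rfl

/-- The endomorphism `Z ↦ A Z B` of the space of matrices. -/
def sandwich (A B : Matrix ι ι ℝ) : Matrix ι ι ℝ →ₗ[ℝ] Matrix ι ι ℝ :=
  LinearMap.mulLeft ℝ A ∘ₗ LinearMap.mulRight ℝ B

/-- The endomorphism `Z ↦ A Zᵀ B` of the space of matrices. -/
def sandwichTranspose (A B : Matrix ι ι ℝ) : Matrix ι ι ℝ →ₗ[ℝ] Matrix ι ι ℝ :=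
  sandwich A B ∘ₗ (Matrix.transposeLinearEquiv ι ι ℝ ℝ).toLinearMap

theorem sandwich_apply (A B Z : Matrix ι ι ℝ) : sandwich A B Z = A * Z * B := by
  simp [sandwich, mul_assoc]

theorem sandwichTranspose_apply (A B Z : Matrix ι ι ℝ) :
    sandwichTranspose A B Z = A * Zᵀ * B := by
  simp [sandwichTranspose, sandwich_apply]

theorem mul_single_mul_apply (A B : Matrix ι ι ℝ) (i j k l : ι) :
    (A * (Matrix.single i j 1 : Matrix ι ι ℝ) * B) k l = A k i * B j l := by
  rw [Matrix.mul_assoc, Matrix.mul_apply, Finset.sum_eq_single i]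
  · simp
  · intro b _ hb
    rw [Matrix.single_mul_apply_of_ne _ _ _ _ _ hb, mul_zero]
  · simp

theorem trace_sandwich (A B : Matrix ι ι ℝ) :
    LinearMap.trace ℝ _ (sandwich A B) = A.trace * B.trace := by
  simp only [trace_eq_sum_single, sandwich_apply, mul_single_mul_apply, Matrix.trace,
    Matrix.diag_apply, Finset.sum_mul_sum]

theorem trace_sandwichTranspose (A B : Matrix ι ι ℝ) :
    LinearMap.trace ℝ _ (sandwichTranspose A B) = (A * Bᵀ).trace := by
  simp only [trace_eq_sum_single, sandwichTranspose_apply, Matrix.transpose_single,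
    mul_single_mul_apply, Matrix.trace, Matrix.diag_apply]
  simp only [Matrix.mul_apply, Matrix.transpose_apply]

variable {Q : Matrix ι ι ℝ} {ε : ℝ}

theorem mem_lieAlg {X : Matrix ι ι ℝ} : X ∈ lieAlg Q ↔ Xᵀ * Q = -(Q * X) := by
  rw [lieAlg, mem_skewAdjointMatricesLieSubalgebra, mem_skewAdjointMatricesSubmodule,
    Matrix.IsSkewAdjoint, Matrix.IsAdjointPair, mul_neg]

/-- The projection `Z ↦ (Z - Q⁻¹ Zᵀ Q) / 2` of the space of matrices onto `lieAlg Q`. -/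
def skewProjection (hQ : Qᵀ = ε • Q) (hε : ε * ε = 1) (hdet : IsUnit Q.det) :
    Matrix ι ι ℝ →ₗ[ℝ] lieAlg Q :=
  LinearMap.codRestrict (lieAlg Q).toSubmodule
    ((1 / 2 : ℝ) • (LinearMap.id - sandwichTranspose Q⁻¹ Q)) fun Z => by
      change _ ∈ lieAlg Q
      have h1 : (Q⁻¹)ᵀ = ε • Q⁻¹ := by
        rw [Matrix.transpose_nonsing_inv, hQ]
        refine Matrix.inv_eq_left_inv ?_
        rw [Matrix.smul_mul, Matrix.mul_smul, smul_smul, hε, one_smul,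
          Matrix.nonsing_inv_mul _ hdet]
      rw [mem_lieAlg]
      simp only [LinearMap.smul_apply, LinearMap.sub_apply, LinearMap.id_apply,
        sandwichTranspose_apply, Matrix.transpose_smul, Matrix.transpose_sub,
        Matrix.transpose_mul, Matrix.transpose_transpose, h1, hQ, Matrix.smul_mul,
        Matrix.mul_smul, smul_smul, hε, one_smul, Matrix.sub_mul, Matrix.mul_sub, Matrix.mul_assoc,
        Matrix.nonsing_inv_mul _ hdet, Matrix.mul_one, Matrix.mul_nonsing_inv_cancel_left _ _ hdet]
      module

theorem trace_eq_zero_of_mem_lieAlg (hdet : IsUnit Q.det) {X : Matrix ι ι ℝ} (hX : X ∈ lieAlg Q) :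
    X.trace = 0 := by
  have h1 : X = -(Q⁻¹ * (Xᵀ * Q)) := by
    rw [mem_lieAlg.1 hX, mul_neg, neg_neg, Matrix.nonsing_inv_mul_cancel_left _ _ hdet]
  have h2 : (Q⁻¹ * (Xᵀ * Q)).trace = X.trace := by
    rw [Matrix.trace_mul_comm, Matrix.mul_assoc, Matrix.mul_nonsing_inv _ hdet, Matrix.mul_one,
      Matrix.trace_transpose]
  have h3 := congrArg Matrix.trace h1
  rw [Matrix.trace_neg, h2] at h3
  linarith

/-- The Killing form of the Lie algebra of an `ε`-symmetric form on an `N`-dimensional space is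
`N - 2 ε` times the trace form. -/
theorem killingForm_lieAlg (hQ : Qᵀ = ε • Q) (hε : ε * ε = 1) (hdet : IsUnit Q.det)
    (X Y : lieAlg Q) :
    killingForm ℝ (lieAlg Q) X Y = (Fintype.card ι - 2 * ε) * (X.1 * Y.1).trace := by
  obtain ⟨X, hX⟩ := X
  obtain ⟨Y, hY⟩ := Y
  have hX' := mem_lieAlg.1 hX
  have hY' := mem_lieAlg.1 hY
  -- The formula for ad X ∘ ad Y, extended from the Lie algebra to all matrices.
  set f : Matrix ι ι ℝ →ₗ[ℝ] Matrix ι ι ℝ :=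
    sandwich (X * Y) 1 - sandwich X Y - sandwich Y X + sandwich 1 (Y * X) with hf
  set p := skewProjection hQ hε hdet with hp
  have hpval : ∀ Z, ((p Z : lieAlg Q) : Matrix ι ι ℝ) = (1 / 2 : ℝ) • (Z - Q⁻¹ * Zᵀ * Q) := by
    intro Z
    change (1 / 2 : ℝ) • (Z - sandwichTranspose Q⁻¹ Q Z) = _
    rw [sandwichTranspose_apply]
  have hpi : ∀ Z : lieAlg Q, p Z = Z := by
    intro Z
    apply Subtype.ext
    rw [hpval, Matrix.mul_assoc, mem_lieAlg.1 Z.2, mul_neg,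
      Matrix.nonsing_inv_mul_cancel_left _ _ hdet]
    module
  have h1 : LieAlgebra.ad ℝ (lieAlg Q) ⟨X, hX⟩ ∘ₗ LieAlgebra.ad ℝ (lieAlg Q) ⟨Y, hY⟩ =
      p ∘ₗ (f ∘ₗ (lieAlg Q).toSubmodule.subtype) := by
    ext1 Z
    rw [LinearMap.comp_apply, LinearMap.comp_apply, ← hpi (LieAlgebra.ad ℝ (lieAlg Q) _ _)]
    congr 1
    simp only [LieAlgebra.ad_apply, LieSubalgebra.coe_bracket, Ring.lie_def, hf,
      LinearMap.comp_apply, LinearMap.add_apply, LinearMap.sub_apply, sandwich_apply]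
    change X * (Y * Z.1 - Z.1 * Y) - (Y * Z.1 - Z.1 * Y) * X =
      X * Y * Z.1 * 1 - X * Z.1 * Y - Y * Z.1 * X + 1 * Z.1 * (Y * X)
    noncomm_ring
  -- By cyclicity the trace of p ∘ f on the Lie algebra is that of f ∘ p on all matrices, which
  -- splits into a plain and a transposed half.
  have h2 : (f ∘ₗ (lieAlg Q).toSubmodule.subtype) ∘ₗ p = (1 / 2 : ℝ) • (f -
      (sandwichTranspose (X * Y * Q⁻¹) Q - sandwichTranspose (X * Q⁻¹) (Q * Y)
        - sandwichTranspose (Y * Q⁻¹) (Q * X) + sandwichTranspose Q⁻¹ (Q * (Y * X)))) := by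
    ext1 Z
    rw [LinearMap.comp_apply, LinearMap.comp_apply, Submodule.subtype_apply]
    change f ((p Z : lieAlg Q) : Matrix ι ι ℝ) = _
    rw [hpval, map_smul, map_sub]
    simp only [hf, LinearMap.smul_apply, LinearMap.add_apply, LinearMap.sub_apply, sandwich_apply,
      sandwichTranspose_apply, Matrix.mul_one, Matrix.one_mul, Matrix.mul_assoc]
  rw [killingForm_apply_apply, h1, LinearMap.trace_comp_comm', h2]
  have tX := trace_eq_zero_of_mem_lieAlg hdet hX
  have hXQ : Q⁻¹ * (Xᵀ * Q) = -X := by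
    rw [hX', mul_neg, Matrix.nonsing_inv_mul_cancel_left _ _ hdet]
  have hYQ : Q⁻¹ * (Yᵀ * Q) = -Y := by
    rw [hY', mul_neg, Matrix.nonsing_inv_mul_cancel_left _ _ hdet]
  -- Each of the four transposed terms contributes ε tr(XY), whereas f has trace 2 N tr(XY) because
  -- tr X = 0; half the difference is (N - 2ε) tr(XY).
  have e1 : X * Y * Q⁻¹ * Qᵀ = ε • (X * Y) := by
    rw [hQ, Matrix.mul_smul, Matrix.mul_assoc, Matrix.nonsing_inv_mul _ hdet, Matrix.mul_one]
  have e2 : X * Q⁻¹ * (Q * Y)ᵀ = -(ε • (X * Y)) := by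
    rw [Matrix.transpose_mul, hQ, Matrix.mul_smul, Matrix.mul_smul, Matrix.mul_assoc, hYQ]
    simp
  have e3 : Y * Q⁻¹ * (Q * X)ᵀ = -(ε • (Y * X)) := by
    rw [Matrix.transpose_mul, hQ, Matrix.mul_smul, Matrix.mul_smul, Matrix.mul_assoc, hXQ]
    simp
  have e4 : Q⁻¹ * (Q * (Y * X))ᵀ = ε • (X * Y) := by
    rw [Matrix.transpose_mul, Matrix.transpose_mul, hQ, Matrix.mul_smul, Matrix.mul_smul,
      Matrix.mul_assoc, hY', mul_neg, mul_neg, ← Matrix.mul_assoc Xᵀ, hX', Matrix.neg_mul,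
      mul_neg, neg_neg, Matrix.mul_assoc, Matrix.nonsing_inv_mul_cancel_left _ _ hdet]
  simp only [hf, map_smul, map_sub, map_add, trace_sandwich, trace_sandwichTranspose, e1, e2, e3,
    e4, Matrix.trace_smul, Matrix.trace_neg, tX, Matrix.trace_one, Matrix.trace_mul_comm Y X,
    smul_eq_mul]
  ring

end Killing

/-! ### Higgs fields -/

section Algebra

variable {𝓐 : Type*} [NormedRing 𝓐] [NormedAlgebra ℂ 𝓐]

/-- `st` is a conjugate-linear involutive anti-automorphism and `τ` a compatible trace. -/
structure IsTracialInvolution (st : 𝓐 →L[ℝ] 𝓐) (τ : 𝓐 →L[ℂ] ℂ) : Prop where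
  map_mul : ∀ a b, st (a * b) = st b * st a
  involutive : ∀ a, st (st a) = a
  map_smul : ∀ (c : ℂ) a, st (c • a) = star c • st a
  trace_comm : ∀ a b, τ (a * b) = τ (b * a)
  trace_map : ∀ a, τ (st a) = star (τ a)

/-- The real bilinear form `-m Re τ(a b*)`. -/
def tracePairing (st : 𝓐 →L[ℝ] 𝓐) (τ : 𝓐 →L[ℂ] ℂ) (m : ℝ) : 𝓐 →L[ℝ] 𝓐 →L[ℝ] ℝ :=
  (ContinuousLinearMap.compL ℝ 𝓐 𝓐 ℝ ((-m) • (Complex.reCLM.comp (τ.restrictScalars ℝ)))).comp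
    ((ContinuousLinearMap.mul ℝ 𝓐).bilinearComp (ContinuousLinearMap.id ℝ 𝓐) st)

variable {st : 𝓐 →L[ℝ] 𝓐} {τ : 𝓐 →L[ℂ] ℂ} {m : ℝ}

theorem tracePairing_apply (a b : 𝓐) : tracePairing st τ m a b = -m * (τ (a * st b)).re := by
  simp [tracePairing]

theorem IsTracialInvolution.tracePairing_comm (h : IsTracialInvolution st τ) (a b : 𝓐) :
    tracePairing st τ m a b = tracePairing st τ m b a := by
  have h1 : τ (b * st a) = star (τ (a * st b)) := by
    rw [← h.trace_map, h.map_mul, h.involutive]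
  rw [tracePairing_apply, tracePairing_apply, h1]
  simp

theorem IsTracialInvolution.tracePairing_I (h : IsTracialInvolution st τ) (a b : 𝓐) :
    tracePairing st τ m (Complex.I • a) (Complex.I • b) = tracePairing st τ m a b := by
  rw [tracePairing_apply, tracePairing_apply, h.map_smul, smul_mul_smul_comm]
  simp

/-- Weights of a grading operator: products of total weight `r ≠ 0` have no trace. -/
theorem IsTracialInvolution.trace_eq_zero (h : IsTracialInvolution st τ) {L a : 𝓐} {r : ℂ}
    (hr : r ≠ 0) (ha : L * a - a * L = r • a) : τ a = 0 := by
  have h1 := congrArg τ ha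
  rw [map_sub, h.trace_comm, sub_self, _root_.map_smul, smul_eq_mul] at h1
  exact (mul_eq_zero.1 h1.symm).resolve_left hr

/-- The commutator with L is a derivation, so weights add under multiplication. -/
theorem commutator_mul {L a b : 𝓐} {r s : ℂ} (ha : L * a - a * L = r • a)
    (hb : L * b - b * L = s • b) : L * (a * b) - (a * b) * L = (r + s) • (a * b) := by
  have h1 : L * (a * b) - (a * b) * L = (L * a - a * L) * b + a * (L * b - b * L) := by
    noncomm_ring
  rw [h1, ha, hb, add_smul, smul_mul_assoc, mul_smul_comm]

/-- Reversing products flips the commutator, hence the sign of the weight; a real weight is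
unaffected by conjugation. -/
theorem IsTracialInvolution.commutator_map (h : IsTracialInvolution st τ) {L a : 𝓐} {r : ℝ}
    (hL : st L = L) (ha : L * a - a * L = (r : ℂ) • a) :
    L * st a - st a * L = ((-r : ℝ) : ℂ) • st a := by
  have h1 := congrArg st ha
  rw [map_sub, h.map_mul, h.map_mul, hL, h.map_smul] at h1
  rw [← neg_sub, h1]
  simp

theorem eq_zero_of_zsmul_eq_zero {x : 𝓐} {k : ℤ} (hk : k ≠ 0) (h : k • x = 0) : x = 0 := by
  rw [← Int.cast_smul_eq_zsmul ℂ] at h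
  exact (smul_eq_zero.1 h).resolve_left (by exact_mod_cast hk)

/-- The infinitesimal integrability conditions of a horizontal variation, with `L` the grading
operator, `a`, `b` the values of the Higgs field and `p`, `q` its mixed derivatives. -/
theorem IsTracialInvolution.structure_equations (h : IsTracialInvolution st τ) {L a b p q : 𝓐}
    (hL : st L = L) (ha : L * a - a * L = -a) (hb : L * b - b * L = -b)
    (hp : (a + st a) * b + L * p - p * L - b * (a + st a) = -p)
    (hq : (b + st b) * a + L * q - q * L - a * (b + st b) = -q) (hpq : p + st p = q + st q) :
    a * b = b * a ∧ p + (st a * b - b * st a) = q + (st b * a - a * st b) := by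
  have ha' : L * st a - st a * L = st a := by
    have := congrArg st ha
    rw [map_sub, h.map_mul, h.map_mul, hL, map_neg] at this
    linear_combination (norm := noncomm_ring) (-1 : ℤ) • this
  have hb' : L * st b - st b * L = st b := by
    have := congrArg st hb
    rw [map_sub, h.map_mul, h.map_mul, hL, map_neg] at this
    linear_combination (norm := noncomm_ring) (-1 : ℤ) • this
  -- The antisymmetrized derivative d will be compared with the commutators c, c' and e, of weights
  -- -2, 2 and 0.
  obtain ⟨d, hd⟩ : ∃ d, d = p - q := ⟨_, rfl⟩
  obtain ⟨c, hc⟩ : ∃ c, c = a * b - b * a := ⟨_, rfl⟩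
  obtain ⟨c', hc'⟩ : ∃ c', c' = st b * st a - st a * st b := ⟨_, rfl⟩
  obtain ⟨e, he⟩ : ∃ e, e = (st a * b - b * st a) - (st b * a - a * st b) := ⟨_, rfl⟩
  have hsd : st d = -d := by
    rw [hd, map_sub]
    linear_combination (norm := noncomm_ring) hpq
  have hsc : st c = c' := by rw [hc, hc', map_sub, h.map_mul, h.map_mul]
  have hse : st e = -e := by
    rw [he]
    simp only [map_sub, h.map_mul, h.involutive]
    noncomm_ring
  -- Difference of the two differentiated degree equations; `e2` is its adjoint.
  have e1 : L * d - d * L + d = -(c + c) - e := by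
    rw [hd, hc, he]
    linear_combination (norm := noncomm_ring) hp - hq
  have e2 : L * d - d * L - d = -(c' + c') + e := by
    have h1 := congrArg st e1
    simp only [map_sub, map_add, map_neg, h.map_mul, hL, hsd, hsc, hse] at h1
    linear_combination (norm := noncomm_ring) h1
  have wc : L * c - c * L = -(c + c) := by
    rw [hc]
    linear_combination (norm := noncomm_ring) ha * b + a * hb - hb * a - b * ha
  have wc' : L * c' - c' * L = c' + c' := by
    rw [hc']
    linear_combination (norm := noncomm_ring)
      hb' * st a + st b * ha' - ha' * st b - st a * hb'
  have we : L * e - e * L = 0 := by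
    rw [he]
    linear_combination (norm := noncomm_ring)
      ha' * b + st a * hb - hb * st a - b * ha' - (hb' * a + st b * ha - ha * st b - a * hb')
  have hd2 : d + d = (c' + c') - (c + c) - (e + e) := by
    linear_combination (norm := noncomm_ring) e1 - e2
  -- The sum of `e1` and `e2` gives [L, 2d] = -2(c + c'), while bracketing `hd2` with L gives 4(c +
  -- c').
  have h6 : (6 : ℤ) • (c + c') = 0 := by
    have h1 : L * (d + d) - (d + d) * L = -(c + c) - (c' + c') := by
      linear_combination (norm := noncomm_ring) e1 + e2
    rw [hd2] at h1
    linear_combination (norm := noncomm_ring) h1 - (2 : ℤ) • wc' + (2 : ℤ) • wc + (2 : ℤ) • we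
  have hcc : c + c' = 0 := eq_zero_of_zsmul_eq_zero (by norm_num) h6
  -- The terms c and c' have opposite weights -2 and 2, so a vanishing sum forces both to vanish.
  have hc0 : c = 0 := by
    refine eq_zero_of_zsmul_eq_zero (k := 4) (by norm_num) ?_
    linear_combination (norm := noncomm_ring) wc' + wc - (L * hcc - hcc * L) + (2 : ℤ) • hcc
  have hc0' : c' = 0 := by rw [hc0, zero_add] at hcc; exact hcc
  have hde : d + e = 0 := by
    refine eq_zero_of_zsmul_eq_zero (k := 2) (by norm_num) ?_
    rw [hc0, hc0'] at hd2
    linear_combination (norm := noncomm_ring) hd2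
  refine ⟨sub_eq_zero.1 (hc ▸ hc0), ?_⟩
  rw [hd, he] at hde
  linear_combination (norm := noncomm_ring) hde

end Algebra

/-! ### Higgs fields: structure equations and the covariant derivative -/

section Higgs

variable {E : Type*} [NormedAddCommGroup E] [NormedSpace ℂ E]
variable {𝓐 : Type*} [NormedRing 𝓐] [NormedAlgebra ℂ 𝓐]

/-- The differential-geometric content of a horizontal slice: a family `Λ` of self-adjoint grading
operators with `dΛ = θ + θ*`, where the Higgs field `θ` is an injective complex-linear form with
values in operators of degree `-1`. The trace form is definite on operators of degree `-1` and `0`,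
and `C` bounds the square norm of `Λ`. -/
structure IsHiggsFieldOn (st : 𝓐 →L[ℝ] 𝓐) (τ : 𝓐 →L[ℂ] ℂ) (C : ℝ) (Λ : E → 𝓐)
    (θ : E → E →L[ℝ] 𝓐) (Ω : Set E) : Prop where
  isOpen : IsOpen Ω
  involution : IsTracialInvolution st τ
  contDiffOn_grading : ContDiffOn ℝ ∞ Λ Ω
  contDiffOn_higgs : ContDiffOn ℝ ∞ θ Ω
  map_grading : ∀ z ∈ Ω, st (Λ z) = Λ z
  fderiv_grading : ∀ z ∈ Ω, ∀ v, fderiv ℝ Λ z v = θ z v + st (θ z v)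
  higgs_I : ∀ z ∈ Ω, ∀ v, θ z (Complex.I • v) = Complex.I • θ z v
  higgs_degree : ∀ z ∈ Ω, ∀ v, Λ z * θ z v - θ z v * Λ z = -θ z v
  injective : ∀ z ∈ Ω, ∀ v, θ z v = 0 → v = 0
  trace_neg : ∀ z ∈ Ω, ∀ a, Λ z * a - a * Λ z = -a → a ≠ 0 → (τ (a * st a)).re < 0
  trace_nonneg : ∀ z ∈ Ω, ∀ a, Λ z * a = a * Λ z → 0 ≤ (τ (a * st a)).re
  trace_grading : ∀ z ∈ Ω, (τ (Λ z * Λ z)).re ≤ C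

namespace IsHiggsFieldOn

variable {st : 𝓐 →L[ℝ] 𝓐} {τ : 𝓐 →L[ℂ] ℂ} {C m : ℝ} {Λ : E → 𝓐} {θ : E → E →L[ℝ] 𝓐} {Ω : Set E}
  {z : E}

theorem hasFDerivAt_grading (H : IsHiggsFieldOn st τ C Λ θ Ω) (hz : z ∈ Ω) :
    HasFDerivAt Λ (fderiv ℝ Λ z) z :=
  ((H.contDiffOn_grading.contDiffAt (H.isOpen.mem_nhds hz)).differentiableAt
    (by simp)).hasFDerivAt

theorem hasFDerivAt_higgs (H : IsHiggsFieldOn st τ C Λ θ Ω) (hz : z ∈ Ω) :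
    HasFDerivAt θ (fderiv ℝ θ z) z :=
  ((H.contDiffOn_higgs.contDiffAt (H.isOpen.mem_nhds hz)).differentiableAt
    (by simp)).hasFDerivAt

theorem hasFDerivAt_higgs_apply (H : IsHiggsFieldOn st τ C Λ θ Ω) (hz : z ∈ Ω) (v : E) :
    HasFDerivAt (fun y => θ y v) ((fderiv ℝ θ z).flip v) z :=
  (ContinuousLinearMap.apply ℝ 𝓐 v).hasFDerivAt.comp z (H.hasFDerivAt_higgs hz)

/-- Derivative in the direction u of [Λ, θ_v] = -θ_v, with dΛ = θ + θ*. -/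
theorem fderiv_higgs_degree (H : IsHiggsFieldOn st τ C Λ θ Ω) (hz : z ∈ Ω) (u v : E) :
    (θ z u + st (θ z u)) * θ z v + Λ z * fderiv ℝ θ z u v - fderiv ℝ θ z u v * Λ z
      - θ z v * (θ z u + st (θ z u)) = -fderiv ℝ θ z u v := by
  have h1 := H.hasFDerivAt_grading hz
  have h2 := H.hasFDerivAt_higgs_apply hz v
  have h3 := (h1.mul' h2).sub (h2.mul' h1)
  have h4 : (fun y => Λ y * θ y v - θ y v * Λ y) =ᶠ[𝓝 z] fun y => -θ y v := by
    filter_upwards [H.isOpen.mem_nhds hz] with y hy using H.higgs_degree y hy v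
  have h5 := (h3.congr_of_eventuallyEq h4.symm).unique h2.neg
  have h6 := DFunLike.congr_fun h5 u
  simp only [sub_apply, add_apply,
    neg_apply, ContinuousLinearMap.flip_apply, H.fderiv_grading z hz,
    smul_apply, smul_eq_mul, MulOpposite.smul_eq_mul_unop,
    MulOpposite.unop_op] at h6
  linear_combination (norm := noncomm_ring) h6

/-- Symmetry of the second derivative of Λ, whose first derivative is θ + θ*. -/
theorem fderiv_higgs_add_map_symm (H : IsHiggsFieldOn st τ C Λ θ Ω) (hz : z ∈ Ω) (u v : E) :
    fderiv ℝ θ z u v + st (fderiv ℝ θ z u v) = fderiv ℝ θ z v u + st (fderiv ℝ θ z v u) := by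
  have h1 : ∀ v, HasFDerivAt (fun y => fderiv ℝ Λ y v)
      ((fderiv ℝ θ z).flip v + st.comp ((fderiv ℝ θ z).flip v)) z := by
    intro v
    have h2 := H.hasFDerivAt_higgs_apply hz v
    refine (h2.add (st.hasFDerivAt.comp z h2)).congr_of_eventuallyEq ?_
    filter_upwards [H.isOpen.mem_nhds hz] with y hy using H.fderiv_grading y hy v
  have hsm := H.contDiffOn_grading.contDiffAt (H.isOpen.mem_nhds hz)
  have h3 : IsSymmSndFDerivAt ℝ Λ z := (contDiffAt_infty.1 hsm 2).isSymmSndFDerivAt (by simp)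
  have h4 : DifferentiableAt ℝ (fderiv ℝ Λ) z :=
    ((contDiffAt_infty.1 hsm 2).fderiv_right (m := 1) (by norm_num)).differentiableAt (by simp)
  have h5 : ∀ u v, fderiv ℝ (fderiv ℝ Λ) z u v =
      fderiv ℝ θ z u v + st (fderiv ℝ θ z u v) := by
    intro u v
    have h6 := ((ContinuousLinearMap.apply ℝ 𝓐 v).hasFDerivAt.comp z h4.hasFDerivAt).unique (h1 v)
    exact DFunLike.congr_fun h6 u
  rw [← h5, ← h5, h3.eq]

theorem higgs_comm (H : IsHiggsFieldOn st τ C Λ θ Ω) (hz : z ∈ Ω) (u v : E) :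
    θ z u * θ z v = θ z v * θ z u :=
  (H.involution.structure_equations (H.map_grading z hz) (H.higgs_degree z hz u)
    (H.higgs_degree z hz v) (H.fderiv_higgs_degree hz u v) (H.fderiv_higgs_degree hz v u)
    (H.fderiv_higgs_add_map_symm hz u v)).1

variable (st θ) in
/-- The part of degree `0` of the derivative of the Higgs field, up to sign. -/
def torsion (z u v : E) : 𝓐 := st (θ z u) * θ z v - θ z v * st (θ z u)

variable (st θ) in
/-- The covariant derivative of the Higgs field. -/
def covDeriv (z u v : E) : 𝓐 := fderiv ℝ θ z u v + torsion st θ z u v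

theorem covDeriv_symm (H : IsHiggsFieldOn st τ C Λ θ Ω) (hz : z ∈ Ω) (u v : E) :
    covDeriv st θ z u v = covDeriv st θ z v u :=
  (H.involution.structure_equations (H.map_grading z hz) (H.higgs_degree z hz u)
    (H.higgs_degree z hz v) (H.fderiv_higgs_degree hz u v) (H.fderiv_higgs_degree hz v u)
    (H.fderiv_higgs_add_map_symm hz u v)).2

theorem map_higgs_degree (H : IsHiggsFieldOn st τ C Λ θ Ω) (hz : z ∈ Ω) (v : E) :
    Λ z * st (θ z v) - st (θ z v) * Λ z = st (θ z v) := by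
  have := congrArg st (H.higgs_degree z hz v)
  rw [map_sub, H.involution.map_mul, H.involution.map_mul, H.map_grading z hz, map_neg] at this
  linear_combination (norm := noncomm_ring) (-1 : ℤ) • this

theorem torsion_degree (H : IsHiggsFieldOn st τ C Λ θ Ω) (hz : z ∈ Ω) (u v : E) :
    Λ z * torsion st θ z u v = torsion st θ z u v * Λ z := by
  have h1 := H.map_higgs_degree hz u
  have h2 := H.higgs_degree z hz v
  simp only [torsion]
  linear_combination (norm := noncomm_ring)
    h1 * θ z v + st (θ z u) * h2 - h2 * st (θ z u) - θ z v * h1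

/-- In the differentiated degree equation the degree -2 term is [θ_u, θ_v] = 0, and adding the
torsion cancels the degree 0 term. -/
theorem covDeriv_degree (H : IsHiggsFieldOn st τ C Λ θ Ω) (hz : z ∈ Ω) (u v : E) :
    Λ z * covDeriv st θ z u v - covDeriv st θ z u v * Λ z = -covDeriv st θ z u v := by
  have h1 := H.torsion_degree hz u v
  have h2 := H.fderiv_higgs_degree hz u v
  have h3 := H.higgs_comm hz u v
  simp only [torsion] at h1
  simp only [covDeriv, torsion]
  linear_combination (norm := noncomm_ring) h1 + h2 - h3

theorem fderiv_higgs_I (H : IsHiggsFieldOn st τ C Λ θ Ω) (hz : z ∈ Ω) (u v : E) :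
    fderiv ℝ θ z u (Complex.I • v) = Complex.I • fderiv ℝ θ z u v := by
  have h1 := H.hasFDerivAt_higgs_apply hz (Complex.I • v)
  have h2 := (H.hasFDerivAt_higgs_apply hz v).const_smul Complex.I
  have h3 : (fun y => θ y (Complex.I • v)) =ᶠ[𝓝 z] fun y => Complex.I • θ y v := by
    filter_upwards [H.isOpen.mem_nhds hz] with y hy using H.higgs_I y hy v
  exact DFunLike.congr_fun (h1.unique (h2.congr_of_eventuallyEq h3)) u

theorem torsion_I_right (H : IsHiggsFieldOn st τ C Λ θ Ω) (hz : z ∈ Ω) (u v : E) :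
    torsion st θ z u (Complex.I • v) = Complex.I • torsion st θ z u v := by
  simp only [torsion, H.higgs_I z hz, mul_smul_comm, smul_mul_assoc, smul_sub]

theorem torsion_I_left (H : IsHiggsFieldOn st τ C Λ θ Ω) (hz : z ∈ Ω) (u v : E) :
    torsion st θ z (Complex.I • u) v = -(Complex.I • torsion st θ z u v) := by
  have h1 : st (θ z (Complex.I • u)) = -(Complex.I • st (θ z u)) := by
    rw [H.higgs_I z hz, H.involution.map_smul, RCLike.star_def, Complex.conj_I, neg_smul]
  simp only [torsion, h1, neg_mul, mul_neg, mul_smul_comm, smul_mul_assoc, smul_sub]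
  abel

theorem covDeriv_I_right (H : IsHiggsFieldOn st τ C Λ θ Ω) (hz : z ∈ Ω) (u v : E) :
    covDeriv st θ z u (Complex.I • v) = Complex.I • covDeriv st θ z u v := by
  simp only [covDeriv, H.fderiv_higgs_I hz, H.torsion_I_right hz, smul_add]

/-- Symmetry transports complex linearity from the second argument to the first. The torsion, by
contrast, is conjugate linear there, and this contrast produces the curvature signs. -/
theorem covDeriv_I_left (H : IsHiggsFieldOn st τ C Λ θ Ω) (hz : z ∈ Ω) (u v : E) :
    covDeriv st θ z (Complex.I • u) v = Complex.I • covDeriv st θ z u v := by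
  rw [H.covDeriv_symm hz, H.covDeriv_I_right hz, H.covDeriv_symm hz]

end IsHiggsFieldOn

end Higgs

/-! ### Orthogonality of degrees and the sign of the torsion -/

section HiggsPairing

variable {E : Type*} [NormedAddCommGroup E] [NormedSpace ℂ E]
variable {𝓐 : Type*} [NormedRing 𝓐] [NormedAlgebra ℂ 𝓐]

namespace IsHiggsFieldOn

variable {st : 𝓐 →L[ℝ] 𝓐} {τ : 𝓐 →L[ℂ] ℂ} {C m : ℝ} {Λ : E → 𝓐} {θ : E → E →L[ℝ] 𝓐} {Ω : Set E}
  {z : E}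

/-- The adjoint of θ_w has weight 1 and the torsion weight 0, so their product is traceless. -/
theorem tracePairing_torsion_higgs (H : IsHiggsFieldOn st τ C Λ θ Ω) (hz : z ∈ Ω) (u v w : E) :
    tracePairing st τ m (torsion st θ z u v) (θ z w) = 0 := by
  have h1 : Λ z * torsion st θ z u v - torsion st θ z u v * Λ z = (0 : ℂ) • torsion st θ z u v := by
    rw [H.torsion_degree hz, sub_self, zero_smul]
  have h2 : Λ z * st (θ z w) - st (θ z w) * Λ z = (1 : ℂ) • st (θ z w) := by
    rw [H.map_higgs_degree hz, one_smul]
  have h3 := H.involution.trace_eq_zero (by norm_num) (commutator_mul h1 h2)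
  rw [tracePairing_apply, h3]
  simp

theorem tracePairing_covDeriv_torsion (H : IsHiggsFieldOn st τ C Λ θ Ω) (hz : z ∈ Ω)
    (u v w x : E) :
    tracePairing st τ m (covDeriv st θ z u v) (torsion st θ z w x) = 0 := by
  have h1 : Λ z * covDeriv st θ z u v - covDeriv st θ z u v * Λ z =
      (-1 : ℂ) • covDeriv st θ z u v := by
    rw [H.covDeriv_degree hz, neg_one_smul]
  have h2 : Λ z * st (torsion st θ z w x) - st (torsion st θ z w x) * Λ z =
      (0 : ℂ) • st (torsion st θ z w x) := by
    have := congrArg st (H.torsion_degree hz w x)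
    rw [H.involution.map_mul, H.involution.map_mul, H.map_grading z hz] at this
    rw [this, sub_self, zero_smul]
  have h3 := H.involution.trace_eq_zero (by norm_num) (commutator_mul h1 h2)
  rw [tracePairing_apply, h3]
  simp

theorem fderiv_higgs_eq (z u v : E) :
    fderiv ℝ θ z u v = covDeriv st θ z u v - torsion st θ z u v := by
  simp [covDeriv]

theorem tracePairing_fderiv_higgs (H : IsHiggsFieldOn st τ C Λ θ Ω) (hz : z ∈ Ω) (u v w : E) :
    tracePairing st τ m (fderiv ℝ θ z u v) (θ z w) =
      tracePairing st τ m (covDeriv st θ z u v) (θ z w) := by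
  rw [fderiv_higgs_eq (st := st), map_sub, sub_apply,
    H.tracePairing_torsion_higgs hz, sub_zero]

theorem tracePairing_fderiv_higgs_symm (H : IsHiggsFieldOn st τ C Λ θ Ω) (hz : z ∈ Ω)
    (u v w : E) :
    tracePairing st τ m (fderiv ℝ θ z u v) (θ z w) =
      tracePairing st τ m (fderiv ℝ θ z v u) (θ z w) := by
  rw [H.tracePairing_fderiv_higgs hz, H.covDeriv_symm hz, H.tracePairing_fderiv_higgs hz]

theorem tracePairing_fderiv_fderiv (H : IsHiggsFieldOn st τ C Λ θ Ω) (hz : z ∈ Ω) (u v w x : E) :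
    tracePairing st τ m (fderiv ℝ θ z u v) (fderiv ℝ θ z w x) =
      tracePairing st τ m (covDeriv st θ z u v) (covDeriv st θ z w x) +
        tracePairing st τ m (torsion st θ z u v) (torsion st θ z w x) := by
  rw [fderiv_higgs_eq (st := st), fderiv_higgs_eq (st := st)]
  simp only [map_sub, sub_apply, H.tracePairing_covDeriv_torsion hz,
    H.involution.tracePairing_comm (torsion st θ z u v) (covDeriv st θ z w x)]
  ring

theorem tracePairing_pos (H : IsHiggsFieldOn st τ C Λ θ Ω) (hm : 0 < m) (hz : z ∈ Ω) {a : 𝓐}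
    (ha : Λ z * a - a * Λ z = -a) (ha0 : a ≠ 0) : 0 < tracePairing st τ m a a := by
  rw [tracePairing_apply]
  nlinarith [H.trace_neg z hz a ha ha0]

theorem tracePairing_nonneg (H : IsHiggsFieldOn st τ C Λ θ Ω) (hm : 0 < m) (hz : z ∈ Ω) {a : 𝓐}
    (ha : Λ z * a - a * Λ z = -a) : 0 ≤ tracePairing st τ m a a := by
  by_cases ha0 : a = 0
  · simp [ha0]
  · exact (H.tracePairing_pos hm hz ha ha0).le

theorem tracePairing_torsion_nonpos (H : IsHiggsFieldOn st τ C Λ θ Ω) (hm : 0 < m) (hz : z ∈ Ω)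
    (u v : E) : tracePairing st τ m (torsion st θ z u v) (torsion st θ z u v) ≤ 0 := by
  rw [tracePairing_apply]
  nlinarith [H.trace_nonneg z hz _ (H.torsion_degree hz u v)]

theorem tracePairing_higgs_pos (H : IsHiggsFieldOn st τ C Λ θ Ω) (hm : 0 < m) (hz : z ∈ Ω) {u : E}
    (hu : u ≠ 0) : 0 < tracePairing st τ m (θ z u) (θ z u) :=
  H.tracePairing_pos hm hz (H.higgs_degree z hz u) fun h => hu (H.injective z hz u h)

theorem map_torsion (H : IsHiggsFieldOn st τ C Λ θ Ω) (z u v : E) :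
    st (torsion st θ z u v) = torsion st θ z v u := by
  simp only [torsion, map_sub, H.involution.map_mul, H.involution.involutive]

/-- Cyclicity of the trace and commutation of θ_u with θ_w. It converts the torsion term of the
Ricci curvature into the one of the bisectional curvature. -/
theorem tracePairing_torsion_swap (H : IsHiggsFieldOn st τ C Λ θ Ω) (hz : z ∈ Ω) (u w : E) :
    tracePairing st τ m (torsion st θ z u u) (torsion st θ z w w) =
      tracePairing st τ m (torsion st θ z u w) (torsion st θ z u w) := by
  rw [tracePairing_apply, tracePairing_apply, H.map_torsion, H.map_torsion]
  have h1 := H.higgs_comm hz u w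
  have hc := H.involution.trace_comm
  simp only [torsion]
  generalize θ z u = A at *
  generalize θ z w = B at *
  congr 2
  have e1 : τ (st A * A * (st B * B)) = τ (B * st A * (A * st B)) := by
    rw [← mul_assoc, hc]; simp only [mul_assoc]
  have e2 : τ (A * st A * (B * st B)) = τ (st A * B * (st B * A)) := by
    rw [mul_assoc, hc]; simp only [mul_assoc]
  have e3 : st A * A * (B * st B) = st A * B * (A * st B) := by
    rw [mul_assoc, ← mul_assoc A, h1]; simp only [mul_assoc]
  have e4 : τ (A * st A * (st B * B)) = τ (B * st A * (st B * A)) := by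
    rw [← mul_assoc, hc, ← mul_assoc, ← mul_assoc, ← h1, mul_assoc, mul_assoc, hc]
    simp only [mul_assoc]
  have e5 : (st A * A - A * st A) * (st B * B - B * st B) = st A * A * (st B * B)
      - st A * A * (B * st B) - A * st A * (st B * B) + A * st A * (B * st B) := by noncomm_ring
  have e6 : (st A * B - B * st A) * (st B * A - A * st B) = st A * B * (st B * A)
      - st A * B * (A * st B) - B * st A * (st B * A) + B * st A * (A * st B) := by noncomm_ring
  rw [e5, e6]
  simp only [map_add, map_sub, e1, e2, e3, e4]
  ring

/-- The trace of `[θ_u*, θ_u]` against the grading operator gives the norm of `θ_u`. -/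
theorem sq_le_of_torsion (H : IsHiggsFieldOn st τ C Λ θ Ω) (hm : 0 < m) (hC : 0 < C) (hz : z ∈ Ω)
    (u : E) :
    tracePairing st τ m (torsion st θ z u u) (torsion st θ z u u) ≤
      -(1 / (m * C)) * (tracePairing st τ m (θ z u) (θ z u)) ^ 2 := by
  set W := torsion st θ z u u with hW
  have hsW : st W = W := H.map_torsion z u u
  have hWL := H.torsion_degree hz u u
  rw [← hW] at hWL
  set t := (τ (θ z u * st (θ z u))).re with ht
  -- By cyclicity tr([θ*, θ] Λ) = tr(θ* [θ, Λ]), and [θ, Λ] = θ.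
  have hWt : τ (W * Λ z) = τ (θ z u * st (θ z u)) := by
    have h1 := H.higgs_degree z hz u
    have h2 : st (θ z u) * (θ z u * Λ z) = st (θ z u) * θ z u + st (θ z u) * (Λ z * θ z u) := by
      rw [← mul_add]
      congr 1
      linear_combination (norm := noncomm_ring) (-1 : ℤ) • h1
    have h3 : τ (θ z u * st (θ z u) * Λ z) = τ (st (θ z u) * (Λ z * θ z u)) := by
      rw [mul_assoc, H.involution.trace_comm, mul_assoc]
    rw [hW, torsion, sub_mul, map_sub, h3, mul_assoc, h2, map_add,
      H.involution.trace_comm (st (θ z u))]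
    ring
  -- Cauchy-Schwarz for W and Λ in degree 0, obtained by testing semidefiniteness on W - (t/C) Λ;
  -- the coefficient is the optimal one when tr Λ² is replaced by its bound C.
  have hpos := H.trace_nonneg z hz (W - ((t / C : ℝ) : ℂ) • Λ z) (by
    rw [mul_sub, sub_mul, hWL, mul_smul_comm, smul_mul_assoc])
  have hst : st (W - ((t / C : ℝ) : ℂ) • Λ z) = W - ((t / C : ℝ) : ℂ) • Λ z := by
    rw [map_sub, hsW, H.involution.map_smul, H.map_grading z hz, RCLike.star_def,
      Complex.conj_ofReal]
  rw [hst, sub_mul, mul_sub, mul_sub, smul_mul_assoc, smul_mul_assoc, mul_smul_comm,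
    mul_smul_comm, hWL] at hpos
  simp only [map_sub, map_smul, smul_eq_mul, hWt, Complex.sub_re, Complex.re_ofReal_mul,
    ← ht] at hpos
  have hL := H.trace_grading z hz
  rw [tracePairing_apply, tracePairing_apply, hsW, ← ht]
  set ww := (τ (W * W)).re
  have h5 : t / C * (t / C * (τ (Λ z * Λ z)).re) ≤ t / C * t := by
    have h6 : t / C * (t / C * (τ (Λ z * Λ z)).re) ≤ t / C * (t / C * C) := by
      rw [← mul_assoc, ← mul_assoc]
      exact mul_le_mul_of_nonneg_left hL (mul_self_nonneg _)
    rwa [div_mul_cancel₀ _ hC.ne'] at h6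
  have h7 : t / C * t ≤ ww := by linarith
  have h8 : -(1 / (m * C)) * (-m * t) ^ 2 = -m * (t / C * t) := by
    field_simp
  rw [h8]
  nlinarith

end IsHiggsFieldOn

end HiggsPairing

/-! ### Traces of negative operators -/

section Trace

/-- If `T` is negative semidefinite for a positive definite form, its trace is bounded by every
Rayleigh quotient. -/
theorem trace_mul_le_of_nonpos {V : Type*} [AddCommGroup V] [Module ℝ V] [FiniteDimensional ℝ V]
    (B : V →ₗ[ℝ] V →ₗ[ℝ] ℝ) (hsymm : ∀ x y, B x y = B y x) (hpos : ∀ x, x ≠ 0 → 0 < B x x)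
    (T : V →ₗ[ℝ] V) (hT : ∀ x, B (T x) x ≤ 0) (u : V) :
    LinearMap.trace ℝ V T * B u u ≤ B (T u) u := by
  by_cases hu : u = 0
  · simp [hu]
  let core : InnerProductSpace.Core ℝ V :=
    { inner := fun x y => B x y
      conj_inner_symm := fun x y => by simp [hsymm x y]
      re_inner_nonneg := fun x => by
        by_cases hx : x = 0
        · simp [hx]
        · exact (hpos x hx).le
      add_left := fun x y z => by simp
      smul_left := fun x y r => by simp
      definite := fun x hx => by
        by_contra h0
        exact (hpos x h0).ne' hx }
  let _ : NormedAddCommGroup V := core.toNormedAddCommGroup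
  let _ : InnerProductSpace ℝ V := InnerProductSpace.ofCore core.toCore
  have hinner : ∀ x y : V, inner ℝ x y = B x y := fun x y => rfl
  set e : V := (‖u‖⁻¹ : ℝ) • u with he
  have hun : ‖u‖ ≠ 0 := norm_ne_zero_iff.2 hu
  have hnorm : ‖e‖ = 1 := by rw [he, norm_smul, norm_inv, norm_norm, inv_mul_cancel₀ hun]
  have horth : Orthonormal ℝ ((↑) : ({e} : Set V) → V) := by
    rw [orthonormal_subsingleton_iff]
    rintro ⟨x, hx⟩
    rw [Set.mem_singleton_iff] at hx
    simpa [hx] using hnorm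
  obtain ⟨s, b, hs, hb⟩ := horth.exists_orthonormalBasis_extension
  have htr : LinearMap.trace ℝ V T = ∑ i, B (T (b i)) (b i) := by
    rw [LinearMap.trace_eq_sum_inner T b]
    exact Finset.sum_congr rfl fun i _ => by rw [hinner, hsymm]
  have hes : e ∈ s := hs rfl
  -- All diagonal entries are nonpositive, so every one except that of e may be dropped.
  have hle : ∑ i, B (T (b i)) (b i) ≤ B (T e) e := by
    have h1 := Finset.sum_le_sum_of_subset_of_nonneg (Finset.subset_univ {(⟨e, hes⟩ : s)})
      (f := fun i => -B (T (b i)) (b i)) (fun i _ _ => neg_nonneg.2 (hT _))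
    rw [Finset.sum_singleton, Finset.sum_neg_distrib] at h1
    have h2 : b ⟨e, hes⟩ = e := by rw [hb]
    rw [h2] at h1
    linarith
  have huu : B u u = ‖u‖ ^ 2 := by rw [← hinner, real_inner_self_eq_norm_sq]
  have hBe : B (T e) e * ‖u‖ ^ 2 = B (T u) u := by
    simp only [he, map_smul, LinearMap.smul_apply, smul_eq_mul]
    field_simp
  rw [htr, huu, ← hBe]
  exact mul_le_mul_of_nonneg_right hle (sq_nonneg _)

end Trace

/-! ### The Kähler property, the Levi-Civita connection and the Gauss equation -/

section HiggsCurvature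

variable {E : Type*} [NormedAddCommGroup E] [NormedSpace ℂ E]
variable {𝓐 : Type*} [NormedRing 𝓐] [NormedAlgebra ℂ 𝓐]

namespace IsHiggsFieldOn

variable {st : 𝓐 →L[ℝ] 𝓐} {τ : 𝓐 →L[ℂ] ℂ} {C m : ℝ} {Λ : E → 𝓐} {θ : E → E →L[ℝ] 𝓐} {Ω : Set E}
  {z : E} {g : E → E → E → ℝ}

theorem fderiv_metric (H : IsHiggsFieldOn st τ C Λ θ Ω)
    (hg : ∀ z ∈ Ω, ∀ u v, g z u v = tracePairing st τ m (θ z u) (θ z v)) (hz : z ∈ Ω)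
    (u v w : E) :
    fderiv ℝ (fun y => g y v w) z u = tracePairing st τ m (fderiv ℝ θ z u v) (θ z w)
      + tracePairing st τ m (fderiv ℝ θ z u w) (θ z v) := by
  have h1 := (tracePairing st τ m).hasFDerivAt_of_bilinear (H.hasFDerivAt_higgs_apply hz v)
    (H.hasFDerivAt_higgs_apply hz w)
  have h2 : (fun y => g y v w) =ᶠ[𝓝 z] fun y => tracePairing st τ m (θ y v) (θ y w) := by
    filter_upwards [H.isOpen.mem_nhds hz] with y hy using hg y hy v w
  rw [(h1.congr_of_eventuallyEq h2).fderiv,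
    H.involution.tracePairing_comm (fderiv ℝ θ z u w)]
  simp [add_comm]

theorem contDiffOn_higgs_apply (H : IsHiggsFieldOn st τ C Λ θ Ω) (v : E) :
    ContDiffOn ℝ ∞ (fun y => θ y v) Ω :=
  H.contDiffOn_higgs.clm_apply contDiffOn_const

/-- The metric defined by a Higgs field is Kähler. -/
theorem isKahlerOn (H : IsHiggsFieldOn st τ C Λ θ Ω) (hm : 0 < m)
    (hg : ∀ z ∈ Ω, ∀ u v, g z u v = tracePairing st τ m (θ z u) (θ z v)) : IsKahlerOn g Ω where
  add_left z hz u u' v := by simp [hg z hz]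
  smul_left z hz a u v := by simp [hg z hz]
  symm z hz u v := by rw [hg z hz, hg z hz, H.involution.tracePairing_comm]
  pos z hz u hu := by rw [hg z hz]; exact H.tracePairing_higgs_pos hm hz hu
  smooth u v := by
    refine ContDiffOn.congr (f := fun z => tracePairing st τ m (θ z u) (θ z v)) ?_
      (fun z hz => hg z hz u v)
    exact ((tracePairing st τ m).contDiff.comp_contDiffOn (H.contDiffOn_higgs_apply u)).clm_apply
      (H.contDiffOn_higgs_apply v)
  hermitian z hz u v := by
    rw [hg z hz, hg z hz, H.higgs_I z hz, H.higgs_I z hz, H.involution.tracePairing_I]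
  closed z hz u v w := by
    have key : ∀ u v w, fderiv ℝ (fun y => g y (Complex.I • v) w) z u =
        tracePairing st τ m (Complex.I • fderiv ℝ θ z u v) (θ z w)
          - tracePairing st τ m (Complex.I • fderiv ℝ θ z u w) (θ z v) := by
      intro u v w
      rw [H.fderiv_metric hg hz, H.fderiv_higgs_I hz, H.higgs_I z hz,
        ← H.involution.tracePairing_I (fderiv ℝ θ z u w), smul_smul, Complex.I_mul_I]
      simp [sub_eq_add_neg]
    -- Since ⟨∂_uθ_v, θ_w⟩ is symmetric in u and v, the six terms of the cyclic sum cancel in pairs.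
    have hs : ∀ u v w, tracePairing st τ m (Complex.I • fderiv ℝ θ z u v) (θ z w) =
        tracePairing st τ m (Complex.I • fderiv ℝ θ z v u) (θ z w) := by
      intro u v w
      have h1 := H.tracePairing_fderiv_higgs_symm (m := m) hz u v (Complex.I • w)
      rw [H.higgs_I z hz, ← H.involution.tracePairing_I, ← H.involution.tracePairing_I _
        (Complex.I • θ z w), smul_smul, Complex.I_mul_I] at h1
      simpa using h1
    rw [key, key, key, hs u v w, hs v w u, hs w u v]
    ring

variable (st τ m θ) in
/-- The metric as a map to the dual space. -/
def metricMap (z : E) : E →L[ℝ] E →L[ℝ] ℝ := (tracePairing st τ m).bilinearComp (θ z) (θ z)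

theorem metricMap_apply (z u v : E) :
    metricMap st τ m θ z u v = tracePairing st τ m (θ z u) (θ z v) := rfl

theorem metricMap_injective (H : IsHiggsFieldOn st τ C Λ θ Ω) (hm : 0 < m) (hz : z ∈ Ω) :
    Function.Injective (metricMap st τ m θ z) := by
  rw [injective_iff_map_eq_zero]
  intro u hu
  by_contra h0
  have := H.tracePairing_higgs_pos hm hz h0
  rw [← metricMap_apply, hu] at this
  simp at this

theorem eq_of_tracePairing_higgs (H : IsHiggsFieldOn st τ C Λ θ Ω) (hm : 0 < m) (hz : z ∈ Ω)
    {a b : E} (h : ∀ w, tracePairing st τ m (θ z a) (θ z w) = tracePairing st τ m (θ z b) (θ z w)) :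
    a = b :=
  H.metricMap_injective hm hz (ContinuousLinearMap.ext h)

variable [FiniteDimensional ℂ E]

theorem exists_metricEquiv (H : IsHiggsFieldOn st τ C Λ θ Ω) (hm : 0 < m) (hz : z ∈ Ω) :
    ∃ e : E ≃L[ℝ] (E →L[ℝ] ℝ), (e : E →L[ℝ] E →L[ℝ] ℝ) = metricMap st τ m θ z := by
  have hdim : Module.finrank ℝ E = Module.finrank ℝ (E →L[ℝ] ℝ) := by
    rw [← (LinearMap.toContinuousLinearMap (𝕜 := ℝ) (E := E) (F' := ℝ)).finrank_eq]
    exact (Subspace.dual_finrank_eq (K := ℝ) (V := E)).symm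
  refine ⟨(LinearEquiv.ofInjectiveOfFinrankEq (metricMap st τ m θ z).toLinearMap
    (H.metricMap_injective hm hz) hdim).toContinuousLinearEquiv, ?_⟩
  ext u v
  rfl

/-- By the symmetry of ⟨∂_uθ_v, θ_w⟩ in u and v the Koszul expression collapses to twice one term,
and nondegeneracy of g provides a solution, so the chosen vector does satisfy the Koszul formula.
The Levi-Civita connection is thus the projection of the flat derivative to the image of θ. -/
theorem christoffel_spec (H : IsHiggsFieldOn st τ C Λ θ Ω) (hm : 0 < m)
    (hg : ∀ z ∈ Ω, ∀ u v, g z u v = tracePairing st τ m (θ z u) (θ z v)) (hz : z ∈ Ω)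
    (u v w : E) :
    tracePairing st τ m (θ z (christoffel g z u v)) (θ z w) =
      tracePairing st τ m (fderiv ℝ θ z u v) (θ z w) := by
  have hkos : ∀ w, fderiv ℝ (fun y => g y v w) z u + fderiv ℝ (fun y => g y u w) z v
      - fderiv ℝ (fun y => g y u v) z w = 2 * tracePairing st τ m (fderiv ℝ θ z u v) (θ z w) := by
    intro w
    rw [H.fderiv_metric hg hz, H.fderiv_metric hg hz, H.fderiv_metric hg hz,
      H.tracePairing_fderiv_higgs_symm hz v u, H.tracePairing_fderiv_higgs_symm hz w u,
      H.tracePairing_fderiv_higgs_symm hz w v]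
    ring
  obtain ⟨e, he⟩ := H.exists_metricEquiv hm hz
  have hex : ∃ a, ∀ w, 2 * g z a w =
      fderiv ℝ (fun y => g y v w) z u + fderiv ℝ (fun y => g y u w) z v
      - fderiv ℝ (fun y => g y u v) z w := by
    refine ⟨e.symm ((tracePairing st τ m (fderiv ℝ θ z u v)).comp (θ z)), fun w => ?_⟩
    rw [hkos, hg z hz, ← metricMap_apply, ← he]
    simp
  have h1 := Classical.epsilon_spec hex w
  rw [hkos, hg z hz] at h1
  exact mul_left_cancel₀ two_ne_zero h1

theorem christoffel_symm (H : IsHiggsFieldOn st τ C Λ θ Ω) (hm : 0 < m)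
    (hg : ∀ z ∈ Ω, ∀ u v, g z u v = tracePairing st τ m (θ z u) (θ z v)) (hz : z ∈ Ω) (u v : E) :
    christoffel g z u v = christoffel g z v u :=
  H.eq_of_tracePairing_higgs hm hz fun w => by
    rw [H.christoffel_spec hm hg hz, H.christoffel_spec hm hg hz,
      H.tracePairing_fderiv_higgs_symm hz]

theorem christoffel_add_left (H : IsHiggsFieldOn st τ C Λ θ Ω) (hm : 0 < m)
    (hg : ∀ z ∈ Ω, ∀ u v, g z u v = tracePairing st τ m (θ z u) (θ z v)) (hz : z ∈ Ω)
    (u u' v : E) :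
    christoffel g z (u + u') v = christoffel g z u v + christoffel g z u' v :=
  H.eq_of_tracePairing_higgs hm hz fun w => by
    simp only [map_add, add_apply, H.christoffel_spec hm hg hz]

theorem christoffel_smul_left (H : IsHiggsFieldOn st τ C Λ θ Ω) (hm : 0 < m)
    (hg : ∀ z ∈ Ω, ∀ u v, g z u v = tracePairing st τ m (θ z u) (θ z v)) (hz : z ∈ Ω)
    (r : ℝ) (u v : E) : christoffel g z (r • u) v = r • christoffel g z u v :=
  H.eq_of_tracePairing_higgs hm hz fun w => by
    simp only [map_smul, smul_apply, H.christoffel_spec hm hg hz]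

theorem christoffel_I_right (H : IsHiggsFieldOn st τ C Λ θ Ω) (hm : 0 < m)
    (hg : ∀ z ∈ Ω, ∀ u v, g z u v = tracePairing st τ m (θ z u) (θ z v)) (hz : z ∈ Ω) (u v : E) :
    christoffel g z u (Complex.I • v) = Complex.I • christoffel g z u v :=
  H.eq_of_tracePairing_higgs hm hz fun w => by
    have h1 := H.christoffel_spec hm hg hz u v (Complex.I • w)
    rw [H.higgs_I z hz, ← H.involution.tracePairing_I, ← H.involution.tracePairing_I
      (fderiv ℝ θ z u v), smul_smul, Complex.I_mul_I] at h1
    rw [H.christoffel_spec hm hg hz, H.fderiv_higgs_I hz, H.higgs_I z hz]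
    simpa using h1.symm

theorem christoffel_I_left (H : IsHiggsFieldOn st τ C Λ θ Ω) (hm : 0 < m)
    (hg : ∀ z ∈ Ω, ∀ u v, g z u v = tracePairing st τ m (θ z u) (θ z v)) (hz : z ∈ Ω) (u v : E) :
    christoffel g z (Complex.I • u) v = Complex.I • christoffel g z u v := by
  rw [H.christoffel_symm hm hg hz, H.christoffel_I_right hm hg hz, H.christoffel_symm hm hg hz]

/-- Near z the symbol is the inverse of the metric applied to the covector ⟨∂_uθ_v, θ_·⟩, and
inversion is smooth at an invertible map. -/
theorem differentiableAt_christoffel (H : IsHiggsFieldOn st τ C Λ θ Ω) (hm : 0 < m)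
    (hg : ∀ z ∈ Ω, ∀ u v, g z u v = tracePairing st τ m (θ z u) (θ z v)) (hz : z ∈ Ω) (u v : E) :
    DifferentiableAt ℝ (fun y => christoffel g y u v) z := by
  have hsm := H.contDiffOn_higgs.contDiffAt (H.isOpen.mem_nhds hz)
  have hdθ : DifferentiableAt ℝ (fun y => fderiv ℝ θ y u v) z :=
    ((((contDiffAt_infty.1 hsm 2).fderiv_right (m := 1) (by norm_num)).differentiableAt
      (by simp)).clm_apply (differentiableAt_const u)).clm_apply (differentiableAt_const v)
  have hθ := (H.hasFDerivAt_higgs hz).differentiableAt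
  have hG : DifferentiableAt ℝ (metricMap st τ m θ) z := by
    have h1 : ContDiffOn ℝ ∞ (metricMap st τ m θ) Ω := by
      refine contDiffOn_clm_apply.2 fun a => contDiffOn_clm_apply.2 fun b => ?_
      simp only [metricMap_apply]
      exact ((tracePairing st τ m).contDiff.comp_contDiffOn
        (H.contDiffOn_higgs_apply a)).clm_apply (H.contDiffOn_higgs_apply b)
    exact (h1.contDiffAt (H.isOpen.mem_nhds hz)).differentiableAt (by simp)
  have hK : DifferentiableAt ℝ (fun y => (tracePairing st τ m (fderiv ℝ θ y u v)).comp (θ y)) z :=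
    ((tracePairing st τ m).differentiableAt.comp z hdθ).clm_comp hθ
  obtain ⟨e, he⟩ := H.exists_metricEquiv hm hz
  have hinv : DifferentiableAt ℝ (fun y => ContinuousLinearMap.inverse (metricMap st τ m θ y)) z := by
    have h1 : DifferentiableAt ℝ (ContinuousLinearMap.inverse (R := ℝ) (M := E) (M₂ := E →L[ℝ] ℝ))
        (metricMap st τ m θ z) := by
      rw [← he]
      exact (contDiffAt_map_inverse (n := 1) e).differentiableAt (by simp)
    exact DifferentiableAt.comp (𝕜 := ℝ) (F := E →L[ℝ] E →L[ℝ] ℝ) (G := (E →L[ℝ] ℝ) →L[ℝ] E)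
      (g := ContinuousLinearMap.inverse) (f := metricMap st τ m θ) z h1 hG
  refine (hinv.clm_apply hK).congr_of_eventuallyEq ?_
  filter_upwards [H.isOpen.mem_nhds hz] with y hy
  obtain ⟨e', he'⟩ := H.exists_metricEquiv hm hy
  rw [← he', ContinuousLinearMap.inverse_equiv]
  change _ = e'.symm _
  rw [ContinuousLinearEquiv.eq_symm_apply]
  ext w
  have := H.christoffel_spec hm hg hy u v w
  rw [← metricMap_apply, ← he'] at this
  exact this

/-- Gauss equation for the image of θ in the algebra with its constant pairing: the trivial
connection there has no curvature, so only products of first derivatives of θ and of their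
tangential parts remain. -/
theorem tracePairing_curvature (H : IsHiggsFieldOn st τ C Λ θ Ω) (hm : 0 < m)
    (hg : ∀ z ∈ Ω, ∀ u v, g z u v = tracePairing st τ m (θ z u) (θ z v)) (hz : z ∈ Ω)
    (u v w x : E) :
    tracePairing st τ m (θ z (curvature g z u v w)) (θ z x) =
      tracePairing st τ m (fderiv ℝ θ z v w) (fderiv ℝ θ z u x)
        - tracePairing st τ m (fderiv ℝ θ z u w) (fderiv ℝ θ z v x)
        - tracePairing st τ m (θ z (christoffel g z v w)) (θ z (christoffel g z u x))
        + tracePairing st τ m (θ z (christoffel g z u w)) (θ z (christoffel g z v x)) := by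
  have hsm := H.contDiffOn_higgs.contDiffAt (H.isOpen.mem_nhds hz)
  have hd2 : DifferentiableAt ℝ (fderiv ℝ θ) z :=
    ((contDiffAt_infty.1 hsm 2).fderiv_right (m := 1) (by norm_num)).differentiableAt (by simp)
  have hsymm : IsSymmSndFDerivAt ℝ θ z := (contDiffAt_infty.1 hsm 2).isSymmSndFDerivAt (by simp)
  -- Derivative in the direction u of ⟨θ(Γ(v, w)), θ_x⟩ = ⟨∂_vθ_w, θ_x⟩. The second derivative of θ
  -- cancels upon antisymmetrizing in u and v.
  have key : ∀ u v, tracePairing st τ m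
      (θ z (fderiv ℝ (fun y => christoffel g y v w) z u)) (θ z x)
      + tracePairing st τ m (θ z (christoffel g z u (christoffel g z v w))) (θ z x)
      = tracePairing st τ m (fderiv ℝ (fderiv ℝ θ) z u v w) (θ z x)
        + tracePairing st τ m (fderiv ℝ θ z v w) (fderiv ℝ θ z u x)
        - tracePairing st τ m (θ z (christoffel g z v w)) (θ z (christoffel g z u x)) := by
    intro u v
    have hΓ := (H.differentiableAt_christoffel hm hg hz v w).hasFDerivAt
    have hθx := H.hasFDerivAt_higgs_apply hz x
    have hl := (tracePairing st τ m).hasFDerivAt_of_bilinear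
      ((H.hasFDerivAt_higgs hz).clm_apply hΓ) hθx
    have hr := (tracePairing st τ m).hasFDerivAt_of_bilinear
      ((hd2.hasFDerivAt.clm_apply (hasFDerivAt_const v z)).clm_apply (hasFDerivAt_const w z)) hθx
    have heq : (fun y => tracePairing st τ m (θ y (christoffel g y v w)) (θ y x)) =ᶠ[𝓝 z]
        fun y => tracePairing st τ m (fderiv ℝ θ y v w) (θ y x) := by
      filter_upwards [H.isOpen.mem_nhds hz] with y hy using H.christoffel_spec hm hg hy v w x
    have h1 := DFunLike.congr_fun (hl.unique (hr.congr_of_eventuallyEq heq)) u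
    simp at h1
    have h2 := H.christoffel_spec hm hg hz u (christoffel g z v w) x
    have h3 := H.christoffel_spec hm hg hz u x (christoffel g z v w)
    rw [H.involution.tracePairing_comm, H.involution.tracePairing_comm (fderiv ℝ θ z u x)] at h3
    linarith
  have h1 := key u v
  have h2 := key v u
  rw [hsymm.eq] at h1
  simp only [curvature, map_add, map_sub, add_apply,
    sub_apply]
  linarith

end IsHiggsFieldOn

end HiggsCurvature

/-! ### Curvature estimates for the metric of a Higgs field -/

section HiggsCurvatureBounds

variable {E : Type*} [NormedAddCommGroup E] [NormedSpace ℂ E] [FiniteDimensional ℂ E]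
variable {𝓐 : Type*} [NormedRing 𝓐] [NormedAlgebra ℂ 𝓐]

namespace IsHiggsFieldOn

variable {st : 𝓐 →L[ℝ] 𝓐} {τ : 𝓐 →L[ℂ] ℂ} {C m : ℝ} {Λ : E → 𝓐} {θ : E → E →L[ℝ] 𝓐} {Ω : Set E}
  {z : E} {g : E → E → E → ℝ}

/-- The second fundamental form of the image of the Higgs field has a sign. -/
theorem christoffel_le_covDeriv (H : IsHiggsFieldOn st τ C Λ θ Ω) (hm : 0 < m)
    (hg : ∀ z ∈ Ω, ∀ u v, g z u v = tracePairing st τ m (θ z u) (θ z v)) (hz : z ∈ Ω) (u v : E) :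
    tracePairing st τ m (θ z (christoffel g z u v)) (θ z (christoffel g z u v)) ≤
      tracePairing st τ m (covDeriv st θ z u v) (covDeriv st θ z u v) := by
  have h1 := H.christoffel_spec hm hg hz u v (christoffel g z u v)
  rw [H.tracePairing_fderiv_higgs hz] at h1
  have h2 := H.tracePairing_nonneg hm hz
    (a := covDeriv st θ z u v - θ z (christoffel g z u v)) (by
      linear_combination (norm := noncomm_ring) H.covDeriv_degree hz u v
        - H.higgs_degree z hz (christoffel g z u v))
  simp only [map_sub, sub_apply] at h2
  rw [H.involution.tracePairing_comm (θ z _) (covDeriv st θ z u v)] at h2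
  linarith

/-- In the Gauss equation the factors i make the ∇θ terms add up to -2|∇_uθ_v|² and the Γ terms to
2|Γ(u, v)|². The torsion is conjugate linear on the left, so its two terms add up with the opposite
sign, to 2⟨T_uv, T_uv⟩. -/
theorem curvature_bisectional (H : IsHiggsFieldOn st τ C Λ θ Ω) (hm : 0 < m)
    (hg : ∀ z ∈ Ω, ∀ u v, g z u v = tracePairing st τ m (θ z u) (θ z v)) (hz : z ∈ Ω) (u v : E) :
    g z (curvature g z u (Complex.I • u) (Complex.I • v)) v ≤
      2 * tracePairing st τ m (torsion st θ z u v) (torsion st θ z u v) := by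
  rw [hg z hz, H.tracePairing_curvature hm hg hz]
  simp only [H.tracePairing_fderiv_fderiv hz, H.covDeriv_I_left hz, H.covDeriv_I_right hz,
    H.torsion_I_left hz, H.torsion_I_right hz, H.christoffel_I_left hm hg hz,
    H.christoffel_I_right hm hg hz, H.higgs_I z hz, smul_smul, Complex.I_mul_I, neg_smul,
    one_smul, map_neg, neg_apply, H.involution.tracePairing_I, neg_neg]
  have := H.christoffel_le_covDeriv hm hg hz u v
  linarith

/-- Adding the terms for w and Jw cancels ⟨∇_uθ_u, ∇_wθ_w⟩, where J contributes i² = -1, and its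
analogue for Γ. The surviving torsion term 2⟨T_uu, T_ww⟩ is rewritten by
`tracePairing_torsion_swap`. -/
theorem curvature_ricci (H : IsHiggsFieldOn st τ C Λ θ Ω) (hm : 0 < m)
    (hg : ∀ z ∈ Ω, ∀ u v, g z u v = tracePairing st τ m (θ z u) (θ z v)) (hz : z ∈ Ω) (u w : E) :
    g z (curvature g z w u u) w + g z (curvature g z (Complex.I • w) u u) (Complex.I • w) ≤
      2 * tracePairing st τ m (torsion st θ z u w) (torsion st θ z u w) := by
  rw [hg z hz, hg z hz, H.tracePairing_curvature hm hg hz, H.tracePairing_curvature hm hg hz]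
  simp only [H.tracePairing_fderiv_fderiv hz, H.covDeriv_I_left hz, H.covDeriv_I_right hz,
    H.torsion_I_left hz, H.torsion_I_right hz, H.christoffel_I_left hm hg hz,
    H.christoffel_I_right hm hg hz, H.higgs_I z hz, smul_smul, Complex.I_mul_I, neg_smul,
    one_smul, map_neg, neg_apply, H.involution.tracePairing_I, neg_neg]
  rw [H.covDeriv_symm hz w u, H.christoffel_symm hm hg hz w u, H.tracePairing_torsion_swap hz u w]
  have := H.christoffel_le_covDeriv hm hg hz u w
  linarith

theorem bisectionalCurvature_nonpos (H : IsHiggsFieldOn st τ C Λ θ Ω) (hm : 0 < m)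
    (hg : ∀ z ∈ Ω, ∀ u v, g z u v = tracePairing st τ m (θ z u) (θ z v)) (hz : z ∈ Ω) {u v : E}
    (hu : u ≠ 0) (hv : v ≠ 0) : bisectionalCurvature g z u v ≤ 0 := by
  refine div_nonpos_of_nonpos_of_nonneg ?_ ?_
  · have h1 := H.curvature_bisectional hm hg hz u v
    have h2 := H.tracePairing_torsion_nonpos hm hz u v
    linarith
  · rw [hg z hz, hg z hz]
    exact (mul_pos (H.tracePairing_higgs_pos hm hz hu) (H.tracePairing_higgs_pos hm hz hv)).le

theorem holomorphicSectionalCurvature_le (H : IsHiggsFieldOn st τ C Λ θ Ω) (hm : 0 < m)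
    (hC : 0 < C) (hg : ∀ z ∈ Ω, ∀ u v, g z u v = tracePairing st τ m (θ z u) (θ z v))
    (hz : z ∈ Ω) {u : E} (hu : u ≠ 0) :
    holomorphicSectionalCurvature g z u ≤ -(1 / (m * C)) := by
  have h1 := H.curvature_bisectional hm hg hz u u
  have h2 := H.sq_le_of_torsion hm hC hz u
  have h3 := H.tracePairing_torsion_nonpos hm hz u u
  have hpos : 0 < g z u u := by rw [hg z hz]; exact H.tracePairing_higgs_pos hm hz hu
  rw [holomorphicSectionalCurvature, div_le_iff₀ (by positivity)]
  rw [← hg z hz] at h2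
  -- One of the two copies of the torsion term gives the bound; the other is dropped as nonpositive.
  linarith

/-- Needed to read the Ricci sum as a basis-free trace. The symbols are chosen vectors, so linearity
is recovered from the Gauss equation and nondegeneracy. -/
theorem curvature_isLinear (H : IsHiggsFieldOn st τ C Λ θ Ω) (hm : 0 < m)
    (hg : ∀ z ∈ Ω, ∀ u v, g z u v = tracePairing st τ m (θ z u) (θ z v)) (hz : z ∈ Ω) (u : E) :
    IsLinearMap ℝ fun w => curvature g z w u u where
  map_add w w' := H.eq_of_tracePairing_higgs hm hz fun x => by
    simp only [map_add, add_apply, H.tracePairing_curvature hm hg hz,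
      H.christoffel_add_left hm hg hz]
    ring
  map_smul r w := H.eq_of_tracePairing_higgs hm hz fun x => by
    simp only [map_smul, smul_apply, H.tracePairing_curvature hm hg hz,
      H.christoffel_smul_left hm hg hz, smul_eq_mul]
    ring

theorem ricciCurvature_le (H : IsHiggsFieldOn st τ C Λ θ Ω) (hm : 0 < m)
    (hC : 0 < C) (hg : ∀ z ∈ Ω, ∀ u v, g z u v = tracePairing st τ m (θ z u) (θ z v))
    (hz : z ∈ Ω) (u : E) : ricciCurvature g z u u ≤ -(1 / (m * C)) * g z u u := by
  set T : E →ₗ[ℝ] E := (H.curvature_isLinear hm hg hz u).mk' _ with hT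
  have hric : ricciCurvature g z u u = LinearMap.trace ℝ E T := by
    rw [LinearMap.trace_eq_matrix_trace ℝ (Module.finBasis ℝ E), Matrix.trace]
    refine Finset.sum_congr rfl fun i _ => ?_
    rw [Matrix.diag_apply, LinearMap.toMatrix_apply]
    rfl
  set J : E →ₗ[ℝ] E := (LinearMap.lsmul ℂ E Complex.I).restrictScalars ℝ with hJ
  have hJa : ∀ x, J x = Complex.I • x := fun x => rfl
  have hJJ : J * J = -1 := by
    ext x
    simp [hJa, smul_smul]
  -- Since J⁻¹ = -J, the operator T - J T J is the sum of T and its conjugate by J. Its quadratic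
  -- form at w adds those of T at w and Jw, which is what `curvature_ricci` controls.
  have htr : LinearMap.trace ℝ E (T - J * T * J) = 2 * LinearMap.trace ℝ E T := by
    rw [map_sub, LinearMap.trace_mul_comm, ← mul_assoc, hJJ]
    simp
    ring
  set B : E →ₗ[ℝ] E →ₗ[ℝ] ℝ := (metricMap st τ m θ z).toLinearMap₁₂ with hB
  have hBa : ∀ x y, B x y = tracePairing st τ m (θ z x) (θ z y) := fun x y => rfl
  have hBJ : ∀ x y, B (J x) (J y) = B x y := fun x y => by
    simp only [hBa, hJa, H.higgs_I z hz, H.involution.tracePairing_I]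
  have hBT : ∀ w, B ((T - J * T * J) w) w = g z (curvature g z w u u) w
      + g z (curvature g z (Complex.I • w) u u) (Complex.I • w) := by
    intro w
    have h1 : B ((J * T * J) w) w = -B (T (J w)) (J w) := by
      rw [← hBJ ((J * T * J) w) w]
      have h2 : J ((J * T * J) w) = -(T (J w)) := by
        have := LinearMap.congr_fun hJJ (T (J w))
        simpa using this
      rw [h2]
      simp
    rw [LinearMap.sub_apply, map_sub, LinearMap.sub_apply, h1, sub_neg_eq_add, hBa, hBa,
      ← hg z hz, ← hg z hz]
    rfl
  have key := trace_mul_le_of_nonpos B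
    (fun x y => by rw [hBa, hBa, H.involution.tracePairing_comm])
    (fun x hx => H.tracePairing_higgs_pos hm hz hx) (T - J * T * J)
    (fun w => by
      rw [hBT]
      linarith [H.curvature_ricci hm hg hz u w, H.tracePairing_torsion_nonpos hm hz u w]) u
  rw [htr, hBT, hBa, ← hg z hz] at key
  rw [hric]
  -- The final division by g(u, u) requires u ≠ 0; for u = 0 the operator T itself vanishes.
  by_cases hu : u = 0
  · have hΓ : ∀ x, christoffel g z 0 x = 0 := fun x => by
      simpa using H.christoffel_smul_left hm hg hz 0 0 x
    have hT0 : T = 0 := by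
      ext w
      change curvature g z w u u = 0
      refine H.eq_of_tracePairing_higgs hm hz fun x => ?_
      rw [H.tracePairing_curvature hm hg hz, hu]
      simp [hΓ]
    simp [hT0, hu, hg z hz]
  · have hpos : 0 < g z u u := by rw [hg z hz]; exact H.tracePairing_higgs_pos hm hz hu
    have h2 := H.sq_le_of_torsion hm hC hz u
    have h1 := H.curvature_ricci hm hg hz u u
    rw [← hg z hz] at h2
    have h3 : LinearMap.trace ℝ E T * g z u u ≤ -(1 / (m * C)) * g z u u * g z u u := by
      nlinarith
    exact le_of_mul_le_mul_right h3 hpos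

end IsHiggsFieldOn

end HiggsCurvatureBounds

/-! ### Linear algebra of polarized Hodge structures -/

namespace ClassifyingSpace

variable {ι : Type*} [Fintype ι] [DecidableEq ι]
variable {Q : Matrix ι ι ℝ} {n : ℕ} {h : Fin (n + 1) → ℕ}

/-- The projection of `H` onto `H^{p,n-p}` along the other Hodge components. -/
def projLinear (F : ClassifyingSpace Q n h) (p : Fin (n + 1)) : (ι → ℂ) →ₗ[ℂ] (ι → ℂ) :=
  (F.comp p).subtype ∘ₗ DirectSum.component ℂ (Fin (n + 1)) (fun p => F.comp p) p ∘ₗ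
    (LinearEquiv.ofBijective (DirectSum.coeLinearMap F.comp) F.isInternal).symm.toLinearMap

/-- The matrix of the projection onto `H^{p,n-p}`. -/
def proj (F : ClassifyingSpace Q n h) (p : Fin (n + 1)) : Matrix ι ι ℂ :=
  LinearMap.toMatrix' (F.projLinear p)

variable (F : ClassifyingSpace Q n h)

theorem proj_mulVec (p : Fin (n + 1)) (x : ι → ℂ) : F.proj p *ᵥ x = F.projLinear p x := by
  rw [proj, LinearMap.toMatrix'_mulVec]

theorem proj_mulVec_mem (p : Fin (n + 1)) (x : ι → ℂ) : F.proj p *ᵥ x ∈ F.comp p := by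
  rw [proj_mulVec, projLinear]
  exact Submodule.coe_mem _

theorem proj_mulVec_of_mem {p q : Fin (n + 1)} {x : ι → ℂ} (hx : x ∈ F.comp p) :
    F.proj q *ᵥ x = if q = p then x else 0 := by
  have h1 : (LinearEquiv.ofBijective (DirectSum.coeLinearMap F.comp) F.isInternal).symm x =
      DirectSum.lof ℂ (Fin (n + 1)) (fun p => F.comp p) p ⟨x, hx⟩ := by
    rw [LinearEquiv.symm_apply_eq]
    exact (DirectSum.coeLinearMap_lof F.comp p ⟨x, hx⟩).symm
  rw [proj_mulVec, projLinear]
  simp only [LinearMap.comp_apply, LinearEquiv.coe_coe, h1]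
  by_cases hq : q = p
  · subst hq
    rw [DirectSum.component.lof_self]
    simp
  · rw [DirectSum.component.of, dif_neg (Ne.symm hq)]
    simp [hq]

theorem sum_proj_mulVec (x : ι → ℂ) : ∑ p, F.proj p *ᵥ x = x := by
  have hx : x ∈ ⨆ p, F.comp p := by
    rw [F.isInternal.submodule_iSup_eq_top]; trivial
  induction hx using Submodule.iSup_induction' with
  | mem p y hy => simp [F.proj_mulVec_of_mem hy]
  | zero => simp
  | add y y' _ _ h1 h2 =>
    simp only [Matrix.mulVec_add, Finset.sum_add_distrib, h1, h2]

theorem sum_proj : ∑ p, F.proj p = 1 := by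
  refine Matrix.ext_of_mulVec_single fun i => ?_
  rw [Matrix.sum_mulVec, sum_proj_mulVec, Matrix.one_mulVec]

theorem proj_mul_proj (p q : Fin (n + 1)) :
    F.proj p * F.proj q = if p = q then F.proj p else 0 := by
  refine Matrix.ext_of_mulVec_single fun i => ?_
  rw [← Matrix.mulVec_mulVec, F.proj_mulVec_of_mem (F.proj_mulVec_mem q _)]
  split_ifs with hpq
  · rw [hpq]
  · rw [Matrix.zero_mulVec]

theorem mem_iSup_comp_iff (S : Fin (n + 1) → Prop) [DecidablePred S] (x : ι → ℂ) :
    x ∈ (⨆ (p : Fin (n + 1)) (_ : S p), F.comp p) ↔ (∑ p with S p, F.proj p) *ᵥ x = x := by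
  constructor
  · intro hx
    have hle : (⨆ (p : Fin (n + 1)) (_ : S p), F.comp p) ≤
        LinearMap.eqLocus (Matrix.mulVecLin (∑ p with S p, F.proj p)) LinearMap.id := by
      refine iSup₂_le fun p hp y hy => ?_
      rw [LinearMap.mem_eqLocus, Matrix.mulVecLin_apply, Matrix.sum_mulVec, Finset.sum_filter]
      simp only [F.proj_mulVec_of_mem hy, LinearMap.id_apply]
      rw [Finset.sum_eq_single p] <;> simp +contextual [hp]
    exact hle hx
  · intro hx
    rw [← hx, Matrix.sum_mulVec]
    refine Submodule.sum_mem _ fun p hp => ?_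
    exact Submodule.mem_iSup_of_mem p
      (Submodule.mem_iSup_of_mem (Finset.mem_filter.1 hp).2 (F.proj_mulVec_mem p x))

/-- The projection onto `F^k` along `⨁_{p < k} H^{p,n-p}`. -/
def filProj (k : ℕ) : Matrix ι ι ℂ := ∑ p with k ≤ ((p : Fin (n + 1)) : ℕ), F.proj p

/-- The grading operator, which is multiplication by `p` on `H^{p,n-p}`. -/
def grading : Matrix ι ι ℂ := ∑ p : Fin (n + 1), ((p : ℕ) : ℂ) • F.proj p

/-- The parity operator, which is multiplication by `(-1)^p` on `H^{p,n-p}`. -/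
def parity : Matrix ι ι ℂ := ∑ p : Fin (n + 1), ((-1) ^ (p : ℕ) : ℂ) • F.proj p

theorem mem_fil_iff (k : ℕ) (x : ι → ℂ) : x ∈ F.fil k ↔ F.filProj k *ᵥ x = x :=
  F.mem_iSup_comp_iff (fun p => k ≤ (p : ℕ)) x

theorem sum_smul_proj_mul (a b : Fin (n + 1) → ℂ) :
    (∑ p, a p • F.proj p) * (∑ p, b p • F.proj p) = ∑ p, (a p * b p) • F.proj p := by
  simp only [Finset.sum_mul_sum, smul_mul_smul_comm, proj_mul_proj]
  simp

theorem filProj_eq (k : ℕ) :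
    F.filProj k = ∑ p : Fin (n + 1), (if k ≤ (p : ℕ) then (1 : ℂ) else 0) • F.proj p := by
  simp [filProj, Finset.sum_filter]

theorem filProj_mul_filProj (k l : ℕ) : F.filProj k * F.filProj l = F.filProj (max k l) := by
  simp only [filProj_eq, sum_smul_proj_mul]
  refine Finset.sum_congr rfl fun p _ => ?_
  congr 1
  simp only [sup_le_iff, mul_ite, mul_one, mul_zero]
  split_ifs <;> tauto

theorem filProj_zero : F.filProj 0 = 1 := by simp [filProj, sum_proj]

theorem filProj_of_lt {k : ℕ} (hk : n < k) : F.filProj k = 0 := by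
  rw [filProj, Finset.filter_false_of_mem, Finset.sum_empty]
  intro p _
  have := p.2
  omega

/-- A vector of type p lies in exactly p of the steps F^1, ..., F^n. This expresses Λ through the
filtration, which is what varies holomorphically. -/
theorem grading_eq_sum_filProj : F.grading = ∑ k ∈ Finset.range n, F.filProj (k + 1) := by
  simp only [filProj_eq, grading]
  rw [Finset.sum_comm]
  refine Finset.sum_congr rfl fun p _ => ?_
  rw [← Finset.sum_smul, Finset.sum_ite, Finset.sum_const_zero, add_zero, Finset.sum_const]
  have h1 : (Finset.range n).filter (fun k => k + 1 ≤ (p : ℕ)) = Finset.range p := by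
    ext k
    have := p.2
    simp only [Finset.mem_filter, Finset.mem_range]
    omega
  rw [h1]
  simp

theorem parity_mul_parity : F.parity * F.parity = 1 := by
  rw [parity, sum_smul_proj_mul, ← sum_proj F]
  refine Finset.sum_congr rfl fun p _ => ?_
  rw [← mul_pow]
  simp

/-- The parity operator in terms of the projections onto the Hodge filtration. -/
theorem parity_eq_sum_filProj :
    F.parity = ∑ k ∈ Finset.range (n + 1), ((-1) ^ k : ℂ) • (F.filProj k - F.filProj (k + 1)) := by
  rw [parity, ← Fin.sum_univ_eq_sum_range
    (fun k => ((-1) ^ k : ℂ) • (F.filProj k - F.filProj (k + 1)))]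
  refine Finset.sum_congr rfl fun p _ => ?_
  congr 1
  rw [filProj_eq, filProj_eq, ← Finset.sum_sub_distrib, Finset.sum_eq_single p]
  · simp
  · intro q _ hq
    rw [← sub_smul]
    have h1 : (q : ℕ) ≠ p := fun h => hq (Fin.ext h)
    have h2 : ((p : ℕ) ≤ q ↔ (p : ℕ) + 1 ≤ q) := by omega
    simp [h2]
  · simp

/-- The sign (-1)^p equals (-1)^n (-1)^(n-p), and H^+ collects the types with n - p even. -/
theorem mem_plus_iff (x : ι → ℂ) : x ∈ F.plus ↔ F.parity *ᵥ x = ((-1) ^ n : ℂ) • x := by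
  have h1 : F.parity = ((-1) ^ n : ℂ) •
      ((2 : ℂ) • (∑ p with Even (n - ((p : Fin (n + 1)) : ℕ)), F.proj p) - 1) := by
    rw [← sum_proj F, parity, Finset.sum_filter, Finset.smul_sum, ← Finset.sum_sub_distrib,
      Finset.smul_sum]
    refine Finset.sum_congr rfl fun p _ => ?_
    have hp : n = (p : ℕ) + (n - p) := by have := p.2; omega
    have h2 : ((-1) ^ n : ℂ) = (-1) ^ (p : ℕ) * (-1) ^ (n - (p : ℕ)) := by
      rw [← pow_add, ← hp]
    split_ifs with he
    · rw [h2, he.neg_one_pow]; module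
    · rw [h2, (Nat.not_even_iff_odd.1 he).neg_one_pow]; module
  have h0 : ((-1) ^ n : ℂ) ≠ 0 := by simp
  rw [plus, F.mem_iSup_comp_iff (fun p => Even (n - (p : ℕ))), h1, Matrix.smul_mulVec,
    Matrix.sub_mulVec, Matrix.smul_mulVec, Matrix.one_mulVec, smul_right_inj h0, sub_eq_iff_eq_add,
    ← two_smul ℂ x, smul_right_inj two_ne_zero]

theorem mem_minus_iff (x : ι → ℂ) : x ∈ F.minus ↔ F.parity *ᵥ x = -(((-1) ^ n : ℂ) • x) := by
  have h1 : F.parity = ((-1) ^ n : ℂ) •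
      (1 - (2 : ℂ) • (∑ p with Odd (n - ((p : Fin (n + 1)) : ℕ)), F.proj p)) := by
    rw [← sum_proj F, parity, Finset.sum_filter, Finset.smul_sum, ← Finset.sum_sub_distrib,
      Finset.smul_sum]
    refine Finset.sum_congr rfl fun p _ => ?_
    have hp : n = (p : ℕ) + (n - p) := by have := p.2; omega
    have h2 : ((-1) ^ n : ℂ) = (-1) ^ (p : ℕ) * (-1) ^ (n - (p : ℕ)) := by
      rw [← pow_add, ← hp]
    split_ifs with he
    · rw [h2, he.neg_one_pow]; module
    · rw [h2, (Nat.not_odd_iff_even.1 he).neg_one_pow]; module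
  have h0 : ((-1) ^ n : ℂ) ≠ 0 := by simp
  rw [minus, F.mem_iSup_comp_iff (fun p => Odd (n - (p : ℕ))), h1, Matrix.smul_mulVec,
    Matrix.sub_mulVec, Matrix.smul_mulVec, Matrix.one_mulVec, ← smul_neg, smul_right_inj h0,
    sub_eq_iff_eq_add, eq_neg_add_iff_add_eq, ← two_smul ℂ x, smul_right_inj two_ne_zero, eq_comm]

/-! #### Adjoints and conjugates -/

theorem dotProduct_star_eq_zero {p q : Fin (n + 1)} (hpq : p ≠ q) {x y : ι → ℂ}
    (hx : x ∈ F.comp p) (hy : y ∈ F.comp q) :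
    star x ⬝ᵥ (Q.map Complex.ofReal *ᵥ y) = 0 := by
  refine F.orthogonal p.rev q ?_ (star x) ((F.conj_comp p x).2 hx) y hy
  rw [Fin.rev_rev]
  exact hpq.symm

theorem conjTranspose_proj_mul_mul_proj {p q : Fin (n + 1)} (hpq : p ≠ q) :
    (F.proj p)ᴴ * Q.map Complex.ofReal * F.proj q = 0 := by
  ext i j
  have h1 := F.dotProduct_star_eq_zero hpq (F.proj_mulVec_mem p (Pi.single i 1))
    (F.proj_mulVec_mem q (Pi.single j 1))
  rw [Matrix.star_mulVec, Matrix.mulVec_mulVec, ← Matrix.dotProduct_mulVec, Matrix.mulVec_mulVec,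
    ← mul_assoc] at h1
  simpa [Pi.single_star] using h1

/-- The Hodge components are mutually orthogonal for the flat Hermitian pairing, so their
projections are self-adjoint: inserting ∑ P_q = 1 on either side leaves P_pᴴ Q P_p. -/
theorem conjTranspose_proj_mul (p : Fin (n + 1)) :
    (F.proj p)ᴴ * Q.map Complex.ofReal = Q.map Complex.ofReal * F.proj p := by
  have h1 : (F.proj p)ᴴ * Q.map Complex.ofReal =
      (F.proj p)ᴴ * Q.map Complex.ofReal * F.proj p := by
    conv_lhs => rw [← mul_one ((F.proj p)ᴴ * Q.map Complex.ofReal), ← sum_proj F, Finset.mul_sum]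
    exact Finset.sum_eq_single p
      (fun q _ hq => F.conjTranspose_proj_mul_mul_proj hq.symm) (by simp)
  have h2 : Q.map Complex.ofReal * F.proj p =
      (F.proj p)ᴴ * Q.map Complex.ofReal * F.proj p := by
    have h3 : ∑ q, (F.proj q)ᴴ = 1 := by
      rw [← Matrix.conjTranspose_sum, sum_proj, Matrix.conjTranspose_one]
    conv_lhs => rw [← one_mul (Q.map Complex.ofReal), ← h3, Finset.sum_mul, Finset.sum_mul]
    exact Finset.sum_eq_single p
      (fun q _ hq => F.conjTranspose_proj_mul_mul_proj hq) (by simp)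
  rw [h1, h2]

theorem map_star_proj (p : Fin (n + 1)) : (F.proj p).map star = F.proj p.rev := by
  have h1 : ∀ x : ι → ℂ, (F.proj p).map star *ᵥ x = star (F.proj p *ᵥ star x) := by
    intro x
    ext i
    simp [Matrix.mulVec, dotProduct]
  refine Matrix.ext_of_mulVec_single fun i => ?_
  generalize (Pi.single i 1 : ι → ℂ) = x
  rw [h1]
  have hx : x ∈ ⨆ p, F.comp p := by
    rw [F.isInternal.submodule_iSup_eq_top]; trivial
  induction hx using Submodule.iSup_induction' with
  | mem q y hy =>
    rw [F.proj_mulVec_of_mem hy, F.proj_mulVec_of_mem ((F.conj_comp q y).2 hy)]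
    have : p = q.rev ↔ p.rev = q := by rw [← Fin.rev_inj, Fin.rev_rev]
    simp only [this]
    split_ifs <;> simp
  | zero => simp
  | add y y' _ _ h1 h2 =>
    simp only [Matrix.mulVec_add, star_add, h1, h2]

theorem map_star_grading : F.grading.map star = (n : ℂ) • 1 - F.grading := by
  have h1 : F.grading.map star = ∑ p : Fin (n + 1), ((p : ℕ) : ℂ) • F.proj p.rev := by
    rw [grading]
    ext i j
    simp only [Matrix.map_apply, Matrix.sum_apply, Matrix.smul_apply, smul_eq_mul, star_sum,
      star_mul', star_natCast, ← map_star_proj]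
  rw [h1, ← sum_proj F, grading, Finset.smul_sum, ← Finset.sum_sub_distrib,
    ← Equiv.sum_comp Fin.revPerm]
  refine Finset.sum_congr rfl fun p _ => ?_
  rw [← sub_smul, Fin.revPerm_apply, Fin.rev_rev, Fin.val_rev]
  congr 1
  have := p.2
  rw [Nat.add_sub_add_right, Nat.cast_sub (by omega)]

end ClassifyingSpace

/-! ### Positivity of the trace form and the Hodge inner product -/

section PosDefTrace

variable {ι : Type*} [Fintype ι] [DecidableEq ι]

open scoped MatrixOrder Matrix.Norms.L2Operator in
theorem exists_eq_conjTranspose_mul_self {A : Matrix ι ι ℂ} (hA : A.PosDef) :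
    ∃ B : Matrix ι ι ℂ, IsUnit B.det ∧ A = Bᴴ * B := by
  obtain ⟨B, hB, h⟩ := CStarAlgebra.isStrictlyPositive_iff_eq_star_mul_self.mp
    hA.isStrictlyPositive
  exact ⟨B, (Matrix.isUnit_iff_isUnit_det B).1 hB, h⟩

/-- The trace form `tr(Z Z†)`, with `Z†` the adjoint for a positive definite form, is positive. -/
theorem exists_trace_eq_of_posDef {A Z Z' : Matrix ι ι ℂ} (hA : A.PosDef) (h : A * Z' = Zᴴ * A) :
    0 ≤ (Z * Z').trace.re ∧ (Z ≠ 0 → 0 < (Z * Z').trace.re) := by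
  obtain ⟨B, hB, rfl⟩ := exists_eq_conjTranspose_mul_self hA
  have hBH : IsUnit Bᴴ.det := by rw [Matrix.det_conjTranspose]; exact hB.star
  -- Conjugation by a factor B of A = Bᴴ B turns the A-adjoint into the conjugate transpose.
  set Y := B * Z * B⁻¹ with hY
  have h1 : B * Z' * B⁻¹ = Yᴴ := by
    have h2 : B * Z' = (Bᴴ)⁻¹ * (Zᴴ * (Bᴴ * B)) := by
      rw [← h, mul_assoc, Matrix.nonsing_inv_mul_cancel_left _ _ hBH]
    rw [h2, hY, Matrix.conjTranspose_mul, Matrix.conjTranspose_mul, Matrix.conjTranspose_nonsing_inv]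
    simp only [mul_assoc, Matrix.mul_nonsing_inv _ hB, mul_one]
  have h2 : (Z * Z').trace = (Y * Yᴴ).trace := by
    rw [← h1, hY]
    have h3 : B * Z * B⁻¹ * (B * Z' * B⁻¹) = B * (Z * Z' * B⁻¹) := by
      simp only [mul_assoc, Matrix.nonsing_inv_mul_cancel_left _ _ hB]
    rw [h3, Matrix.trace_mul_comm B, mul_assoc (Z * Z'), Matrix.nonsing_inv_mul _ hB, mul_one]
  have h4 : 0 ≤ (Y * Yᴴ).trace := (Matrix.posSemidef_self_mul_conjTranspose Y).trace_nonneg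
  obtain ⟨h5, h6⟩ := Complex.le_def.1 h4
  rw [h2]
  refine ⟨h5, fun hZ => lt_of_le_of_ne h5 fun h0 => hZ ?_⟩
  have h7 : (Y * Yᴴ).trace = 0 := Complex.ext h0.symm h6.symm
  rw [Matrix.trace_mul_conjTranspose_self_eq_zero_iff, hY] at h7
  have h8 : B⁻¹ * (B * Z * B⁻¹) * B = Z := by
    rw [mul_assoc, mul_assoc, Matrix.nonsing_inv_mul _ hB, mul_one,
      Matrix.nonsing_inv_mul_cancel_left _ _ hB]
  rw [← h8, h7]
  simp

end PosDefTrace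

namespace ClassifyingSpace

variable {ι : Type*} [Fintype ι] [DecidableEq ι]
variable {Q : Matrix ι ι ℝ} {n : ℕ} {h : Fin (n + 1) → ℕ}
variable (F : ClassifyingSpace Q n h)

/-- The Gram matrix of the Hodge inner product. -/
def hodgeForm : Matrix ι ι ℂ := (Complex.I ^ n) • (Q.map Complex.ofReal * F.parity)

/-- The conjugate of the second Hodge-Riemann relation: the conjugate of i^(2p-n) is i^n (-1)^p. -/
theorem hodgeForm_pos_of_mem {p : Fin (n + 1)} {x : ι → ℂ} (hx : x ∈ F.comp p) (hx0 : x ≠ 0) :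
    0 < Complex.I ^ n * (-1) ^ (p : ℕ) * (star x ⬝ᵥ (Q.map Complex.ofReal *ᵥ x)) := by
  have h1 := F.positive p x hx hx0
  have h2 : star (complexForm Q x (star x)) = star x ⬝ᵥ (Q.map Complex.ofReal *ᵥ x) := by
    simp [complexForm, dotProduct, Matrix.mulVec, mul_comm]
  have h3 : star (Complex.I ^ (((p : ℕ) : ℤ) - ((n : ℤ) - ((p : ℕ) : ℤ)))) =
      Complex.I ^ n * (-1) ^ (p : ℕ) := by
    have h4 : star Complex.I = Complex.I⁻¹ := by simp
    rw [star_zpow₀, h4, inv_zpow', neg_sub, zpow_sub₀ Complex.I_ne_zero,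
      zpow_sub₀ Complex.I_ne_zero, zpow_natCast, zpow_natCast, div_div, ← mul_pow, Complex.I_mul_I,
      div_eq_mul_inv, ← inv_pow]
    norm_num
  have h5 := star_pos_iff.2 h1
  rwa [star_mul', h2, h3] at h5

theorem conjTranspose_parity_mul :
    F.parityᴴ * Q.map Complex.ofReal = Q.map Complex.ofReal * F.parity := by
  simp only [parity, Matrix.conjTranspose_sum, Matrix.conjTranspose_smul, Finset.sum_mul,
    Finset.mul_sum, Matrix.smul_mul, Matrix.mul_smul, conjTranspose_proj_mul]
  simp

theorem conjTranspose_filProj_mul (k : ℕ) :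
    (F.filProj k)ᴴ * Q.map Complex.ofReal = Q.map Complex.ofReal * F.filProj k := by
  simp only [filProj, Matrix.conjTranspose_sum, Finset.sum_mul, Finset.mul_sum,
    conjTranspose_proj_mul]

theorem conjTranspose_grading_mul :
    F.gradingᴴ * Q.map Complex.ofReal = Q.map Complex.ofReal * F.grading := by
  simp only [grading, Matrix.conjTranspose_sum, Matrix.conjTranspose_smul, Finset.sum_mul,
    Finset.mul_sum, Matrix.smul_mul, Matrix.mul_smul, conjTranspose_proj_mul]
  simp

theorem conjTranspose_map_ofReal (hQ : Q.transpose = (-1 : ℝ) ^ n • Q) :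
    (Q.map Complex.ofReal)ᴴ = ((-1 : ℂ) ^ n) • Q.map Complex.ofReal := by
  ext i j
  have := congrFun (congrFun hQ i) j
  simp only [Matrix.transpose_apply, Matrix.smul_apply, smul_eq_mul] at this
  simp [Matrix.conjTranspose_apply, this]

theorem posDef_hodgeForm (hQ : Q.transpose = (-1 : ℝ) ^ n • Q) : F.hodgeForm.PosDef := by
  refine Matrix.PosDef.of_dotProduct_mulVec_pos ?_ fun x hx => ?_
  · rw [Matrix.IsHermitian, hodgeForm, Matrix.conjTranspose_smul, Matrix.conjTranspose_mul,
      conjTranspose_map_ofReal hQ, Matrix.mul_smul, conjTranspose_parity_mul, smul_smul]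
    congr 1
    rw [star_pow, ← mul_pow]
    simp
  · have h1 : star x ⬝ᵥ (F.hodgeForm *ᵥ x) = ∑ p : Fin (n + 1), Complex.I ^ n * (-1) ^ (p : ℕ) *
        (star (F.proj p *ᵥ x) ⬝ᵥ (Q.map Complex.ofReal *ᵥ (F.proj p *ᵥ x))) := by
      have h2 : ∀ p, star (F.proj p *ᵥ x) ⬝ᵥ (Q.map Complex.ofReal *ᵥ (F.proj p *ᵥ x)) =
          star x ⬝ᵥ (Q.map Complex.ofReal *ᵥ (F.proj p *ᵥ x)) := by
        intro p
        conv_rhs => rw [← F.sum_proj_mulVec x]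
        rw [star_sum, sum_dotProduct, Finset.sum_eq_single p]
        · rw [F.sum_proj_mulVec x]
        · intro q _ hq
          exact F.dotProduct_star_eq_zero hq (F.proj_mulVec_mem q x) (F.proj_mulVec_mem p _)
        · simp
      simp only [h2]
      simp only [hodgeForm, parity, Matrix.mul_smul, Matrix.smul_mulVec,
        Matrix.sum_mulVec, dotProduct_smul, dotProduct_sum, smul_eq_mul, Finset.mul_sum,
        Matrix.mulVec_mulVec, mul_assoc]
    rw [h1]
    have hne : ∃ p, F.proj p *ᵥ x ≠ 0 := by
      by_contra! h0
      apply hx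
      rw [← F.sum_proj_mulVec x]
      exact Finset.sum_eq_zero fun p _ => h0 p
    obtain ⟨p, hp⟩ := hne
    refine Finset.sum_pos' (fun q _ => ?_) ⟨p, Finset.mem_univ p,
      F.hodgeForm_pos_of_mem (F.proj_mulVec_mem p x) hp⟩
    by_cases hq : F.proj q *ᵥ x = 0
    · simp [hq]
    · exact (F.hodgeForm_pos_of_mem (F.proj_mulVec_mem q x) hq).le

theorem isUnit_det_map (F : ClassifyingSpace Q n h)
    (hQ : Q.transpose = (-1 : ℝ) ^ n • Q) : IsUnit (Q.map Complex.ofReal).det := by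
  have h1 := (Matrix.isUnit_iff_isUnit_det _).1 (F.posDef_hodgeForm hQ).isUnit
  rw [hodgeForm, Matrix.det_smul, Matrix.det_mul] at h1
  exact isUnit_of_mul_isUnit_left (isUnit_of_mul_isUnit_right h1)

theorem isUnit_det (F : ClassifyingSpace Q n h) (hQ : Q.transpose = (-1 : ℝ) ^ n • Q) :
    IsUnit Q.det := by
  have h1 := F.isUnit_det_map hQ
  have h2 : (Q.map Complex.ofReal).det = Complex.ofReal Q.det :=
    (RingHom.map_det Complex.ofRealHom Q).symm
  rw [h2, isUnit_iff_ne_zero] at h1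
  rw [isUnit_iff_ne_zero]
  exact_mod_cast h1

theorem proj_mul_grading (p : Fin (n + 1)) : F.proj p * F.grading = ((p : ℕ) : ℂ) • F.proj p := by
  simp only [grading, Finset.mul_sum, Matrix.mul_smul, proj_mul_proj]
  simp

theorem grading_mul_proj (p : Fin (n + 1)) : F.grading * F.proj p = ((p : ℕ) : ℂ) • F.proj p := by
  simp only [grading, Finset.sum_mul, Matrix.smul_mul, proj_mul_proj]
  simp

/-- The block of Z from type b to type a has weight a - b under the grading. -/
theorem proj_mul_mul_proj_eq_zero {Z : Matrix ι ι ℂ} {r : ℂ}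
    (hZ : F.grading * Z - Z * F.grading = r • Z) {a b : Fin (n + 1)}
    (hab : ((a : ℕ) : ℂ) - ((b : ℕ) : ℂ) ≠ r) : F.proj a * Z * F.proj b = 0 := by
  have h1 := congrArg (fun M => F.proj a * M * F.proj b) hZ
  simp only [mul_sub, sub_mul, Matrix.mul_smul, Matrix.smul_mul] at h1
  rw [← mul_assoc (F.proj a) F.grading, proj_mul_grading, ← mul_assoc (F.proj a) Z,
    mul_assoc (F.proj a * Z) F.grading, grading_mul_proj, Matrix.mul_smul, Matrix.smul_mul,
    Matrix.smul_mul, ← sub_smul, ← sub_eq_zero, ← sub_smul] at h1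
  exact (smul_eq_zero.1 h1).resolve_left (sub_ne_zero.2 hab)

theorem sum_proj_mul_mul_proj (Z : Matrix ι ι ℂ) : ∑ a, ∑ b, F.proj a * Z * F.proj b = Z := by
  simp only [← Finset.mul_sum, sum_proj, mul_one, ← Finset.sum_mul, one_mul]

theorem parity_mul_mul_parity (Z : Matrix ι ι ℂ) : F.parity * Z * F.parity =
    ∑ a : Fin (n + 1), ∑ b : Fin (n + 1),
      ((-1) ^ ((a : ℕ) + b) : ℂ) • (F.proj a * Z * F.proj b) := by
  simp only [parity, Finset.sum_mul, Finset.mul_sum, Matrix.smul_mul, Matrix.mul_smul, smul_smul,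
    pow_add]
  rw [Finset.sum_comm]
  refine Finset.sum_congr rfl fun a _ => Finset.sum_congr rfl fun b _ => ?_
  rw [mul_comm]

theorem parity_mul_mul_parity_of_degree_neg_one {Z : Matrix ι ι ℂ}
    (hZ : F.grading * Z - Z * F.grading = -Z) : F.parity * Z * F.parity = -Z := by
  rw [parity_mul_mul_parity]
  conv_rhs => rw [← F.sum_proj_mul_mul_proj Z, ← Finset.sum_neg_distrib]
  refine Finset.sum_congr rfl fun a _ => ?_
  rw [← Finset.sum_neg_distrib]
  refine Finset.sum_congr rfl fun b _ => ?_
  by_cases hab : (b : ℕ) = a + 1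
  · rw [hab, ← add_assoc, pow_succ, ← two_mul, pow_mul]
    simp
  · rw [F.proj_mul_mul_proj_eq_zero (r := -1) (by rw [hZ, neg_one_smul]), smul_zero, neg_zero]
    intro h1
    apply hab
    have h2 : ((b : ℕ) : ℂ) = ((a : ℕ) : ℂ) + 1 := by linear_combination -h1
    exact_mod_cast h2

theorem parity_mul_mul_parity_of_degree_zero {Z : Matrix ι ι ℂ}
    (hZ : F.grading * Z = Z * F.grading) : F.parity * Z * F.parity = Z := by
  rw [parity_mul_mul_parity]
  conv_rhs => rw [← F.sum_proj_mul_mul_proj Z]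
  refine Finset.sum_congr rfl fun a _ => Finset.sum_congr rfl fun b _ => ?_
  by_cases hab : (b : ℕ) = a
  · rw [hab, ← two_mul, pow_mul]
    simp
  · rw [F.proj_mul_mul_proj_eq_zero (r := 0) (by rw [hZ, sub_self, zero_smul]), smul_zero]
    intro h1
    apply hab
    have h2 : ((b : ℕ) : ℂ) = ((a : ℕ) : ℂ) := by linear_combination -h1
    exact_mod_cast h2

end ClassifyingSpace

/-! ### The flat adjoint, signs of its trace form, and Hodge numbers -/

section FlatAdjoint

variable {ι : Type*} [Fintype ι] [DecidableEq ι]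

/-- The adjoint of an endomorphism for the flat sesquilinear form `Q(x, ȳ)`. -/
def flatAdjoint (Q : Matrix ι ι ℝ) (Z : Matrix ι ι ℂ) : Matrix ι ι ℂ :=
  (Q.map Complex.ofReal)⁻¹ * Zᴴ * Q.map Complex.ofReal

variable {Q : Matrix ι ι ℝ} {n : ℕ} {h : Fin (n + 1) → ℕ}

theorem flatAdjoint_eq_self (hdet : IsUnit (Q.map Complex.ofReal).det) {Z : Matrix ι ι ℂ}
    (hZ : Zᴴ * Q.map Complex.ofReal = Q.map Complex.ofReal * Z) : flatAdjoint Q Z = Z := by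
  rw [flatAdjoint, mul_assoc, hZ, Matrix.nonsing_inv_mul_cancel_left _ _ hdet]

theorem flatAdjoint_mul (hdet : IsUnit (Q.map Complex.ofReal).det) (Y Z : Matrix ι ι ℂ) :
    flatAdjoint Q (Y * Z) = flatAdjoint Q Z * flatAdjoint Q Y := by
  simp only [flatAdjoint, Matrix.conjTranspose_mul, mul_assoc,
    Matrix.mul_nonsing_inv_cancel_left _ _ hdet]

theorem flatAdjoint_flatAdjoint (hQ : Q.transpose = (-1 : ℝ) ^ n • Q)
    (hdet : IsUnit (Q.map Complex.ofReal).det) (Z : Matrix ι ι ℂ) :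
    flatAdjoint Q (flatAdjoint Q Z) = Z := by
  have h1 := ClassifyingSpace.conjTranspose_map_ofReal hQ
  have h0 : ((-1 : ℂ) ^ n) * ((-1 : ℂ) ^ n) = 1 := by rw [← mul_pow]; simp
  have h2 : ((Q.map Complex.ofReal)⁻¹)ᴴ = ((-1 : ℂ) ^ n) • (Q.map Complex.ofReal)⁻¹ := by
    rw [Matrix.conjTranspose_nonsing_inv, h1]
    refine Matrix.inv_eq_left_inv ?_
    rw [Matrix.smul_mul, Matrix.mul_smul, smul_smul, h0, one_smul, Matrix.nonsing_inv_mul _ hdet]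
  simp only [flatAdjoint, Matrix.conjTranspose_mul, Matrix.conjTranspose_conjTranspose, h1, h2,
    Matrix.smul_mul, Matrix.mul_smul, smul_smul, h0, one_smul, mul_assoc,
    Matrix.nonsing_inv_mul_cancel_left _ _ hdet, Matrix.nonsing_inv_mul _ hdet, mul_one]

theorem trace_flatAdjoint (hdet : IsUnit (Q.map Complex.ofReal).det) (Z : Matrix ι ι ℂ) :
    (flatAdjoint Q Z).trace = star Z.trace := by
  rw [flatAdjoint, Matrix.trace_mul_comm, Matrix.mul_nonsing_inv_cancel_left _ _ hdet,
    Matrix.trace_conjTranspose]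

namespace ClassifyingSpace

variable (F : ClassifyingSpace Q n h)

/-- The adjoint for the Hodge inner product is the flat adjoint conjugated by the parity operator;
comparing the two yields the signs below. -/
theorem hodgeForm_mul_parity_flatAdjoint (hQ : Q.transpose = (-1 : ℝ) ^ n • Q)
    (Z : Matrix ι ι ℂ) :
    F.hodgeForm * (F.parity * flatAdjoint Q Z * F.parity) = Zᴴ * F.hodgeForm := by
  have hdet := F.isUnit_det_map hQ
  rw [hodgeForm, Matrix.smul_mul, Matrix.mul_smul]
  congr 1
  rw [mul_assoc, mul_assoc, ← mul_assoc F.parity F.parity, parity_mul_parity, one_mul, flatAdjoint,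
    mul_assoc, mul_assoc, Matrix.mul_nonsing_inv_cancel_left _ _ hdet]

/-- Conjugation by parity changes the sign of an operator of degree -1, so the flat trace form is
minus the Hodge square norm there. In degree 0 there is no sign. -/
theorem trace_mul_flatAdjoint_neg (hQ : Q.transpose = (-1 : ℝ) ^ n • Q) {Z : Matrix ι ι ℂ}
    (hZ : F.grading * Z - Z * F.grading = -Z) (hZ0 : Z ≠ 0) :
    (Z * flatAdjoint Q Z).trace.re < 0 := by
  have h1 := (exists_trace_eq_of_posDef (F.posDef_hodgeForm hQ)
    (F.hodgeForm_mul_parity_flatAdjoint hQ Z)).2 hZ0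
  rw [← mul_assoc, Matrix.trace_mul_comm, ← mul_assoc, ← mul_assoc,
    F.parity_mul_mul_parity_of_degree_neg_one hZ, Matrix.neg_mul, Matrix.trace_neg,
    Complex.neg_re] at h1
  linarith

theorem trace_mul_flatAdjoint_nonneg (hQ : Q.transpose = (-1 : ℝ) ^ n • Q) {Z : Matrix ι ι ℂ}
    (hZ : F.grading * Z = Z * F.grading) : 0 ≤ (Z * flatAdjoint Q Z).trace.re := by
  have h1 := (exists_trace_eq_of_posDef (F.posDef_hodgeForm hQ)
    (F.hodgeForm_mul_parity_flatAdjoint hQ Z)).1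
  rwa [← mul_assoc, Matrix.trace_mul_comm, ← mul_assoc, ← mul_assoc,
    F.parity_mul_mul_parity_of_degree_zero hZ] at h1

theorem trace_proj (p : Fin (n + 1)) : (F.proj p).trace = h p := by
  have h1 : LinearMap.IsProj (F.comp p) (F.projLinear p) :=
    ⟨fun x => by rw [← proj_mulVec]; exact F.proj_mulVec_mem p x,
      fun x hx => by rw [← proj_mulVec, F.proj_mulVec_of_mem hx, if_pos rfl]⟩
  rw [← F.finrank_comp p, ← h1.trace, LinearMap.trace_eq_matrix_trace ℂ (Pi.basisFun ℂ ι), proj,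
    LinearMap.toMatrix_eq_toMatrix']

theorem trace_grading_mul_grading :
    (F.grading * F.grading).trace = ∑ p : Fin (n + 1), ((p : ℕ) : ℂ) * (p : ℕ) * h p := by
  rw [grading, sum_smul_proj_mul, Matrix.trace_sum]
  simp [trace_proj]

theorem sum_hodgeNumbers (F : ClassifyingSpace Q n h) : ∑ p, h p = Fintype.card ι := by
  have h1 := congrArg Matrix.trace F.sum_proj
  rw [Matrix.trace_sum, Matrix.trace_one] at h1
  simp only [trace_proj] at h1
  exact_mod_cast h1

theorem one_le_of_proj_ne_zero {p : Fin (n + 1)} (hp : F.proj p ≠ 0) : 1 ≤ h p := by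
  by_contra h0
  apply hp
  have h1 : Module.finrank ℂ (F.comp p) = 0 := by rw [F.finrank_comp]; omega
  have h2 : F.comp p = ⊥ := Submodule.finrank_eq_zero.1 h1
  refine Matrix.ext_of_mulVec_single fun i => ?_
  have h3 := F.proj_mulVec_mem p (Pi.single i 1)
  rw [h2, Submodule.mem_bot] at h3
  rw [h3, Matrix.zero_mulVec]

/-- In even weight, nonzero operators of degree `-1` only exist in dimension at least three. -/
theorem three_le_card (hn : Even n) {Z : Matrix ι ι ℂ}
    (hZ : F.grading * Z - Z * F.grading = -Z) (hZ0 : Z ≠ 0) : 3 ≤ Fintype.card ι := by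
  have hex : ∃ a b, F.proj a * Z * F.proj b ≠ 0 := by
    by_contra! h0
    exact hZ0 (by rw [← F.sum_proj_mul_mul_proj Z]; simp [h0])
  obtain ⟨a, b, hab⟩ := hex
  have hb : (b : ℕ) = a + 1 := by
    by_contra hne
    refine hab (F.proj_mul_mul_proj_eq_zero (r := -1) (by rw [hZ, neg_one_smul]) fun h1 => hne ?_)
    have h2 : ((b : ℕ) : ℂ) = ((a : ℕ) : ℂ) + 1 := by linear_combination -h1
    exact_mod_cast h2
  have hpa : F.proj a ≠ 0 := fun h0 => hab (by simp [h0])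
  have hpb : F.proj b ≠ 0 := fun h0 => hab (by simp [h0])
  have hrev : ∀ p, F.proj p ≠ 0 → F.proj p.rev ≠ 0 := by
    intro p hp h0
    apply hp
    rw [← p.rev_rev, ← map_star_proj, h0]
    ext i j
    simp
  -- Hodge symmetry supplies a third type. As a + b = 2a + 1 is odd and n is even, reflection never
  -- exchanges a and b; if a is the middle type take n - b, otherwise n - a.
  have hc : ∃ c, F.proj c ≠ 0 ∧ c ≠ a ∧ c ≠ b := by
    obtain ⟨k, hk⟩ := hn
    have ha2 := a.2
    have hb2 := b.2
    by_cases h1 : a.rev = a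
    · refine ⟨b.rev, hrev b hpb, fun h2 => ?_, fun h2 => ?_⟩
      all_goals
        have h1' := congrArg Fin.val h1
        have h2' := congrArg Fin.val h2
        simp only [Fin.val_rev] at h1' h2'
        omega
    · refine ⟨a.rev, hrev a hpa, h1, fun h2 => ?_⟩
      have h2' := congrArg Fin.val h2
      simp only [Fin.val_rev] at h2'
      omega
  obtain ⟨c, hpc, hca, hcb⟩ := hc
  have hne : a ≠ b := fun h0 => by rw [h0] at hb; omega
  have h1 : ∑ p ∈ {a, b, c}, h p ≤ ∑ p, h p :=
    Finset.sum_le_sum_of_subset (Finset.subset_univ _)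
  rw [Finset.sum_insert (by simp [hne, hca.symm]), Finset.sum_insert (by simp [hcb.symm]),
    Finset.sum_singleton, F.sum_hodgeNumbers] at h1
  have := F.one_le_of_proj_ne_zero hpa
  have := F.one_le_of_proj_ne_zero hpb
  have := F.one_le_of_proj_ne_zero hpc
  omega

end ClassifyingSpace

end FlatAdjoint

/-! ### Derivatives of filtrations -/

section FiltrationAlgebra

variable {𝓐 : Type*} [Ring 𝓐]

/-- `P k` are the projections onto the steps of a filtration and `D k` their derivatives in a
horizontal direction. -/
structure IsHorizontalVariation (P D : ℕ → 𝓐) : Prop where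
  mul : ∀ k l, P k * P l = P (max k l)
  leibniz : ∀ k, D k * P k + P k * D k = D k
  horizontal : ∀ k, P k * (D (k + 1) * P (k + 1)) = D (k + 1) * P (k + 1)
  vanish : ∀ k, D k * P (k + 1) = 0

namespace IsHorizontalVariation

variable {P D : ℕ → 𝓐}

/-- For j ≤ k this is horizontality. For j > k, multiplying the Leibniz rule for P² = P by P on the
right gives P D P = 0. -/
theorem mul_deriv (H : IsHorizontalVariation P D) (j k : ℕ) :
    P j * (D (k + 1) * P (k + 1)) = if j ≤ k then D (k + 1) * P (k + 1) else 0 := by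
  split_ifs with hjk
  · rw [← H.horizontal k, ← mul_assoc, H.mul, max_eq_right hjk]
  · have h1 : P (k + 1) * (D (k + 1) * P (k + 1)) = 0 := by
      have h2 := congrArg (· * P (k + 1)) (H.leibniz (k + 1))
      simp only [add_mul, mul_assoc] at h2
      rw [H.mul, max_self] at h2
      exact add_eq_left.1 h2
    have h3 : P j = P j * P (k + 1) := by rw [H.mul, max_eq_left (by omega)]
    rw [h3, mul_assoc, h1, mul_zero]

theorem deriv_mul (H : IsHorizontalVariation P D) (j k : ℕ) :
    D k * P k * P j = if j ≤ k then D k * P k else 0 := by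
  rw [mul_assoc, H.mul]
  split_ifs with hjk
  · rw [max_eq_left hjk]
  · have h3 : P (max k j) = P (k + 1) * P j := by
      rw [H.mul, max_eq_right (by omega), max_eq_right (by omega)]
    rw [h3, ← mul_assoc, H.vanish, zero_mul]

/-- The k-th summand survives right multiplication by P (j + 1) iff j ≤ k, and left multiplication
iff j + 1 ≤ k; only k = j remains in the difference. -/
theorem commutator_proj (H : IsHorizontalVariation P D) {n j : ℕ} (hj : j < n) :
    (∑ k ∈ Finset.range n, D (k + 1) * P (k + 1)) * P (j + 1)
      - P (j + 1) * ∑ k ∈ Finset.range n, D (k + 1) * P (k + 1) = D (j + 1) * P (j + 1) := by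
  rw [Finset.sum_mul, Finset.mul_sum, ← Finset.sum_sub_distrib, Finset.sum_eq_single j]
  · rw [H.deriv_mul, H.mul_deriv, if_pos le_rfl, if_neg (by omega), sub_zero]
  · intro k _ hk
    rw [H.deriv_mul, H.mul_deriv]
    have : j + 1 ≤ k + 1 ↔ j + 1 ≤ k := by omega
    simp [this]
  · simp [hj]

theorem commutator_grading (H : IsHorizontalVariation P D) (n : ℕ) :
    (∑ k ∈ Finset.range n, P (k + 1)) * (∑ k ∈ Finset.range n, D (k + 1) * P (k + 1))
      - (∑ k ∈ Finset.range n, D (k + 1) * P (k + 1)) * (∑ k ∈ Finset.range n, P (k + 1))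
      = -∑ k ∈ Finset.range n, D (k + 1) * P (k + 1) := by
  rw [Finset.sum_mul, Finset.mul_sum, ← Finset.sum_sub_distrib, ← Finset.sum_neg_distrib]
  refine Finset.sum_congr rfl fun j hj => ?_
  rw [← H.commutator_proj (Finset.mem_range.1 hj), neg_sub]

end IsHorizontalVariation

end FiltrationAlgebra

/-! ### Smoothness of the Hodge projections -/

section Smooth

variable {E : Type*} [NormedAddCommGroup E] [NormedSpace ℝ E]

theorem contDiffAt_det {m : Type*} [Fintype m] [DecidableEq m] {M : E → Matrix m m ℂ} {z : E}
    (hM : ∀ i j, ContDiffAt ℝ ∞ (fun y => M y i j) z) : ContDiffAt ℝ ∞ (fun y => (M y).det) z := by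
  simp only [Matrix.det_apply]
  refine ContDiffAt.sum fun σ _ => ContDiffAt.const_smul _ (contDiffAt_prod fun i _ => hM _ _)

theorem contDiffAt_inv_apply {m : Type*} [Fintype m] [DecidableEq m] {M : E → Matrix m m ℂ} {z : E}
    (hM : ∀ i j, ContDiffAt ℝ ∞ (fun y => M y i j) z) (hdet : IsUnit (M z).det) (i j : m) :
    ContDiffAt ℝ ∞ (fun y => (M y)⁻¹ i j) z := by
  simp only [Matrix.inv_def, Ring.inverse_eq_inv', Matrix.smul_apply, smul_eq_mul,
    Matrix.adjugate_apply]
  refine ((contDiffAt_det hM).inv hdet.ne_zero).mul (contDiffAt_det fun a b => ?_)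
  simp only [Matrix.updateRow_apply]
  split_ifs
  · exact contDiffAt_const
  · exact hM _ _

theorem contDiffAt_mul_apply {l m k : Type*} [Fintype m] {M : E → Matrix l m ℂ}
    {M' : E → Matrix m k ℂ} {z : E} (hM : ∀ i j, ContDiffAt ℝ ∞ (fun y => M y i j) z)
    (hM' : ∀ i j, ContDiffAt ℝ ∞ (fun y => M' y i j) z) (i : l) (j : k) :
    ContDiffAt ℝ ∞ (fun y => (M y * M' y) i j) z := by
  simp only [Matrix.mul_apply]
  exact ContDiffAt.sum fun a _ => (hM i a).mul (hM' a j)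

open scoped Matrix.Norms.Operator in
theorem contDiffAt_of_apply {ι : Type*} [Fintype ι] [DecidableEq ι] {M : E → Matrix ι ι ℂ} {z : E}
    (hM : ∀ i j, ContDiffAt ℝ ∞ (fun y => M y i j) z) : ContDiffAt ℝ ∞ M z := by
  have h1 : M = fun y => ∑ i, ∑ j, M y i j • (Matrix.single i j 1 : Matrix ι ι ℂ) := by
    funext y
    conv_lhs => rw [Matrix.matrix_eq_sum_single (M y)]
    simp
  rw [h1]
  exact ContDiffAt.sum fun i _ => ContDiffAt.sum fun j _ => (hM i j).smul contDiffAt_const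

end Smooth

/-! ### Frame formula for the Hodge projections -/

section FilProj

variable {ι : Type*} [Fintype ι] [DecidableEq ι]
variable {Q : Matrix ι ι ℝ} {n : ℕ} {h : Fin (n + 1) → ℕ}

/-- The projection onto a step of the Hodge filtration in terms of a frame. -/
theorem ClassifyingSpace.filProj_eq_of_frame (F : ClassifyingSpace Q n h)
    (hQ : Q.transpose = (-1 : ℝ) ^ n • Q) (k : ℕ) {m : ℕ} (A : Matrix ι (Fin m) ℂ)
    (hind : LinearIndependent ℂ A.col) (hspan : Submodule.span ℂ (Set.range A.col) = F.fil k) :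
    IsUnit (Aᴴ * Q.map Complex.ofReal * A).det ∧ F.filProj k =
      A * (Aᴴ * Q.map Complex.ofReal * A)⁻¹ * (Aᴴ * Q.map Complex.ofReal) := by
  set S := Q.map Complex.ofReal with hS
  have hdet : IsUnit S.det := F.isUnit_det_map hQ
  have hPA : F.filProj k * A = A := by
    refine Matrix.ext_of_mulVec_single fun j => ?_
    rw [← Matrix.mulVec_mulVec, Matrix.mulVec_single_one, ← F.mem_fil_iff, ← hspan]
    exact Submodule.subset_span ⟨j, rfl⟩
  have hAP : Aᴴ * S * F.filProj k = Aᴴ * S := by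
    rw [Matrix.mul_assoc, hS, ← F.conjTranspose_filProj_mul, ← Matrix.mul_assoc,
      ← Matrix.conjTranspose_mul, hPA]
  have hL : ∃ L : Matrix (Fin m) ι ℂ, F.filProj k = A * L := by
    have h1 : ∀ i, ∃ c : Fin m → ℂ, A *ᵥ c = F.filProj k *ᵥ Pi.single i 1 := by
      intro i
      have h2 : F.filProj k *ᵥ Pi.single i 1 ∈ Submodule.span ℂ (Set.range A.col) := by
        rw [hspan, F.mem_fil_iff, Matrix.mulVec_mulVec, F.filProj_mul_filProj, max_self]
      obtain ⟨c, hc⟩ := (Submodule.mem_span_range_iff_exists_fun ℂ).1 h2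
      refine ⟨c, ?_⟩
      rw [← hc, Matrix.mulVec_eq_sum]
      simp [Matrix.col]
    choose c hc using h1
    refine ⟨Matrix.of fun j i => c i j, Matrix.ext_of_mulVec_single fun i => ?_⟩
    rw [← hc i, ← Matrix.mulVec_mulVec, Matrix.mulVec_single_one]
    rfl
  obtain ⟨L, hL⟩ := hL
  -- The flat form is nondegenerate on F^k: S A factors through the Gram matrix, so the kernel of
  -- the latter is killed by S A, hence by A, hence is zero.
  have hunit : IsUnit (Aᴴ * S * A).det := by
    rw [← Matrix.isUnit_iff_isUnit_det, ← Matrix.mulVec_injective_iff_isUnit]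
    refine (injective_iff_map_eq_zero (Matrix.mulVecLin (Aᴴ * S * A))).2 fun c hc => ?_
    rw [Matrix.mulVecLin_apply] at hc
    have h1 : S *ᵥ (A *ᵥ c) = 0 := by
      have h2 : S * A = Lᴴ * (Aᴴ * S * A) := by
        conv_lhs => rw [← hPA, ← Matrix.mul_assoc, hS, ← F.conjTranspose_filProj_mul, hL]
        rw [Matrix.conjTranspose_mul]
        simp only [Matrix.mul_assoc, hS]
      rw [Matrix.mulVec_mulVec, h2, ← Matrix.mulVec_mulVec, hc, Matrix.mulVec_zero]
    have h3 : A *ᵥ c = 0 := by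
      have h4 := congrArg (S⁻¹ *ᵥ ·) h1
      simpa [Matrix.mulVec_mulVec, Matrix.nonsing_inv_mul_cancel_left _ _ hdet] using h4
    exact (Matrix.mulVec_injective_iff.2 hind) (by simpa using h3)
  refine ⟨hunit, ?_⟩
  have h1 : A * (Aᴴ * S * A)⁻¹ * (Aᴴ * S) * F.filProj k = A * (Aᴴ * S * A)⁻¹ * (Aᴴ * S) := by
    rw [Matrix.mul_assoc, hAP]
  rw [← h1, hL]
  have h2 : A * (Aᴴ * S * A)⁻¹ * (Aᴴ * S) * (A * L) =
      A * ((Aᴴ * S * A)⁻¹ * (Aᴴ * S * A)) * L := by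
    simp only [Matrix.mul_assoc]
  rw [h2, Matrix.nonsing_inv_mul _ hunit, Matrix.mul_one]

variable {E : Type*} [NormedAddCommGroup E] [NormedSpace ℂ E] [FiniteDimensional ℂ E]

-- The projection is not holomorphic, but the frame formula involves only a holomorphic frame, its
-- conjugate and an inverse, so it is real smooth.
open scoped Matrix.Norms.Operator in
theorem IsHorizontalImmersionOn.contDiffOn_filProj {ψ : E → ClassifyingSpace Q n h} {Ω : Set E}
    (H : IsHorizontalImmersionOn ψ Ω) (hQ : Q.transpose = (-1 : ℝ) ^ n • Q) (k : ℕ) :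
    ContDiffOn ℝ ∞ (fun y => (ψ y).filProj k) Ω := by
  intro z hz
  refine ContDiffAt.contDiffWithinAt ?_
  obtain ⟨m, s, hs⟩ := H.holomorphic k z hz
  set A : E → Matrix ι (Fin m) ℂ := fun y => Matrix.of fun i j => s j y i with hA
  have hframe : ∀ᶠ y in 𝓝 z,
      IsUnit ((A y)ᴴ * Q.map Complex.ofReal * A y).det ∧ (ψ y).filProj k =
        A y * ((A y)ᴴ * Q.map Complex.ofReal * A y)⁻¹ * ((A y)ᴴ * Q.map Complex.ofReal) := by
    filter_upwards [hs] with y hy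
    exact (ψ y).filProj_eq_of_frame hQ k (A y) hy.2.1 hy.2.2
  have hAs : ∀ i j, ContDiffAt ℝ ∞ (fun y => A y i j) z := fun i j =>
    contDiffAt_pi.1 (contDiffAt_of_eventually_differentiableAt (hs.mono fun y hy => hy.1 j)) i
  have hAh : ∀ j i, ContDiffAt ℝ ∞ (fun y => (A y)ᴴ j i) z := fun j i =>
    Complex.conjCLE.contDiff.contDiffAt.comp z (hAs i j)
  have hAQ : ∀ j i, ContDiffAt ℝ ∞ (fun y => ((A y)ᴴ * Q.map Complex.ofReal) j i) z :=
    contDiffAt_mul_apply hAh fun _ _ => contDiffAt_const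
  refine ContDiffAt.congr_of_eventuallyEq (contDiffAt_of_apply (M := fun y =>
    A y * ((A y)ᴴ * Q.map Complex.ofReal * A y)⁻¹ * ((A y)ᴴ * Q.map Complex.ofReal)) ?_)
    (hframe.mono fun y hy => hy.2)
  exact contDiffAt_mul_apply (contDiffAt_mul_apply hAs
    (contDiffAt_inv_apply (contDiffAt_mul_apply hAQ hAs) hframe.self_of_nhds.1)) hAQ

end FilProj

/-! ### The Higgs field of a horizontal slice -/

section HiggsOfSlice

open scoped Matrix.Norms.Operator

attribute [local instance 5000] PseudoMetricSpace.toUniformSpace UniformSpace.toTopologicalSpace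

variable {ι : Type*} [Fintype ι] [DecidableEq ι]
variable {Q : Matrix ι ι ℝ} {n : ℕ} {h : Fin (n + 1) → ℕ}
variable {E : Type*} [NormedAddCommGroup E] [NormedSpace ℂ E]

variable (ι) in
/-- Application of a matrix to a vector as a continuous bilinear map. -/
def mulVecCLM : Matrix ι ι ℂ →L[ℝ] (ι → ℂ) →L[ℝ] (ι → ℂ) :=
  (LinearMap.mk₂ ℝ (fun (M : Matrix ι ι ℂ) (v : ι → ℂ) => M *ᵥ v)
    (fun M M' v => Matrix.add_mulVec M M' v) (fun r M v => Matrix.smul_mulVec r M v)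
    (fun M v v' => Matrix.mulVec_add M v v')
    (fun r M v => Matrix.mulVec_smul M r v)).toContinuousBilinearMap

theorem mulVecCLM_apply (M : Matrix ι ι ℂ) (v : ι → ℂ) : mulVecCLM ι M v = M *ᵥ v := rfl

variable (Q) in
/-- The flat adjoint as a continuous linear map. -/
def flatAdjointCLM : Matrix ι ι ℂ →L[ℝ] Matrix ι ι ℂ :=
  LinearMap.toContinuousLinearMap
    { toFun := flatAdjoint Q
      map_add' := fun Y Z => by
        simp only [flatAdjoint, Matrix.conjTranspose_add, mul_add, add_mul]
      map_smul' := fun r Z => by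
        simp only [flatAdjoint, Matrix.conjTranspose_smul, star_trivial, Matrix.mul_smul,
          Matrix.smul_mul, RingHom.id_apply] }

theorem flatAdjointCLM_apply (Z : Matrix ι ι ℂ) : flatAdjointCLM Q Z = flatAdjoint Q Z := rfl

variable (ι) in
/-- The trace as a continuous linear map. -/
def traceCLM : Matrix ι ι ℂ →L[ℂ] ℂ :=
  LinearMap.toContinuousLinearMap (Matrix.traceLinearMap ι ℂ ℂ)

theorem traceCLM_apply (Z : Matrix ι ι ℂ) : traceCLM ι Z = Z.trace := rfl

theorem isTracialInvolution_flatAdjoint (hQ : Q.transpose = (-1 : ℝ) ^ n • Q)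
    (hdet : IsUnit (Q.map Complex.ofReal).det) :
    IsTracialInvolution (flatAdjointCLM Q) (traceCLM ι) where
  map_mul := flatAdjoint_mul hdet
  involutive := flatAdjoint_flatAdjoint hQ hdet
  map_smul c a := by
    simp only [flatAdjointCLM_apply, flatAdjoint, Matrix.conjTranspose_smul, Matrix.mul_smul,
      Matrix.smul_mul]
  trace_comm a b := Matrix.trace_mul_comm a b
  trace_map := trace_flatAdjoint hdet

/-- The derivative of the projection onto `F^k` along a family of Hodge structures. -/
def filDeriv (ψ : E → ClassifyingSpace Q n h) (z v : E) (k : ℕ) : Matrix ι ι ℂ :=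
  fderiv ℝ (fun y => (ψ y).filProj k) z v

/-- The Higgs field of a family of Hodge structures. -/
def higgsField (ψ : E → ClassifyingSpace Q n h) (z : E) : E →L[ℝ] Matrix ι ι ℂ :=
  ∑ k ∈ Finset.range n, ((ContinuousLinearMap.mul ℝ (Matrix ι ι ℂ)).flip
    ((ψ z).filProj (k + 1))).comp (fderiv ℝ (fun y => (ψ y).filProj (k + 1)) z)

theorem higgsField_apply (ψ : E → ClassifyingSpace Q n h) (z v : E) :
    higgsField ψ z v =
      ∑ k ∈ Finset.range n, filDeriv ψ z v (k + 1) * (ψ z).filProj (k + 1) := by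
  simp [higgsField, filDeriv]

theorem ClassifyingSpace.fil_antitone (F : ClassifyingSpace Q n h) {k l : ℕ} (hkl : k ≤ l) :
    F.fil l ≤ F.fil k := fun x hx => by
  rw [F.mem_fil_iff] at hx ⊢
  rw [← hx, Matrix.mulVec_mulVec, F.filProj_mul_filProj, max_eq_right hkl]

theorem ClassifyingSpace.filProj_mulVec_mem (F : ClassifyingSpace Q n h) (k : ℕ) (x : ι → ℂ) :
    F.filProj k *ᵥ x ∈ F.fil k := by
  rw [F.mem_fil_iff, Matrix.mulVec_mulVec, F.filProj_mul_filProj, max_self]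

namespace IsHorizontalImmersionOn

variable {ψ : E → ClassifyingSpace Q n h} {Ω : Set E} {z : E}

theorem exists_section (H : IsHorizontalImmersionOn ψ Ω) (hz : z ∈ Ω) {k : ℕ}
    {w : ι → ℂ} (hw : w ∈ (ψ z).fil k) :
    ∃ s : E → ι → ℂ, IsHolomorphicSectionAt (fun y => (ψ y).fil k) z s ∧ s z = w := by
  obtain ⟨m, s, hs⟩ := H.holomorphic k z hz
  have hspan : Submodule.span ℂ (Set.range fun i => s i z) = (ψ z).fil k :=
    hs.self_of_nhds.2.2
  rw [← hspan] at hw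
  obtain ⟨c, hc⟩ := (Submodule.mem_span_range_iff_exists_fun ℂ).1 hw
  refine ⟨fun y => ∑ i, c i • s i y, ?_, hc⟩
  filter_upwards [hs] with y hy
  refine ⟨DifferentiableAt.fun_sum fun i _ => (hy.1 i).const_smul (c i), ?_⟩
  rw [← hy.2.2]
  exact Submodule.sum_mem _ fun i _ => Submodule.smul_mem _ _ (Submodule.subset_span ⟨i, rfl⟩)

variable [FiniteDimensional ℂ E]

theorem hasFDerivAt_filProj (H : IsHorizontalImmersionOn ψ Ω)
    (hQ : Q.transpose = (-1 : ℝ) ^ n • Q) (hΩ : IsOpen Ω) (hz : z ∈ Ω) (k : ℕ) :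
    HasFDerivAt (fun y => (ψ y).filProj k) (fderiv ℝ (fun y => (ψ y).filProj k) z) z :=
  (((H.contDiffOn_filProj hQ k).contDiffAt (hΩ.mem_nhds hz)).differentiableAt
    (by simp)).hasFDerivAt

/-- Derivative of the identity P_k s = s. -/
theorem filDeriv_mulVec (H : IsHorizontalImmersionOn ψ Ω)
    (hQ : Q.transpose = (-1 : ℝ) ^ n • Q) (hΩ : IsOpen Ω) (hz : z ∈ Ω) {k : ℕ} {s : E → ι → ℂ}
    (hs : IsHolomorphicSectionAt (fun y => (ψ y).fil k) z s) (v : E) :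
    filDeriv ψ z v k *ᵥ s z + (ψ z).filProj k *ᵥ fderiv ℂ s z v = fderiv ℂ s z v := by
  have h1 := H.hasFDerivAt_filProj hQ hΩ hz k
  have h2 := hs.self_of_nhds.1.hasFDerivAt.restrictScalars ℝ
  have h3 := (mulVecCLM ι).hasFDerivAt_of_bilinear h1 h2
  have h4 : (fun y => mulVecCLM ι ((ψ y).filProj k) (s y)) =ᶠ[𝓝 z] s := by
    filter_upwards [hs] with y hy
    exact ((ψ y).mem_fil_iff k (s y)).1 hy.2
  have h5 := DFunLike.congr_fun (h3.unique (h2.congr_of_eventuallyEq h4)) v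
  simpa [mulVecCLM_apply, filDeriv, add_comm] using h5

theorem isHorizontalVariation (H : IsHorizontalImmersionOn ψ Ω)
    (hQ : Q.transpose = (-1 : ℝ) ^ n • Q) (hΩ : IsOpen Ω) (hz : z ∈ Ω) (v : E) :
    IsHorizontalVariation (fun k => (ψ z).filProj k) (fun k => filDeriv ψ z v k) where
  mul := (ψ z).filProj_mul_filProj
  leibniz k := by
    have h1 := H.hasFDerivAt_filProj hQ hΩ hz k
    have h2 := h1.mul' h1
    have h3 : (fun y => (ψ y).filProj k * (ψ y).filProj k) = fun y => (ψ y).filProj k := by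
      funext y
      rw [(ψ y).filProj_mul_filProj, max_self]
    have h3' : (fun y => (ψ y).filProj k) * (fun y => (ψ y).filProj k) =
      fun y => (ψ y).filProj k := h3
    rw [h3'] at h2
    have h4 := DFunLike.congr_fun (h2.unique h1) v
    simpa [filDeriv, add_comm] using h4
  horizontal k := by
    refine Matrix.ext_of_mulVec_single fun i => ?_
    rw [← Matrix.mulVec_mulVec, ← Matrix.mulVec_mulVec]
    obtain ⟨s, hs, hsz⟩ := H.exists_section hz
      ((ψ z).filProj_mulVec_mem (k + 1) (Pi.single i 1))
    have h1 := H.filDeriv_mulVec hQ hΩ hz hs v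
    have h2 := ((ψ z).mem_fil_iff k _).1 (H.horizontal z hz k s hs v)
    rw [hsz] at h1
    rw [eq_sub_of_add_eq h1, Matrix.mulVec_sub, h2, Matrix.mulVec_mulVec,
      (ψ z).filProj_mul_filProj, max_eq_right (by omega)]
  -- A section of F^{k+1} is also one of F^k, and horizontality keeps its derivative in F^k, so the
  -- derivative of P_k kills it.
  vanish k := by
    refine Matrix.ext_of_mulVec_single fun i => ?_
    rw [← Matrix.mulVec_mulVec, Matrix.zero_mulVec]
    obtain ⟨s, hs, hsz⟩ := H.exists_section hz
      ((ψ z).filProj_mulVec_mem (k + 1) (Pi.single i 1))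
    have hs' : IsHolomorphicSectionAt (fun y => (ψ y).fil k) z s := by
      filter_upwards [hs] with y hy using ⟨hy.1, (ψ y).fil_antitone (by omega) hy.2⟩
    have h1 := H.filDeriv_mulVec hQ hΩ hz hs' v
    have h2 := ((ψ z).mem_fil_iff k _).1 (H.horizontal z hz k s hs v)
    rw [hsz, h2] at h1
    exact add_eq_right.1 h1

/-- On F^k the derivative of P_k acts by s ↦ (1 - P_k) ∂_v s with s holomorphic, which is complex
linear in v. -/
theorem filDeriv_I (H : IsHorizontalImmersionOn ψ Ω)
    (hQ : Q.transpose = (-1 : ℝ) ^ n • Q) (hΩ : IsOpen Ω) (hz : z ∈ Ω) (v : E) (k : ℕ) :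
    filDeriv ψ z (Complex.I • v) k * (ψ z).filProj k =
      Complex.I • (filDeriv ψ z v k * (ψ z).filProj k) := by
  refine Matrix.ext_of_mulVec_single fun i => ?_
  rw [Matrix.smul_mulVec, ← Matrix.mulVec_mulVec, ← Matrix.mulVec_mulVec]
  obtain ⟨s, hs, hsz⟩ := H.exists_section hz ((ψ z).filProj_mulVec_mem k (Pi.single i 1))
  have h1 := H.filDeriv_mulVec hQ hΩ hz hs v
  have h2 := H.filDeriv_mulVec hQ hΩ hz hs (Complex.I • v)
  rw [hsz] at h1 h2
  rw [eq_sub_of_add_eq h1, eq_sub_of_add_eq h2, map_smul, Matrix.mulVec_smul, smul_sub]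

theorem flatAdjoint_filDeriv (H : IsHorizontalImmersionOn ψ Ω)
    (hQ : Q.transpose = (-1 : ℝ) ^ n • Q) (hΩ : IsOpen Ω) (hz : z ∈ Ω) (v : E) (k : ℕ) :
    flatAdjoint Q (filDeriv ψ z v k) = filDeriv ψ z v k := by
  have h1 := H.hasFDerivAt_filProj hQ hΩ hz k
  have h2 := (flatAdjointCLM Q).hasFDerivAt.comp z h1
  have h3 : flatAdjointCLM Q ∘ (fun y => (ψ y).filProj k) = fun y => (ψ y).filProj k := by
    funext y
    exact flatAdjoint_eq_self ((ψ y).isUnit_det_map hQ) ((ψ y).conjTranspose_filProj_mul k)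
  rw [h3] at h2
  exact DFunLike.congr_fun (h2.unique h1) v

/-- Both P_k and its derivative are self-adjoint, so the second term is the remaining half of the
Leibniz rule for P_k² = P_k. Summed over k it becomes dΛ = θ + θ*. -/
theorem filDeriv_eq (H : IsHorizontalImmersionOn ψ Ω)
    (hQ : Q.transpose = (-1 : ℝ) ^ n • Q) (hΩ : IsOpen Ω) (hz : z ∈ Ω) (v : E) (k : ℕ) :
    filDeriv ψ z v k = filDeriv ψ z v k * (ψ z).filProj k
      + flatAdjoint Q (filDeriv ψ z v k * (ψ z).filProj k) := by
  have hdet := (ψ z).isUnit_det_map hQ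
  rw [flatAdjoint_mul hdet, H.flatAdjoint_filDeriv hQ hΩ hz,
    flatAdjoint_eq_self hdet ((ψ z).conjTranspose_filProj_mul k),
    (H.isHorizontalVariation hQ hΩ hz v).leibniz k]

theorem fderiv_grading_eq (H : IsHorizontalImmersionOn ψ Ω)
    (hQ : Q.transpose = (-1 : ℝ) ^ n • Q) (hΩ : IsOpen Ω) (hz : z ∈ Ω) :
    HasFDerivAt (fun y => (ψ y).grading)
      (higgsField ψ z + (flatAdjointCLM Q).comp (higgsField ψ z)) z := by
  have h1 : HasFDerivAt (fun y => (ψ y).grading)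
      (∑ k ∈ Finset.range n, fderiv ℝ (fun y => (ψ y).filProj (k + 1)) z) z := by
    simp only [ClassifyingSpace.grading_eq_sum_filProj]
    exact HasFDerivAt.fun_sum fun k _ => H.hasFDerivAt_filProj hQ hΩ hz (k + 1)
  refine h1.congr_fderiv ?_
  ext1 v
  rw [add_apply, ContinuousLinearMap.comp_apply, higgsField_apply, map_sum,
    ← Finset.sum_add_distrib, sum_apply]
  exact Finset.sum_congr rfl fun k _ => H.filDeriv_eq hQ hΩ hz v (k + 1)

theorem higgsField_degree (H : IsHorizontalImmersionOn ψ Ω)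
    (hQ : Q.transpose = (-1 : ℝ) ^ n • Q) (hΩ : IsOpen Ω) (hz : z ∈ Ω) (v : E) :
    (ψ z).grading * higgsField ψ z v - higgsField ψ z v * (ψ z).grading = -higgsField ψ z v := by
  rw [higgsField_apply, ClassifyingSpace.grading_eq_sum_filProj]
  exact (H.isHorizontalVariation hQ hΩ hz v).commutator_grading n

/-- The derivative of the Hodge filtration is the commutator with `θ - θ*`. -/
theorem filDeriv_eq_commutator (H : IsHorizontalImmersionOn ψ Ω)
    (hQ : Q.transpose = (-1 : ℝ) ^ n • Q) (hΩ : IsOpen Ω) (hz : z ∈ Ω) (v : E) (k : ℕ) :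
    filDeriv ψ z v k =
      (higgsField ψ z v - flatAdjoint Q (higgsField ψ z v)) * (ψ z).filProj k
        - (ψ z).filProj k * (higgsField ψ z v - flatAdjoint Q (higgsField ψ z v)) := by
  have hdet := (ψ z).isUnit_det_map hQ
  have hsub : ∀ Y Z : Matrix ι ι ℂ, flatAdjoint Q (Y - Z) = flatAdjoint Q Y - flatAdjoint Q Z :=
    (flatAdjointCLM Q).map_sub
  rcases Nat.eq_zero_or_pos k with rfl | hk
  · have h1 : (fun y => (ψ y).filProj 0) = fun _ => 1 := by
      funext y; exact (ψ y).filProj_zero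
    rw [filDeriv, h1, (ψ z).filProj_zero]
    simp
  by_cases hkn : n < k
  · have h1 : (fun y => (ψ y).filProj k) = fun _ => 0 := by
      funext y; exact (ψ y).filProj_of_lt hkn
    rw [filDeriv, h1, (ψ z).filProj_of_lt hkn]
    simp
  obtain ⟨j, rfl⟩ : ∃ j, k = j + 1 := ⟨k - 1, by omega⟩
  have h1 := (H.isHorizontalVariation hQ hΩ hz v).commutator_proj (n := n) (j := j) (by omega)
  simp only [← higgsField_apply] at h1
  -- The two halves of the derivative are [θ, P] and its adjoint [P, θ*].
  have h2 := congrArg (flatAdjoint Q) h1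
  rw [hsub, flatAdjoint_mul hdet, flatAdjoint_mul hdet,
    flatAdjoint_eq_self hdet ((ψ z).conjTranspose_filProj_mul (j + 1))] at h2
  rw [H.filDeriv_eq hQ hΩ hz v (j + 1), ← h2, ← h1]
  noncomm_ring

theorem higgsField_I (H : IsHorizontalImmersionOn ψ Ω)
    (hQ : Q.transpose = (-1 : ℝ) ^ n • Q) (hΩ : IsOpen Ω) (hz : z ∈ Ω) (v : E) :
    higgsField ψ z (Complex.I • v) = Complex.I • higgsField ψ z v := by
  rw [higgsField_apply, higgsField_apply, Finset.smul_sum]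
  exact Finset.sum_congr rfl fun k _ => H.filDeriv_I hQ hΩ hz v (k + 1)

/-- If θ_v = 0, every projection P_k is stationary along v, so derivatives of sections stay in F^k
and the immersion condition applies. -/
theorem higgsField_injective (H : IsHorizontalImmersionOn ψ Ω)
    (hQ : Q.transpose = (-1 : ℝ) ^ n • Q) (hΩ : IsOpen Ω) (hz : z ∈ Ω) {v : E}
    (hv : higgsField ψ z v = 0) : v = 0 := by
  refine H.immersion z hz v fun k s hs => ?_
  have h1 := H.filDeriv_mulVec hQ hΩ hz hs v
  have h0 : flatAdjoint Q (0 : Matrix ι ι ℂ) = 0 := (flatAdjointCLM Q).map_zero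
  rw [H.filDeriv_eq_commutator hQ hΩ hz, hv, h0] at h1
  rw [(ψ z).mem_fil_iff]
  simpa using h1

theorem contDiffOn_higgsField (H : IsHorizontalImmersionOn ψ Ω)
    (hQ : Q.transpose = (-1 : ℝ) ^ n • Q) (hΩ : IsOpen Ω) :
    ContDiffOn ℝ ∞ (higgsField ψ) Ω := by
  refine ContDiffOn.sum fun k _ => ?_
  have h1 := H.contDiffOn_filProj hQ (k + 1)
  exact (((ContinuousLinearMap.mul ℝ (Matrix ι ι ℂ)).flip).contDiff.comp_contDiffOn h1).clm_comp
    (h1.fderiv_of_isOpen hΩ (by simp))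

/-- The Higgs field of a horizontal slice. -/
theorem isHiggsFieldOn (H : IsHorizontalImmersionOn ψ Ω)
    (hQ : Q.transpose = (-1 : ℝ) ^ n • Q) (hΩ : IsOpen Ω) (hne : Ω.Nonempty) :
    IsHiggsFieldOn (flatAdjointCLM Q) (traceCLM ι) (1 + ∑ p : Fin (n + 1), (p : ℝ) * p * h p)
      (fun y => (ψ y).grading) (higgsField ψ) Ω where
  isOpen := hΩ
  involution := by
    obtain ⟨z, -⟩ := hne
    exact isTracialInvolution_flatAdjoint hQ ((ψ z).isUnit_det_map hQ)
  contDiffOn_grading := by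
    simp only [ClassifyingSpace.grading_eq_sum_filProj]
    exact ContDiffOn.sum fun k _ => H.contDiffOn_filProj hQ (k + 1)
  contDiffOn_higgs := H.contDiffOn_higgsField hQ hΩ
  map_grading z _ := flatAdjoint_eq_self ((ψ z).isUnit_det_map hQ) (ψ z).conjTranspose_grading_mul
  fderiv_grading z hz v := by
    rw [(H.fderiv_grading_eq hQ hΩ hz).fderiv]
    rfl
  higgs_I z hz v := H.higgsField_I hQ hΩ hz v
  higgs_degree z hz v := H.higgsField_degree hQ hΩ hz v
  injective z hz v hv := H.higgsField_injective hQ hΩ hz hv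
  trace_neg z _ a ha ha0 := (ψ z).trace_mul_flatAdjoint_neg hQ ha ha0
  trace_nonneg z _ a ha := (ψ z).trace_mul_flatAdjoint_nonneg hQ ha
  -- The summand 1 in the constant is slack that keeps it positive even if ∑ p² h^{p,n-p} = 0.
  trace_grading z _ := by
    rw [traceCLM_apply, (ψ z).trace_grading_mul_grading]
    simp

end IsHorizontalImmersionOn

end HiggsOfSlice

/-! ### The Hodge metric of a horizontal slice -/

section HodgeMetric

open scoped Matrix.Norms.Operator

attribute [local instance 5000] PseudoMetricSpace.toUniformSpace UniformSpace.toTopologicalSpace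

variable {ι : Type*} [Fintype ι] [DecidableEq ι]
variable {Q : Matrix ι ι ℝ} {n : ℕ} {h : Fin (n + 1) → ℕ}

theorem neg_one_pow_mul_self (n : ℕ) : ((-1) ^ n : ℂ) * (-1) ^ n = 1 := by
  rw [← mul_pow]; simp

theorem ClassifyingSpace.plus_inf_minus (F : ClassifyingSpace Q n h) {x : ι → ℂ}
    (hp : x ∈ F.plus) (hm : x ∈ F.minus) : x = 0 := by
  rw [F.mem_plus_iff] at hp
  rw [F.mem_minus_iff, hp, ← smul_neg] at hm
  have h1 := smul_right_injective (ι → ℂ) (pow_ne_zero n (by norm_num : (-1 : ℂ) ≠ 0)) hm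
  exact self_eq_neg.1 h1

/-- As H^+ and H^- are the eigenspaces of the parity operator, exchanging them means anticommuting
with it. -/
theorem ClassifyingSpace.isNoncompact_iff (F : ClassifyingSpace Q n h) (X : lieAlg Q) :
    F.IsNoncompact X ↔ F.parity * X.1.map Complex.ofReal = -(X.1.map Complex.ofReal * F.parity) := by
  have hplus : ∀ w, ((1 / 2 : ℂ) • (w + ((-1) ^ n : ℂ) • F.parity *ᵥ w)) ∈ F.plus := fun w => by
    rw [F.mem_plus_iff, Matrix.mulVec_smul, Matrix.mulVec_add, Matrix.mulVec_smul,
      Matrix.mulVec_mulVec, F.parity_mul_parity, Matrix.one_mulVec, smul_comm, smul_add _ w,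
      smul_smul ((-1) ^ n : ℂ) _ (F.parity *ᵥ w), neg_one_pow_mul_self, one_smul, add_comm]
  have hminus : ∀ w, ((1 / 2 : ℂ) • (w - ((-1) ^ n : ℂ) • F.parity *ᵥ w)) ∈ F.minus := fun w => by
    rw [F.mem_minus_iff, Matrix.mulVec_smul, Matrix.mulVec_sub, Matrix.mulVec_smul,
      Matrix.mulVec_mulVec, F.parity_mul_parity, Matrix.one_mulVec, smul_comm, smul_sub _ w,
      smul_smul ((-1) ^ n : ℂ) _ (F.parity *ᵥ w), neg_one_pow_mul_self, one_smul, ← smul_neg,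
      neg_sub]
  set Y := X.1.map Complex.ofReal with hY
  constructor
  · rintro ⟨h1, h2⟩
    refine Matrix.ext_of_mulVec_single fun i => ?_
    have h3 : ∀ w, (F.parity * Y) *ᵥ w = (-(Y * F.parity)) *ᵥ w := fun w => by
      have h4 := (F.mem_minus_iff _).1 (h1 _ (hplus w))
      have h5 := (F.mem_plus_iff _).1 (h2 _ (hminus w))
      simp only [act, ← hY, Matrix.mulVec_smul, Matrix.mulVec_add, Matrix.mulVec_sub] at h4 h5
      have h6 := congrArg₂ (· + ·) h4 h5
      rw [Matrix.neg_mulVec, ← Matrix.mulVec_mulVec, ← Matrix.mulVec_mulVec]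
      have e := neg_one_pow_mul_self n
      generalize ((-1) ^ n : ℂ) = ε at *
      calc F.parity *ᵥ (Y *ᵥ w) = (1 / 2 : ℂ) • (F.parity *ᵥ (Y *ᵥ w) +
              ε • F.parity *ᵥ (Y *ᵥ (F.parity *ᵥ w))) + (1 / 2 : ℂ) • (F.parity *ᵥ (Y *ᵥ w) -
              ε • F.parity *ᵥ (Y *ᵥ (F.parity *ᵥ w))) := by module
        _ = -((ε * ε) • (Y *ᵥ (F.parity *ᵥ w))) := by
          refine h6.trans ?_
          module
        _ = _ := by rw [e, one_smul]
    exact h3 _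
  · intro hPY
    have h3 : ∀ w, F.parity *ᵥ act X.1 w = -(Y *ᵥ (F.parity *ᵥ w)) := fun w => by
      rw [act, ← hY, Matrix.mulVec_mulVec, hPY, Matrix.neg_mulVec, Matrix.mulVec_mulVec]
    refine ⟨fun w hw => ?_, fun w hw => ?_⟩
    · rw [F.mem_minus_iff, h3, (F.mem_plus_iff w).1 hw, Matrix.mulVec_smul]; rfl
    · rw [F.mem_plus_iff, h3, (F.mem_minus_iff w).1 hw, Matrix.mulVec_neg, neg_neg,
        Matrix.mulVec_smul]; rfl

theorem mem_lieAlg_iff_flatAdjoint (hdet : IsUnit (Q.map Complex.ofReal).det) (X : Matrix ι ι ℝ) :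
    X ∈ lieAlg Q ↔ flatAdjoint Q (X.map Complex.ofReal) = -X.map Complex.ofReal := by
  have h1 : (X.map Complex.ofReal)ᴴ = Xᵀ.map Complex.ofReal := by
    ext i j
    simp
  have h2 : flatAdjoint Q (X.map Complex.ofReal) = -X.map Complex.ofReal ↔
      (Xᵀ * Q).map Complex.ofReal = (-(Q * X)).map Complex.ofReal := by
    have h3 : (Xᵀ * Q).map Complex.ofReal = Xᵀ.map Complex.ofReal * Q.map Complex.ofReal :=
      Matrix.map_mul (f := Complex.ofRealHom)
    have h4 : (-(Q * X)).map Complex.ofReal = -(Q.map Complex.ofReal * X.map Complex.ofReal) := by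
      have h5 : (Q * X).map Complex.ofReal = Q.map Complex.ofReal * X.map Complex.ofReal :=
        Matrix.map_mul (f := Complex.ofRealHom)
      rw [← h5]
      ext i j
      simp
    rw [h3, h4, flatAdjoint, h1, mul_assoc]
    constructor
    · intro h5
      have h6 := congrArg (Q.map Complex.ofReal * ·) h5
      simpa [Matrix.mul_nonsing_inv_cancel_left _ _ hdet] using h6
    · intro h5
      rw [h5, mul_neg, Matrix.nonsing_inv_mul_cancel_left _ _ hdet]
  rw [mem_lieAlg, h2]
  exact (Matrix.map_injective Complex.ofReal_injective).eq_iff.symm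

variable {E : Type*} [NormedAddCommGroup E] [NormedSpace ℂ E] [FiniteDimensional ℂ E]

namespace IsHorizontalImmersionOn

variable {ψ : E → ClassifyingSpace Q n h} {Ω : Set E} {z : E}

/-- Reality of θ - θ*: it equals [dΛ, Λ], and conjugation sends Λ to n - Λ and dΛ to -dΛ. -/
theorem map_star_higgsField_sub (H : IsHorizontalImmersionOn ψ Ω)
    (hQ : Q.transpose = (-1 : ℝ) ^ n • Q) (hΩ : IsOpen Ω) (hz : z ∈ Ω) (v : E) :
    (higgsField ψ z v - flatAdjoint Q (higgsField ψ z v)).map star =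
      higgsField ψ z v - flatAdjoint Q (higgsField ψ z v) := by
  have hτ := isTracialInvolution_flatAdjoint (n := n) hQ ((ψ z).isUnit_det_map hQ)
  set st : Matrix ι ι ℂ →L[ℝ] Matrix ι ι ℂ := LinearMap.toContinuousLinearMap
    (Complex.conjAe.toAlgHom.mapMatrix (m := ι)).toLinearMap with hst
  have hmul : ∀ Y Z, st (Y * Z) = st Y * st Z :=
    map_mul (Complex.conjAe.toAlgHom.mapMatrix (m := ι))
  have hone : st 1 = 1 := map_one (Complex.conjAe.toAlgHom.mapMatrix (m := ι))
  set D := higgsField ψ z v + flatAdjoint Q (higgsField ψ z v) with hD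
  have hΛ : st (ψ z).grading = (n : ℂ) • 1 - (ψ z).grading := (ψ z).map_star_grading
  have hgrad := H.fderiv_grading_eq hQ hΩ hz
  have h1 := st.hasFDerivAt.comp z hgrad
  have h2 : st ∘ (fun y => (ψ y).grading) = fun y => (n : ℂ) • 1 - (ψ y).grading :=
    funext fun y => (ψ y).map_star_grading
  rw [h2] at h1
  have h3 : st D = -D := DFunLike.congr_fun (h1.unique (hgrad.const_sub ((n : ℂ) • 1))) v
  have h4 := H.higgsField_degree hQ hΩ hz v
  have h5 := hτ.commutator_map (L := (ψ z).grading) (a := higgsField ψ z v) (r := -1)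
    (flatAdjoint_eq_self ((ψ z).isUnit_det_map hQ) (ψ z).conjTranspose_grading_mul)
    (by simpa using h4)
  simp only [flatAdjointCLM_apply, neg_neg, Complex.ofReal_one, one_smul] at h5
  have hX : higgsField ψ z v - flatAdjoint Q (higgsField ψ z v) =
      D * (ψ z).grading - (ψ z).grading * D := by
    have h7 : D * (ψ z).grading - (ψ z).grading * D =
        -((ψ z).grading * higgsField ψ z v - higgsField ψ z v * (ψ z).grading)
        - ((ψ z).grading * flatAdjoint Q (higgsField ψ z v)
          - flatAdjoint Q (higgsField ψ z v) * (ψ z).grading) := by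
      rw [hD]
      noncomm_ring
    rw [h7, h4, h5, neg_neg]
  have h6 : st (D * (ψ z).grading - (ψ z).grading * D) =
      D * (ψ z).grading - (ψ z).grading * D := by
    rw [map_sub, hmul, hmul, hΛ, h3, mul_sub, sub_mul, mul_smul_comm, smul_mul_assoc, mul_one,
      one_mul]
    noncomm_ring
  rw [hX]
  exact h6

theorem hasFDerivAt_parity (H : IsHorizontalImmersionOn ψ Ω)
    (hQ : Q.transpose = (-1 : ℝ) ^ n • Q) (hΩ : IsOpen Ω) (hz : z ∈ Ω) :
    ∃ L : E →L[ℝ] Matrix ι ι ℂ, HasFDerivAt (fun y => (ψ y).parity) L z ∧ ∀ v, L v =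
      (higgsField ψ z v - flatAdjoint Q (higgsField ψ z v)) * (ψ z).parity
        - (ψ z).parity * (higgsField ψ z v - flatAdjoint Q (higgsField ψ z v)) := by
  refine ⟨∑ k ∈ Finset.range (n + 1), ((-1) ^ k : ℂ) • (fderiv ℝ (fun y => (ψ y).filProj k) z
    - fderiv ℝ (fun y => (ψ y).filProj (k + 1)) z), ?_, fun v => ?_⟩
  · simp only [ClassifyingSpace.parity_eq_sum_filProj]
    exact HasFDerivAt.fun_sum fun k _ => ((H.hasFDerivAt_filProj hQ hΩ hz k).fun_sub
      (H.hasFDerivAt_filProj hQ hΩ hz (k + 1))).fun_const_smul _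
  · rw [sum_apply, ClassifyingSpace.parity_eq_sum_filProj, Finset.mul_sum,
      Finset.sum_mul, ← Finset.sum_sub_distrib]
    refine Finset.sum_congr rfl fun k _ => ?_
    have h1 := H.filDeriv_eq_commutator hQ hΩ hz v k
    have h2 := H.filDeriv_eq_commutator hQ hΩ hz v (k + 1)
    rw [filDeriv] at h1 h2
    rw [smul_apply, sub_apply, h1, h2, mul_smul_comm,
      smul_mul_assoc, ← smul_sub]
    congr 1
    noncomm_ring

theorem parity_mul_higgsField_sub (H : IsHorizontalImmersionOn ψ Ω)
    (hQ : Q.transpose = (-1 : ℝ) ^ n • Q) (hΩ : IsOpen Ω) (hz : z ∈ Ω) (v : E) :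
    (ψ z).parity * (higgsField ψ z v - flatAdjoint Q (higgsField ψ z v)) =
      -((higgsField ψ z v - flatAdjoint Q (higgsField ψ z v)) * (ψ z).parity) := by
  have hdet := (ψ z).isUnit_det_map hQ
  have h1 := (ψ z).parity_mul_mul_parity_of_degree_neg_one (H.higgsField_degree hQ hΩ hz v)
  have hpp := (ψ z).parity_mul_parity
  have h2 : (ψ z).parity * higgsField ψ z v = -(higgsField ψ z v * (ψ z).parity) := by
    have h3 := congrArg (· * (ψ z).parity) h1
    simpa [mul_assoc, hpp] using h3
  have h4 := congrArg (flatAdjoint Q) h2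
  have hneg : ∀ Y : Matrix ι ι ℂ, flatAdjoint Q (-Y) = -flatAdjoint Q Y :=
    (flatAdjointCLM Q).map_neg
  rw [hneg, flatAdjoint_mul hdet, flatAdjoint_mul hdet,
    flatAdjoint_eq_self hdet (ψ z).conjTranspose_parity_mul] at h4
  rw [mul_sub, sub_mul, h2, h4]
  noncomm_ring

/-- The operator θ - θ* is real, skew for Q and odd for parity. Differentiating the equation parity
· s = (-1)^n s for sections of H^+ shows that it has the velocity property. -/
theorem exists_isProjectedVelocity (H : IsHorizontalImmersionOn ψ Ω)
    (hQ : Q.transpose = (-1 : ℝ) ^ n • Q) (hΩ : IsOpen Ω) (hz : z ∈ Ω) (v : E) :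
    ∃ X : lieAlg Q, IsProjectedVelocity ψ z v X ∧
      X.1.map Complex.ofReal = higgsField ψ z v - flatAdjoint Q (higgsField ψ z v) := by
  have hdet := (ψ z).isUnit_det_map hQ
  have hmap := H.map_star_higgsField_sub hQ hΩ hz v
  have hpar := H.parity_mul_higgsField_sub hQ hΩ hz v
  obtain ⟨L, hL, hLv⟩ := H.hasFDerivAt_parity hQ hΩ hz
  specialize hLv v
  have hadj : flatAdjoint Q (higgsField ψ z v - flatAdjoint Q (higgsField ψ z v)) =
      -(higgsField ψ z v - flatAdjoint Q (higgsField ψ z v)) := by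
    have hsub : ∀ Y Z : Matrix ι ι ℂ,
        flatAdjoint Q (Y - Z) = flatAdjoint Q Y - flatAdjoint Q Z := (flatAdjointCLM Q).map_sub
    rw [hsub, flatAdjoint_flatAdjoint hQ hdet, neg_sub]
  generalize higgsField ψ z v - flatAdjoint Q (higgsField ψ z v) = X at *
  have hX : (X.map Complex.re).map Complex.ofReal = X := by
    ext i j
    exact Complex.conj_eq_iff_re.1 (congrFun (congrFun hmap i) j)
  refine ⟨⟨X.map Complex.re, ?_⟩, ⟨?_, fun s hs hsm => ?_⟩, hX⟩
  · rw [mem_lieAlg_iff_flatAdjoint hdet, hX, hadj]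
  · rw [ClassifyingSpace.isNoncompact_iff]
    simpa only [hX] using hpar
  · have h3 := (mulVecCLM ι).hasFDerivAt_of_bilinear hL hs.hasFDerivAt
    have h4 : (fun y => mulVecCLM ι (ψ y).parity (s y)) =ᶠ[𝓝 z] fun y => ((-1) ^ n : ℂ) • s y := by
      filter_upwards [hsm] with y hy
      exact ((ψ y).mem_plus_iff (s y)).1 hy
    have h5 := DFunLike.congr_fun
      (h3.unique ((hs.hasFDerivAt.const_smul ((-1) ^ n : ℂ)).congr_of_eventuallyEq h4)) v
    have h6 : (ψ z).parity *ᵥ fderiv ℝ s z v + L v *ᵥ s z = ((-1) ^ n : ℂ) • fderiv ℝ s z v := by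
      simpa [mulVecCLM_apply] using h5
    have h7 := ((ψ z).mem_plus_iff (s z)).1 hsm.self_of_nhds
    rw [hLv, hpar, sub_neg_eq_add, Matrix.add_mulVec, ← Matrix.mulVec_mulVec, h7] at h6
    simp only [act, hX]
    rw [(ψ z).mem_plus_iff, Matrix.mulVec_sub, Matrix.mulVec_mulVec, hpar, Matrix.neg_mulVec,
      ← Matrix.mulVec_mulVec, h7, smul_sub, ← h6, Matrix.mulVec_smul]
    abel

/-- The difference Z of two candidates maps H^+ into H^- by oddness and into H^+ by the velocity
condition, so it kills H^+. Skewness and oddness then make it vanish on H^- as well. -/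
theorem isProjectedVelocity_unique (H : IsHorizontalImmersionOn ψ Ω)
    (hQ : Q.transpose = (-1 : ℝ) ^ n • Q) (hΩ : IsOpen Ω) (hz : z ∈ Ω) {v : E} {X Y : lieAlg Q}
    (hX : IsProjectedVelocity ψ z v X) (hY : IsProjectedVelocity ψ z v Y) : X = Y := by
  have hdet := (ψ z).isUnit_det_map hQ
  obtain ⟨L, hL, -⟩ := H.hasFDerivAt_parity hQ hΩ hz
  have hpp := (ψ z).parity_mul_parity
  have e := neg_one_pow_mul_self n
  set Z : Matrix ι ι ℂ := X.1.map Complex.ofReal - Y.1.map Complex.ofReal with hZ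
  have hZpar : (ψ z).parity * Z = -(Z * (ψ z).parity) := by
    rw [hZ, mul_sub, sub_mul, (ClassifyingSpace.isNoncompact_iff _ X).1 hX.1,
      (ClassifyingSpace.isNoncompact_iff _ Y).1 hY.1, neg_sub_neg, neg_sub]
  have hsub : ∀ Y Z : Matrix ι ι ℂ,
    flatAdjoint Q (Y - Z) = flatAdjoint Q Y - flatAdjoint Q Z := (flatAdjointCLM Q).map_sub
  have hZadj : flatAdjoint Q Z = -Z := by
    rw [hZ, hsub, (mem_lieAlg_iff_flatAdjoint hdet X.1).1 X.2,
      (mem_lieAlg_iff_flatAdjoint hdet Y.1).1 Y.2, neg_sub_neg, neg_sub]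
  have hker : Z + ((-1) ^ n : ℂ) • (Z * (ψ z).parity) = 0 := by
    refine Matrix.ext_of_mulVec_single fun i => ?_
    set w : ι → ℂ := Pi.single i 1
    -- Twice the projection of the constant vector w to H^+: a section through every vector of H^+
    -- as w varies.
    set s : E → ι → ℂ := fun y => w + ((-1) ^ n : ℂ) • ((ψ y).parity *ᵥ w) with hs
    have hsplus : ∀ y, s y ∈ (ψ y).plus := fun y => by
      rw [(ψ y).mem_plus_iff, hs, Matrix.mulVec_add, Matrix.mulVec_smul,
        Matrix.mulVec_mulVec, (ψ y).parity_mul_parity, Matrix.one_mulVec, smul_add, smul_smul,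
        e, one_smul, add_comm]
    have hsd : DifferentiableAt ℝ s z :=
      (((((mulVecCLM ι).flip w).hasFDerivAt.comp z hL).const_smul
        ((-1) ^ n : ℂ)).const_add w).differentiableAt
    have h1 := hX.2 s hsd (Filter.Eventually.of_forall hsplus)
    have h2 := hY.2 s hsd (Filter.Eventually.of_forall hsplus)
    have h3 := Submodule.sub_mem _ h2 h1
    have h4 := Submodule.sub_mem _ (hX.1.1 _ (hsplus z)) (hY.1.1 _ (hsplus z))
    rw [sub_sub_sub_cancel_left] at h3
    have h5 := (ψ z).plus_inf_minus h3 h4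
    rw [act, act, ← Matrix.sub_mulVec, ← hZ] at h5
    rw [Matrix.add_mulVec, Matrix.smul_mulVec, Matrix.zero_mulVec, ← Matrix.mulVec_mulVec,
      ← Matrix.mulVec_smul, ← Matrix.mulVec_add]
    exact h5
  have hadd : ∀ Y Z : Matrix ι ι ℂ,
    flatAdjoint Q (Y + Z) = flatAdjoint Q Y + flatAdjoint Q Z := (flatAdjointCLM Q).map_add
  have h6 := congrArg (flatAdjoint Q) hker
  have hsm : flatAdjoint Q (((-1) ^ n : ℂ) • (Z * (ψ z).parity)) =
      ((-1) ^ n : ℂ) • flatAdjoint Q (Z * (ψ z).parity) := by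
    simp [flatAdjoint]
  have h0 : flatAdjoint Q (0 : Matrix ι ι ℂ) = 0 := (flatAdjointCLM Q).map_zero
  rw [hadd, hsm, flatAdjoint_mul hdet, flatAdjoint_eq_self hdet (ψ z).conjTranspose_parity_mul,
    hZadj, h0, mul_neg, hZpar, neg_neg] at h6
  have h7 : Z = 0 := by
    have h8 : Z = (1 / 2 : ℂ) • ((Z + ((-1) ^ n : ℂ) • (Z * (ψ z).parity))
        - (-Z + ((-1) ^ n : ℂ) • (Z * (ψ z).parity))) := by module
    rw [h8, hker, h6, sub_zero, smul_zero]
  exact Subtype.ext (Matrix.map_injective Complex.ofReal_injective (sub_eq_zero.1 h7))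

theorem existsUnique_isProjectedVelocity (H : IsHorizontalImmersionOn ψ Ω)
    (hQ : Q.transpose = (-1 : ℝ) ^ n • Q) (hΩ : IsOpen Ω) (hz : z ∈ Ω) (v : E) :
    ∃! X : lieAlg Q, IsProjectedVelocity ψ z v X := by
  obtain ⟨X, hX, -⟩ := H.exists_isProjectedVelocity hQ hΩ hz v
  exact ⟨X, hX, fun Y hY => H.isProjectedVelocity_unique hQ hΩ hz hY hX⟩

theorem map_projectedVelocity (H : IsHorizontalImmersionOn ψ Ω)
    (hQ : Q.transpose = (-1 : ℝ) ^ n • Q) (hΩ : IsOpen Ω) (hz : z ∈ Ω) (v : E) :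
    (projectedVelocity ψ z v).1.map Complex.ofReal =
      higgsField ψ z v - flatAdjoint Q (higgsField ψ z v) := by
  obtain ⟨X, hX, h1⟩ := H.exists_isProjectedVelocity hQ hΩ hz v
  have h2 : IsProjectedVelocity ψ z v (projectedVelocity ψ z v) :=
    Classical.epsilon_spec (p := fun X => IsProjectedVelocity ψ z v X) ⟨X, hX⟩
  rw [← h1, H.isProjectedVelocity_unique hQ hΩ hz h2 hX]

/-- In the expansion of tr((θ_u - θ_u*)(θ_v - θ_v*)) the terms of degree -2 and 2 are traceless, and
the mixed ones are complex conjugates. -/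
theorem trace_projectedVelocity_mul (H : IsHorizontalImmersionOn ψ Ω)
    (hQ : Q.transpose = (-1 : ℝ) ^ n • Q) (hΩ : IsOpen Ω) (hz : z ∈ Ω) (u v : E) :
    ((projectedVelocity ψ z u).1 * (projectedVelocity ψ z v).1).trace =
      -2 * (higgsField ψ z u * flatAdjoint Q (higgsField ψ z v)).trace.re := by
  have hdet := (ψ z).isUnit_det_map hQ
  have hτ : ∀ a b : E, (higgsField ψ z a * higgsField ψ z b).trace = 0 := fun a b => by
    have ha : ∀ a, (ψ z).grading * higgsField ψ z a - higgsField ψ z a * (ψ z).grading =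
        (-1 : ℂ) • higgsField ψ z a := fun a => by
      rw [neg_one_smul]
      exact H.higgsField_degree hQ hΩ hz a
    exact (isTracialInvolution_flatAdjoint hQ hdet).trace_eq_zero (by norm_num)
      (commutator_mul (ha a) (ha b))
  have h1 : (((projectedVelocity ψ z u).1 * (projectedVelocity ψ z v).1).trace : ℂ) =
      ((projectedVelocity ψ z u).1.map Complex.ofReal *
        (projectedVelocity ψ z v).1.map Complex.ofReal).trace := by
    have h2 := AddMonoidHom.map_trace Complex.ofRealHom.toAddMonoidHom
      ((projectedVelocity ψ z u).1 * (projectedVelocity ψ z v).1)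
    have h3 : ((projectedVelocity ψ z u).1 * (projectedVelocity ψ z v).1).map Complex.ofReal =
      (projectedVelocity ψ z u).1.map Complex.ofReal *
        (projectedVelocity ψ z v).1.map Complex.ofReal := Matrix.map_mul (f := Complex.ofRealHom)
    rw [← h3]
    exact h2
  have h4 : (flatAdjoint Q (higgsField ψ z u) * flatAdjoint Q (higgsField ψ z v)).trace = 0 := by
    rw [← flatAdjoint_mul hdet, trace_flatAdjoint hdet, hτ, star_zero]
  have h5 : (flatAdjoint Q (higgsField ψ z u) * higgsField ψ z v).trace =
      star (higgsField ψ z u * flatAdjoint Q (higgsField ψ z v)).trace := by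
    rw [← trace_flatAdjoint hdet, flatAdjoint_mul hdet, flatAdjoint_flatAdjoint hQ hdet,
      Matrix.trace_mul_comm]
  rw [H.map_projectedVelocity hQ hΩ hz, H.map_projectedVelocity hQ hΩ hz, sub_mul, mul_sub,
    mul_sub, Matrix.trace_sub, Matrix.trace_sub, Matrix.trace_sub, hτ, h4, h5] at h1
  have h6 := congrArg Complex.re h1
  simp only [Complex.ofReal_re, Complex.sub_re, Complex.zero_re, Complex.star_def,
    Complex.conj_re] at h6
  rw [h6]
  ring

/-- The Hodge metric is the trace form of the Higgs field. -/
theorem hodgeMetric_eq (H : IsHorizontalImmersionOn ψ Ω)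
    (hQ : Q.transpose = (-1 : ℝ) ^ n • Q) (hΩ : IsOpen Ω) (hz : z ∈ Ω) (c : ℝ) (u v : E) :
    hodgeMetric c ψ z u v = tracePairing (flatAdjointCLM Q) (traceCLM ι)
      (2 * c * max ((Fintype.card ι : ℝ) - 2 * (-1) ^ n) 1) (higgsField ψ z u)
      (higgsField ψ z v) := by
  have hε : ((-1) ^ n : ℝ) * (-1) ^ n = 1 := by rw [← mul_pow]; simp
  rw [hodgeMetric, killingForm_lieAlg hQ hε ((ψ z).isUnit_det hQ),
    H.trace_projectedVelocity_mul hQ hΩ hz, tracePairing_apply, flatAdjointCLM_apply,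
    traceCLM_apply]
  -- The maximum with 1 only serves to keep the constant positive. Where it would alter N - 2(-1)^n,
  -- every Higgs field vanishes, by `three_le_card` in even weight; in odd weight N + 2 exceeds 1
  -- anyway.
  by_cases hu : higgsField ψ z u = 0
  · simp [hu]
  have h1 : 1 ≤ (Fintype.card ι : ℝ) - 2 * (-1) ^ n := by
    rcases Nat.even_or_odd n with hn | hn
    · have h2 := (ψ z).three_le_card hn (H.higgsField_degree hQ hΩ hz u) hu
      have h3 : (3 : ℝ) ≤ Fintype.card ι := by exact_mod_cast h2
      rw [hn.neg_one_pow]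
      linarith
    · rw [hn.neg_one_pow]
      have h3 : (0 : ℝ) ≤ Fintype.card ι := Nat.cast_nonneg _
      linarith
  rw [max_eq_left h1]
  ring

theorem isKahlerOn_hodgeMetric (H : IsHorizontalImmersionOn ψ Ω)
    (hQ : Q.transpose = (-1 : ℝ) ^ n • Q) (hΩ : IsOpen Ω) {c : ℝ} (hc : 0 < c) :
    IsKahlerOn (hodgeMetric c ψ) Ω := by
  rcases Ω.eq_empty_or_nonempty with rfl | hne
  · exact ⟨by simp, by simp, by simp, by simp, by simp, by simp, by simp⟩
  · exact (H.isHiggsFieldOn hQ hΩ hne).isKahlerOn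
      (mul_pos (by positivity) (lt_max_of_lt_right one_pos))
      fun z hz => H.hodgeMetric_eq hQ hΩ hz c

theorem hodgeMetric_curvature_le (H : IsHorizontalImmersionOn ψ Ω)
    (hQ : Q.transpose = (-1 : ℝ) ^ n • Q) (hΩ : IsOpen Ω) {c : ℝ} (hc : 0 < c) (hz : z ∈ Ω) :
    (∀ u v, u ≠ 0 → v ≠ 0 → bisectionalCurvature (hodgeMetric c ψ) z u v ≤ 0) ∧
    (∀ u, u ≠ 0 → holomorphicSectionalCurvature (hodgeMetric c ψ) z u ≤
      -(1 / (2 * c * max ((Fintype.card ι : ℝ) - 2 * (-1) ^ n) 1 *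
        (1 + ∑ p : Fin (n + 1), (p : ℝ) * p * h p)))) ∧
    (∀ u, ricciCurvature (hodgeMetric c ψ) z u u ≤
      -(1 / (2 * c * max ((Fintype.card ι : ℝ) - 2 * (-1) ^ n) 1 *
        (1 + ∑ p : Fin (n + 1), (p : ℝ) * p * h p))) * hodgeMetric c ψ z u u) := by
  have hm : 0 < 2 * c * max ((Fintype.card ι : ℝ) - 2 * (-1) ^ n) 1 :=
    mul_pos (by positivity) (lt_max_of_lt_right one_pos)
  have hC : 0 < 1 + ∑ p : Fin (n + 1), (p : ℝ) * p * h p := by positivity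
  have hθ := H.isHiggsFieldOn hQ hΩ ⟨z, hz⟩
  have hg := fun y (hy : y ∈ Ω) => H.hodgeMetric_eq hQ hΩ hy c
  exact ⟨fun u v hu hv => hθ.bisectionalCurvature_nonpos hm hg hz hu hv,
    fun u hu => hθ.holomorphicSectionalCurvature_le hm hC hg hz hu,
    fun u => hθ.ricciCurvature_le hm hC hg hz u⟩

end IsHorizontalImmersionOn

end HodgeMetric

end HodgeSlice

end

/-! ### The main theorem -/

theorem theorem3 {ι : Type*} [Fintype ι] [DecidableEq ι] (n : ℕ) (Q : Matrix ι ι ℝ)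
    (hQ : Q.transpose = (-1 : ℝ) ^ n • Q) (h : Fin (n + 1) → ℕ) (c : ℝ) (hc : 0 < c) :
    ∃ κ : ℝ, 0 < κ ∧
      ∀ (d : ℕ) (M : Type*) [TopologicalSpace M] [ChartedSpace (EuclideanSpace ℂ (Fin d)) M]
        [IsManifold (modelWithCornersSelf ℂ (EuclideanSpace ℂ (Fin d))) ω M]
        (φ : M → HodgeSlice.ClassifyingSpace Q n h),
        HodgeSlice.IsHorizontalSlice (E := EuclideanSpace ℂ (Fin d)) φ →
        ∀ e ∈ atlas (EuclideanSpace ℂ (Fin d)) M,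
          (∀ z ∈ e.target, ∀ v, ∃! X : HodgeSlice.lieAlg Q,
            HodgeSlice.IsProjectedVelocity (φ ∘ e.symm) z v X) ∧
          HodgeSlice.IsKahlerOn (HodgeSlice.hodgeMetric c (φ ∘ e.symm)) e.target ∧
          ∀ z ∈ e.target,
            (∀ u v, u ≠ 0 → v ≠ 0 → HodgeSlice.bisectionalCurvature
              (HodgeSlice.hodgeMetric c (φ ∘ e.symm)) z u v ≤ 0) ∧
            (∀ u, u ≠ 0 → HodgeSlice.holomorphicSectionalCurvature
              (HodgeSlice.hodgeMetric c (φ ∘ e.symm)) z u ≤ -κ) ∧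
            (∀ u, HodgeSlice.ricciCurvature
              (HodgeSlice.hodgeMetric c (φ ∘ e.symm)) z u u ≤
                -κ * HodgeSlice.hodgeMetric c (φ ∘ e.symm) z u u) := by
  -- The constant is κ = 1/(mC), with m the factor between the Hodge metric and the trace form and C
  -- the bound for tr Λ²; neither depends on the slice.
  refine ⟨1 / (2 * c * max ((Fintype.card ι : ℝ) - 2 * (-1) ^ n) 1 *
    (1 + ∑ p : Fin (n + 1), (p : ℝ) * p * h p)), ?_, fun d M _ _ _ φ hφ e he => ?_⟩
  · exact one_div_pos.2 (mul_pos (mul_pos (by positivity) (lt_max_of_lt_right one_pos))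
      (by positivity))
  · have H := hφ e he
    exact ⟨fun z hz v => H.existsUnique_isProjectedVelocity hQ e.open_target hz v,
      H.isKahlerOn_hodgeMetric hQ e.open_target hc,
      fun z hz => H.hodgeMetric_curvature_le hQ e.open_target hc hz⟩
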